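/- Let $M$ be a smooth $8$-manifold with a $Spin(7)$-structure, i.e. a $4$-form $\Phi$ together with the Riemannian metric $g$ and the orientation it determines, such that near every point there is a smooth oriented orthonormal frame $e_0,\dots,e_7$ (with dual coframe denoted by the same letters) in which $$\Phi=-e_{0127}+e_{0236}-e_{0347}-e_{0567}+e_{0146}+e_{0245}-e_{0135}-e_{3456}-e_{1457}-e_{1256}-e_{1234}-e_{2357}-e_{1367}+e_{2467}.$$ Let $\delta=-*d*$ be the codifferential and let $\theta$ be the Lee form, $\theta_a=\frac1{42}(\delta\Phi)_{ijk}\Phi_{ijka}$; components are taken in an orthonormal frame and repeated indices are summed. Let $\nabla$ be the $Spin(7)$-torsion connection, i.e. the linear connection with $\nabla g=0$, $\nabla\Phi=0$ and totally skew-symmetric torsion $T(X,Y,Z)=g(\nabla_XY-\nabla_YX-[X,Y],Z)$; let $R(X,Y)Z=[\nabla_X,\nabla_Y]Z-\nabla_{[X,Y]}Z$ be its curvature, $Ric(X,Y)=\sum_a g(R(e_a,X)Y,e_a)$ its Ricci tensor, and put $d^\nabla\theta(X,Y)=(\nabla_X\theta)Y-(\nabla_Y\theta)X$. Then the following three conditions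 are equivalent: (a) the Ricci tensor is symmetric, $Ric(X,Y)=Ric(Y,X)$; (b) $(d^\nabla\theta)_{ij}=-\frac13\theta_s(\delta\Phi)_{sij}+\frac16\theta_s(\delta\Phi)_{sab}\Phi_{abij}$; (c) $(d^\nabla\theta)_{ij}=-\frac13\theta_sT_{sij}+\frac16\theta_sT_{sab}\Phi_{abij}$. If they hold, then also $(d^\nabla\theta)_{ij}=-\frac16(d^\nabla\theta)_{ab}\Phi_{abij}$; in particular $d^\nabla\theta$ is a section of $\Lambda^2_7=\{\beta\in\Lambda^2 : *(\beta\wedge\Phi)=-3\beta\}$. -/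

import Mathlib

open Bundle VectorField FiberBundle
open scoped Manifold ContDiff Nat

noncomputable section

namespace Spin7

/-- The model space `ℝ⁸`. -/
abbrev E8 : Type := EuclideanSpace ℝ (Fin 8)

/-- The model with corners of an 8-manifold without boundary. -/
abbrev I8 : ModelWithCorners ℝ E8 E8 := 𝓘(ℝ, E8)

/-- The tangent space `T_x M`. -/
abbrev TM {M : Type*} [TopologicalSpace M] [ChartedSpace E8 M] (x : M) : Type :=
  TangentSpace I8 x

/-! ### The standard 4-form on `ℝ⁸` -/

/-- The component `(e_q)(e_{i 0}, e_{i 1}, e_{i 2}, e_{i 3})` of the decomposable form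
`e_q = e_{q 0} ∧ e_{q 1} ∧ e_{q 2} ∧ e_{q 3}`. -/
def elem4 (q i : Fin 4 → Fin 8) : ℤ :=
  Matrix.det (Matrix.of fun a b : Fin 4 => if i a = q b then (1 : ℤ) else 0)

/-- The components `Φ_{i 0, i 1, i 2, i 3}` of the standard `Spin(7)`-form on `ℝ⁸`:
`- e₀₁₂₇ + e₀₂₃₆ - e₀₃₄₇ - e₀₅₆₇ + e₀₁₄₆ + e₀₂₄₅ - e₀₁₃₅`
`- e₃₄₅₆ - e₁₄₅₇ - e₁₂₅₆ - e₁₂₃₄ - e₂₃₅₇ - e₁₃₆₇ + e₂₄₆₇`. -/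
def stdPhi (i : Fin 4 → Fin 8) : ℤ :=
  - elem4 ![0, 1, 2, 7] i + elem4 ![0, 2, 3, 6] i - elem4 ![0, 3, 4, 7] i
  - elem4 ![0, 5, 6, 7] i + elem4 ![0, 1, 4, 6] i + elem4 ![0, 2, 4, 5] i
  - elem4 ![0, 1, 3, 5] i - elem4 ![3, 4, 5, 6] i - elem4 ![1, 4, 5, 7] i
  - elem4 ![1, 2, 5, 6] i - elem4 ![1, 2, 3, 4] i - elem4 ![2, 3, 5, 7] i
  - elem4 ![1, 3, 6, 7] i + elem4 ![2, 4, 6, 7] i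

theorem finrank_TM {M : Type*} [TopologicalSpace M] [ChartedSpace E8 M] (x : M) :
    Module.finrank ℝ (TM x) = 8 := by
  change Module.finrank ℝ E8 = 8
  simp

instance {M : Type*} [TopologicalSpace M] [ChartedSpace E8 M] (x : M) :
    FiniteDimensional ℝ (TM x) :=
  Module.finite_of_finrank_pos (by rw [finrank_TM]; norm_num)

section Manifold

variable {M : Type*} [TopologicalSpace M] [ChartedSpace E8 M] [IsManifold I8 ∞ M]

/-- Covariant `k`-tensor fields, as functions of `k` tangent vectors. The operators below are
only applied to `k`-forms, i.e. to fields of alternating multilinear maps. -/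
abbrev Field (k : ℕ) (M : Type*) [TopologicalSpace M] [ChartedSpace E8 M] : Type _ :=
  (x : M) → (Fin k → TM x) → ℝ

/-- A vector field on a neighbourhood of `x` that is smooth there and extends `v ∈ T_x M`. The
operators below are tensorial, so that the extension used in them is immaterial. -/
abbrev extV {x : M} (v : TM x) (y : M) : TM y := FiberBundle.extend E8 v y

/-- The exterior derivative,
`dη(V₀,…,V_{n+1}) = ∑ᵢ (-1)ⁱ Vᵢ(η(…,V̂ᵢ,…)) + ∑_{i<j} (-1)^{i+j} η([Vᵢ,Vⱼ],…,V̂ᵢ,…,V̂ⱼ,…)`.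
The pair `(i, j)`, `i ≤ j`, of the last sum stands for the pair of positions `i < j + 1`, whence
the minus sign. -/
def extD {n : ℕ} (η : Field (n + 1) M) : Field (n + 2) M := fun x v =>
  (∑ i : Fin (n + 2), (-1 : ℝ) ^ (i : ℕ) *
      mvfderiv I8 (fun y => η y (i.removeNth fun a => extV (v a) y)) x (v i)) -
    ∑ i : Fin (n + 1), ∑ j ≥ i, (-1 : ℝ) ^ ((i : ℕ) + (j : ℕ)) *
      η x (Matrix.vecCons (mlieBracket I8 (extV (v i.castSucc)) (extV (v j.succ)) x)
        (j.removeNth (i.castSucc.removeNth v)))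

/-- The wedge product (without numerical factors on decomposable forms). -/
def wedge {p q : ℕ} (α : Field p M) (β : Field q M) : Field (p + q) M := fun x v =>
  (1 / ((p ! : ℝ) * (q ! : ℝ))) * ∑ σ : Equiv.Perm (Fin (p + q)),
    ((Equiv.Perm.sign σ : ℤ) : ℝ) *
      α x (fun a => v (σ (Fin.castAdd q a))) * β x (fun b => v (σ (Fin.natAdd p b)))

variable [RiemannianBundle (fun x : M => TangentSpace I8 x)]

/-- An orthonormal basis of `T_x M`. Every contraction below is independent of it. -/
def onb (x : M) : OrthonormalBasis (Fin 8) ℝ (TM x) :=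
  (stdOrthonormalBasis ℝ (TM x)).reindex (finCongr (finrank_TM x))

/-- The vectors `e_{i 0}, e_{i 1}, …` of the orthonormal basis. -/
def frame (x : M) {k : ℕ} (i : Fin k → Fin 8) : Fin k → TM x := fun a => onb x (i a)

/-- A `Spin(7)`-structure on a Riemannian 8-manifold: the fundamental 4-form `Φ` and the volume
form of the orientation, such that near every point there is a smooth oriented orthonormal frame
in which `Φ` has the standard components (a local section of the reduced frame bundle). Both the
metric and the volume form are thereby those determined by `Φ`. -/
structure Structure (M : Type*) [TopologicalSpace M] [ChartedSpace E8 M] [IsManifold I8 ∞ M]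
    [RiemannianBundle (fun x : M => TangentSpace I8 x)] where
  /-- the fundamental form -/
  Phi : (x : M) → (TM x) [⋀^Fin 4]→L[ℝ] ℝ
  /-- the volume form -/
  vol : (x : M) → (TM x) [⋀^Fin 8]→L[ℝ] ℝ
  exists_frame : ∀ x : M, ∃ U : Set M, IsOpen U ∧ x ∈ U ∧
    ∃ e : Fin 8 → (y : M) → TangentSpace I8 y,
      (∀ i, ContMDiffOn I8 I8.tangent ∞ (fun y => (⟨y, e i y⟩ : TangentBundle I8 M)) U) ∧
      ∀ y ∈ U, Orthonormal ℝ (fun i => e i y) ∧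
        vol y (fun i => e i y) = 1 ∧
        ∀ i : Fin 4 → Fin 8, Phi y (fun a => e (i a) y) = (stdPhi i : ℝ)

namespace Structure

variable (S : Structure M)

/-- The fundamental form as a tensor field. -/
def phi : Field 4 M := fun x v => S.Phi x v

/-- The Hodge star on `k`-forms, normalized by `α ∧ *β = ⟨α, β⟩ vol`:
`(*η)(v) = (1/k!) ∑_I η(e_I) vol(e_I, v)`. -/
def star {k m : ℕ} (h : k + m = 8) (η : Field k M) : Field m M := fun x v =>
  (1 / (k ! : ℝ)) * ∑ i : Fin k → Fin 8,
    η x (frame x i) * S.vol x (fun a => Fin.append (frame x i) v (Fin.cast h.symm a))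

/-- The codifferential `δ = - * d *` on `(k+1)`-forms. -/
def codiff {k m : ℕ} (h : k + m = 6) (η : Field (k + 1) M) : Field k M := fun x v =>
  - S.star (k := m + 2) (m := k) (by omega)
      (extD (n := m) (S.star (k := k + 1) (m := m + 1) (by omega) η)) x v

/-- The 3-form `δΦ`. -/
def deltaPhi : Field 3 M := S.codiff (k := 3) (m := 3) (by norm_num) S.phi

/-- The Lee form `θ_a = (1/42) (δΦ)_{ijk} Φ_{ijka}`. -/
def lee : Field 1 M := fun x w =>
  (1 / 42 : ℝ) * ∑ i : Fin 3 → Fin 8, S.deltaPhi x (frame x i) *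
    S.phi x ![onb x (i 0), onb x (i 1), onb x (i 2), w 0]

/-- `β_{ab} Φ_{abij}` for a 2-form `β`. -/
def contrPhi (β : Field 2 M) : Field 2 M := fun x v =>
  ∑ a : Fin 8, ∑ b : Fin 8, β x ![onb x a, onb x b] * S.phi x ![onb x a, onb x b, v 0, v 1]

/-- `θ_s γ_{sij}` for a 3-form `γ`. -/
def leeContr (γ : Field 3 M) : Field 2 M := fun x v =>
  ∑ s : Fin 8, S.lee x ![onb x s] * γ x ![onb x s, v 0, v 1]

/-- The space `Λ²₇ = {β ∈ Λ² | *(β ∧ Φ) = -3 β}`. -/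
def MemLambda27 (β : Field 2 M) : Prop :=
  (∀ x : M, ∃ b : (TM x) [⋀^Fin 2]→L[ℝ] ℝ, β x = b) ∧
  ∀ (x : M) (v : Fin 2 → TM x),
    S.star (k := 2 + 4) (m := 2) (by norm_num) (wedge β S.phi) x v = -3 * β x v

end Structure

/-! ### Linear connections -/

/-- Linear connections on `M`; `∇_X Y` at `x` is `D Y x (X x)`. -/
abbrev Connection (M : Type*) [TopologicalSpace M] [ChartedSpace E8 M] [IsManifold I8 ∞ M] :=
  CovariantDerivative I8 E8 (fun x : M => TangentSpace I8 x)

variable (D : Connection M)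

/-- The torsion as a covariant tensor, `T(X,Y,Z) = g(∇_X Y - ∇_Y X - [X,Y], Z)`. -/
def torsionForm : Field 3 M := fun x v => inner ℝ (D.torsion x (v 0) (v 1)) (v 2)

/-- The curvature `R(X,Y)Z = ∇_X ∇_Y Z - ∇_Y ∇_X Z - ∇_{[X,Y]} Z` on vector fields. -/
def curvatureFields (X Y Z : (y : M) → TM y) (x : M) : TM x :=
  D (fun y => D Z y (Y y)) x (X x) - D (fun y => D Z y (X y)) x (Y x) -
    D Z x (mlieBracket I8 X Y x)

/-- The curvature tensor `R(u,v)w`. -/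
def curvature (x : M) (u v w : TM x) : TM x :=
  curvatureFields D (extV u) (extV v) (extV w) x

/-- The Ricci tensor `Ric(u,v) = ∑ₐ g(R(eₐ,u)v, eₐ)`. -/
def ricci (x : M) (u v : TM x) : ℝ :=
  ∑ a : Fin 8, inner ℝ (curvature D x (onb x a) u v) (onb x a)

/-- The covariant derivative `(∇_u θ)(v)` of a 1-form. -/
def nablaForm (θ : Field 1 M) (x : M) (u v : TM x) : ℝ :=
  mvfderiv I8 (fun y => θ y ![extV v y]) x u - θ x ![D (extV v) x u]

/-- `d^∇θ(X,Y) = (∇_X θ)Y - (∇_Y θ)X`. -/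
def dNabla (θ : Field 1 M) : Field 2 M := fun x v =>
  nablaForm D θ x (v 0) (v 1) - nablaForm D θ x (v 1) (v 0)

/-- A smooth metric is of class `C¹`. -/
instance instRiemannianOne
    [IsContMDiffRiemannianBundle I8 ∞ E8 (fun x : M => TangentSpace I8 x)] :
    IsContMDiffRiemannianBundle I8 1 E8 (fun x : M => TangentSpace I8 x) :=
  IsContMDiffRiemannianBundle.of_le (n := ∞) (by simp)

/-- A `Spin(7)`-torsion connection: a smooth linear connection with `∇g = 0`, `∇Φ = 0` and
totally skew-symmetric torsion. -/
structure Structure.IsTorsionConnection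
    [IsContMDiffRiemannianBundle I8 ∞ E8 (fun x : M => TangentSpace I8 x)]
    (S : Structure M) (D : Connection M) : Prop where
  smooth : CovariantDerivative.ContMDiffCovariantDerivative D ∞
  metric : D.IsMetricCompatible
  parallel : ∀ (x : M) (Y : Fin 4 → (y : M) → TangentSpace I8 y),
    (∀ i, MDifferentiableAt I8 I8.tangent (fun y => (⟨y, Y i y⟩ : TangentBundle I8 M)) x) → ∀ u : TM x,
      mvfderiv I8 (fun y => S.phi y (fun i => Y i y)) x u =
        ∑ i, S.phi x (Function.update (fun j => Y j x) i (D (Y i) x u))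
  skew : ∀ (x : M) (u v w : TM x), torsionForm D x ![u, v, w] = - torsionForm D x ![u, w, v]

end Manifold

end Spin7

end

/-!
The proof is representation theory of `Spin(7)` carried out on components. The contraction of
`Φ ⊗ Φ` over one index and the self-duality of `Φ` are checked on the standard form. They show
that `P β = β_{ab} Φ_{abij}` satisfies `P² = 12 - 4 P` on 2-forms, with eigenspace `2` on
`Λ²₂₁ = spin(7)` and `-6` on `Λ²₇`, and that `*(β ∧ Φ) = ½ P β`.

Since `∇Φ = 0`, both `δΦ` and `θ` are algebraic in the torsion: `θ_s = -(1/7) T_{abc} Φ_{abcs}`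
and `δΦ` differs from `T` by a multiple of `θ ⌟ Φ`, which `θ` annihilates. Hence `θ ⌟ δΦ = θ ⌟ T`,
so conditions (b) and (c) coincide, and `d^∇θ` is the skew part of `-(1/7) (∇_u T)_{abc} Φ_{abcv}`.

By the first Bianchi identity the skew part of `Ric` is `div T`. On the other hand the curvature
takes values in `spin(7)`, so `Ric_{uv} = ½ R_{uabc} Φ_{abcv}`, which the Bianchi identity also
expresses through `∇T` and `T ⊗ T`. Comparing the two gives, for `V = -(1/7) div T`, `W = d^∇θ`
and `X = θ ⌟ T`, the relation `2 V + P V = W - (1/6) P W + (2/3) X - (1/3) P X`. As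
`P² = 12 - 4 P`, the operator `2 + P` is invertible, and `V = 0` is equivalent to
`W = -(1/3) X + (1/6) P X`, a multiple of the projection of `X` to `Λ²₇`.
-/

noncomputable section

namespace Spin7

/-- The sign of the permutation sorting `v`, with the value `0` if two entries agree. -/
def tupleSign {n m : ℕ} (v : Fin n → Fin m) : ℤ :=
  ∏ i, ∏ j ∈ Finset.Ioi i, ((v j : ℤ) - v i).sign

theorem tupleSign_comp_perm {n m : ℕ} (v : Fin n → Fin m) (σ : Equiv.Perm (Fin n)) :
    tupleSign (v ∘ σ) = (Equiv.Perm.sign σ : ℤ) * tupleSign v :=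
  σ.prod_Ioi_comp_eq_sign_mul_prod (f := fun i j ↦ ((v j : ℤ) - v i).sign) fun i j ↦ by
    rw [← Int.sign_neg, neg_sub]

theorem tupleSign_of_strictMono {n m : ℕ} {v : Fin n → Fin m} (hv : StrictMono v) :
    tupleSign v = 1 :=
  Finset.prod_eq_one fun _ _ ↦ Finset.prod_eq_one fun _ hij ↦
    Int.sign_eq_one_of_pos (by have := hv (Finset.mem_Ioi.1 hij); omega)

theorem eq_of_eq_of_strictMono {n : ℕ} {ι A : Type*} [LinearOrder ι] [AddCommGroup A]
    [IsAddTorsionFree A] {F G : (Fin n → ι) → A}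
    (hF : ∀ v (σ : Equiv.Perm (Fin n)), F (v ∘ σ) = Equiv.Perm.sign σ • F v)
    (hG : ∀ v (σ : Equiv.Perm (Fin n)), G (v ∘ σ) = Equiv.Perm.sign σ • G v)
    (h : ∀ v, StrictMono v → F v = G v) (v : Fin n → ι) : F v = G v := by
  by_cases hv : Function.Injective v
  · have sorted : StrictMono (v ∘ Tuple.sort v) :=
      (Tuple.monotone_sort v).strictMono_of_injective (hv.comp (Tuple.sort v).injective)
    exact smul_left_cancel _ ((hF _ _).symm.trans ((h _ sorted).trans (hG _ _)))
  · obtain ⟨a, b, hab, hne⟩ : ∃ a b, v a = v b ∧ a ≠ b := by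
      simpa [Function.Injective] using hv
    have eq_zero {H : (Fin n → ι) → A}
        (hH : ∀ v (σ : Equiv.Perm (Fin n)), H (v ∘ σ) = Equiv.Perm.sign σ • H v) : H v = 0 := by
      have := hH v (Equiv.swap a b)
      rwa [Equiv.comp_swap_eq_update, hab, Function.update_eq_self, ← hab,
        Function.update_eq_self, Equiv.Perm.sign_swap hne, Units.neg_smul, one_smul,
        self_eq_neg] at this
    rw [eq_zero hF, eq_zero hG]

theorem elem4_comp_perm (q i : Fin 4 → Fin 8) (σ : Equiv.Perm (Fin 4)) :
    elem4 q (i ∘ σ) = (Equiv.Perm.sign σ : ℤ) * elem4 q i :=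
  Matrix.det_permute σ (Matrix.of fun a b : Fin 4 => if i a = q b then (1 : ℤ) else 0)

theorem stdPhi_comp_perm (i : Fin 4 → Fin 8) (σ : Equiv.Perm (Fin 4)) :
    stdPhi (i ∘ σ) = (Equiv.Perm.sign σ : ℤ) * stdPhi i := by
  simp only [stdPhi, elem4_comp_perm]
  ring

theorem elem4_eq_sum_perm (q i : Fin 4 → Fin 8) :
    elem4 q i = ∑ σ : Equiv.Perm (Fin 4), if i ∘ σ = q then (Equiv.Perm.sign σ : ℤ) else 0 := by
  simp [elem4, Matrix.det_apply', Fintype.prod_boole, funext_iff]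

theorem elem4_of_strictMono {q i : Fin 4 → Fin 8} (hq : StrictMono q) (hi : StrictMono i) :
    elem4 q i = if i = q then 1 else 0 := by
  have eq_one {σ : Equiv.Perm (Fin 4)} (h : i ∘ σ = q) : σ = 1 := by
    have hσ : StrictMono σ := fun a b hab ↦ hi.lt_iff_lt.1 (by simpa [← h] using hq hab)
    ext a
    simpa using congrArg Fin.val (DFunLike.congr_fun
      (Subsingleton.elim (hσ.orderIsoOfSurjective _ σ.surjective) (OrderIso.refl _)) a)
  rw [elem4_eq_sum_perm, Finset.sum_eq_single 1]
  · simp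
  · exact fun σ _ hσ ↦ if_neg fun h ↦ hσ (eq_one h)
  · simp

/-- The coefficient of `e_I` in the standard 4-form, for a set `I` of four indices encoded by the
number `∑_{i ∈ I} 10 ^ i`, whose decimal digits are the indicator function of `I`. -/
def phiCoeff : ℕ → ℤ
  | 1001101 | 1010011 | 110101 | 11010100 => 1
  | 10000111 | 10011001 | 11100001 | 101011 | 1111000 | 10110010 | 1100110
  | 11110 | 10101100 | 11001010 => -1
  | _ => 0

/-- The components of the standard 4-form in a shape that the kernel evaluates quickly. -/
def phiTab (i j k l : Fin 8) : ℤ :=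
  ((j : ℤ) - i).sign * ((k : ℤ) - i).sign * ((l : ℤ) - i).sign * ((k : ℤ) - j).sign *
    ((l : ℤ) - j).sign * ((l : ℤ) - k).sign *
    phiCoeff (10 ^ (i : ℕ) + 10 ^ (j : ℕ) + 10 ^ (k : ℕ) + 10 ^ (l : ℕ))

theorem phiTab_eq_tupleSign_mul (i : Fin 4 → Fin 8) :
    phiTab (i 0) (i 1) (i 2) (i 3) = tupleSign i * phiCoeff (∑ a, 10 ^ (i a : ℕ)) := by
  have h₀ : Finset.Ioi (0 : Fin 4) = {1, 2, 3} := by decide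
  have h₁ : Finset.Ioi (1 : Fin 4) = {2, 3} := by decide
  have h₂ : Finset.Ioi (2 : Fin 4) = {3} := by decide
  have h₃ : Finset.Ioi (3 : Fin 4) = ∅ := by decide
  simp [phiTab, tupleSign, Fin.prod_univ_four, Fin.sum_univ_four, h₀, h₁, h₂, h₃, mul_assoc]

theorem stdPhi_eq_phiTab_of_lt : ∀ i j : Fin 8, i < j → ∀ k, j < k → ∀ l, k < l →
    stdPhi ![i, j, k, l] = phiTab i j k l := by
  intro i j hij k hjk l hkl
  have sorted : StrictMono ![i, j, k, l] := by simp [hij, hjk, hkl]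
  simp only [stdPhi]
  repeat rw [elem4_of_strictMono (by decide) sorted]
  clear sorted
  revert i j k l
  decide +kernel

theorem stdPhi_eq_phiTab (i : Fin 4 → Fin 8) :
    stdPhi i = phiTab (i 0) (i 1) (i 2) (i 3) := by
  refine eq_of_eq_of_strictMono (G := fun i ↦ phiTab (i 0) (i 1) (i 2) (i 3))
    (fun i σ ↦ ?_) (fun i σ ↦ ?_) (fun i hi ↦ ?_) i
  · rw [stdPhi_comp_perm, Units.smul_def, smul_eq_mul]
  · have mask_comp : ∑ a, 10 ^ ((i ∘ σ) a : ℕ) = ∑ a, 10 ^ (i a : ℕ) :=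
      Equiv.sum_comp σ fun a ↦ 10 ^ (i a : ℕ)
    rw [phiTab_eq_tupleSign_mul (i ∘ σ), phiTab_eq_tupleSign_mul i, tupleSign_comp_perm, mask_comp,
      Units.smul_def, smul_eq_mul, mul_assoc]
  · rw [← stdPhi_eq_phiTab_of_lt _ _ (hi (by decide)) _ (hi (by decide)) _ (hi (by decide))]
    exact congrArg stdPhi (List.ofFn_inj.1 rfl)

theorem sum_phiTab_mul_phiTab : ∀ i j : Fin 8, i < j → ∀ k, j < k →
    ∀ a b : Fin 8, a < b → ∀ c, b < c →
      ∑ p, phiTab p i j k * phiTab p a b c =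
        (if i = a then 1 else 0) * (if j = b then 1 else 0) * (if k = c then 1 else 0)
        - (if i = a then 1 else 0) * (if j = c then 1 else 0) * (if k = b then 1 else 0)
        - (if i = b then 1 else 0) * (if j = a then 1 else 0) * (if k = c then 1 else 0)
        + (if i = b then 1 else 0) * (if j = c then 1 else 0) * (if k = a then 1 else 0)
        + (if i = c then 1 else 0) * (if j = a then 1 else 0) * (if k = b then 1 else 0)
        - (if i = c then 1 else 0) * (if j = b then 1 else 0) * (if k = a then 1 else 0)
        - ((if i = a then phiTab b c j k else 0) - (if i = b then phiTab a c j k else 0)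
          + (if i = c then phiTab a b j k else 0) - (if j = a then phiTab b c i k else 0)
          + (if j = b then phiTab a c i k else 0) - (if j = c then phiTab a b i k else 0)
          + (if k = a then phiTab b c i j else 0) - (if k = b then phiTab a c i j else 0)
          + (if k = c then phiTab a b i j else 0)) := by
  simp only [Fin.sum_univ_eight]
  decide +kernel

theorem alternatingMap_ext_of_strictMono {R V A ι : Type*} [CommRing R] [AddCommGroup V]
    [Module R V] [AddCommGroup A] [Module R A] [IsAddTorsionFree A] [LinearOrder ι] {n : ℕ}
    (b : Module.Basis ι R V) {f g : V [⋀^Fin n]→ₗ[R] A}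
    (h : ∀ v : Fin n → ι, StrictMono v → f (b ∘ v) = g (b ∘ v)) : f = g :=
  b.ext_alternating fun v _ ↦
    eq_of_eq_of_strictMono (F := fun v ↦ f (b ∘ v)) (G := fun v ↦ g (b ∘ v))
      (fun v σ ↦ f.map_perm (b ∘ v) σ) (fun v σ ↦ g.map_perm (b ∘ v) σ) h v

section AlternatingFour

variable {R V A : Type*} [Semiring R] [AddCommMonoid V] [Module R V] [AddCommGroup A] [Module R A]
  (f : V [⋀^Fin 4]→ₗ[R] A) (x y z t : V)

theorem alternatingMap_swap₀₁ : f ![y, x, z, t] = -f ![x, y, z, t] := by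
  rw [← f.map_swap ![x, y, z, t] (show (0 : Fin 4) ≠ 1 by decide)]
  exact congrArg f (List.ofFn_inj.1 rfl)

theorem alternatingMap_swap₁₂ : f ![x, z, y, t] = -f ![x, y, z, t] := by
  rw [← f.map_swap ![x, y, z, t] (show (1 : Fin 4) ≠ 2 by decide)]
  exact congrArg f (List.ofFn_inj.1 rfl)

theorem alternatingMap_swap₂₃ : f ![x, y, t, z] = -f ![x, y, z, t] := by
  rw [← f.map_swap ![x, y, z, t] (show (2 : Fin 4) ≠ 3 by decide)]
  exact congrArg f (List.ofFn_inj.1 rfl)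

theorem alternatingMap_swap_pairs : f ![z, t, x, y] = f ![x, y, z, t] := by
  rw [alternatingMap_swap₁₂, alternatingMap_swap₀₁, alternatingMap_swap₂₃,
    alternatingMap_swap₁₂, neg_neg, neg_neg]

end AlternatingFour

theorem alternatingMap_sum_apply {κ ι R V A : Type*} [Semiring R] [AddCommMonoid V] [Module R V]
    [AddCommMonoid A] [Module R A] (s : Finset κ) (f : κ → V [⋀^ι]→ₗ[R] A) (v : ι → V) :
    (∑ k ∈ s, f k) v = ∑ k ∈ s, f k v :=
  map_sum (⟨⟨fun g ↦ g v, rfl⟩, fun _ _ ↦ rfl⟩ : (V [⋀^ι]→ₗ[R] A) →+ A) f s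

section StandardForm

variable {V : Type*} [NormedAddCommGroup V] [InnerProductSpace ℝ V]

/-- The basis `e` is an oriented orthonormal basis, for the volume form `Ω`, in which the 4-form
`Φ` has the standard components. -/
structure IsAdapted (Φ : V [⋀^Fin 4]→ₗ[ℝ] ℝ) (Ω : V [⋀^Fin 8]→ₗ[ℝ] ℝ)
    (e : OrthonormalBasis (Fin 8) ℝ V) : Prop where
  vol : Ω e = 1
  phi : ∀ i : Fin 4 → Fin 8, Φ (e ∘ i) = stdPhi i

/-- The alternating form in `u` whose vanishing expresses the contraction over one index of
`Φ ⊗ Φ` by the metric and `Φ`. -/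
def contractionDefect (e : OrthonormalBasis (Fin 8) ℝ V) (Φ : V [⋀^Fin 4]→ₗ[ℝ] ℝ)
    (w : Fin 3 → V) : V [⋀^Fin 3]→ₗ[ℝ] ℝ :=
  ∑ p, Φ (Matrix.vecCons (e p) w) • Φ.curryLeft (e p)
    - Matrix.detRowAlternating.compLinearMap (LinearMap.pi fun a ↦ innerₛₗ ℝ (w a))
    + ∑ a : Fin 3, (-1 : ℝ) ^ (a : ℕ) • AlternatingMap.alternatizeUncurryFin
        ((innerₛₗ ℝ (w a)).smulRight
          ((Φ.curryLeft (a.removeNth w 0)).curryLeft (a.removeNth w 1)))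

theorem contractionDefect_apply (e : OrthonormalBasis (Fin 8) ℝ V) (Φ : V [⋀^Fin 4]→ₗ[ℝ] ℝ)
    (i j k a b c : V) :
    contractionDefect e Φ ![a, b, c] ![i, j, k] =
      ∑ p, Φ ![e p, i, j, k] * Φ ![e p, a, b, c]
      - (inner ℝ i a * inner ℝ j b * inner ℝ k c - inner ℝ i a * inner ℝ j c * inner ℝ k b
        - inner ℝ i b * inner ℝ j a * inner ℝ k c + inner ℝ i b * inner ℝ j c * inner ℝ k a
        + inner ℝ i c * inner ℝ j a * inner ℝ k b - inner ℝ i c * inner ℝ j b * inner ℝ k a)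
      + (inner ℝ i a * Φ ![b, c, j, k] - inner ℝ i b * Φ ![a, c, j, k]
        + inner ℝ i c * Φ ![a, b, j, k] - inner ℝ j a * Φ ![b, c, i, k]
        + inner ℝ j b * Φ ![a, c, i, k] - inner ℝ j c * Φ ![a, b, i, k]
        + inner ℝ k a * Φ ![b, c, i, j] - inner ℝ k b * Φ ![a, c, i, j]
        + inner ℝ k c * Φ ![a, b, i, j]) := by
  have remove₁ (x y z : V) : Fin.removeNth 1 ![x, y, z] = ![x, z] := List.ofFn_inj.1 rfl
  have remove₂ (x y z : V) : Fin.removeNth 2 ![x, y, z] = ![x, y] := List.ofFn_inj.1 rfl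
  have sum_eq : (∑ p, Φ ![e p, a, b, c] • Φ.curryLeft (e p)) ![i, j, k] =
      ∑ p, Φ ![e p, i, j, k] * Φ ![e p, a, b, c] := by
    simp [alternatingMap_sum_apply, mul_comm]
  have det_eq : Matrix.detRowAlternating
      (fun r ↦ LinearMap.pi (fun s ↦ innerₛₗ ℝ (![a, b, c] s)) (![i, j, k] r)) =
      Matrix.det !![inner ℝ i a, inner ℝ i b, inner ℝ i c; inner ℝ j a, inner ℝ j b, inner ℝ j c;
        inner ℝ k a, inner ℝ k b, inner ℝ k c] := by
    refine congrArg Matrix.det (Matrix.ext fun r s ↦ ?_)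
    fin_cases r <;> fin_cases s <;> exact real_inner_comm _ _
  simp [contractionDefect, sum_eq, det_eq, Matrix.det_fin_three, Fin.sum_univ_three,
    AlternatingMap.alternatizeUncurryFin_apply, remove₁, remove₂, real_inner_comm]
  ring

theorem contractionDefect_symm (e : OrthonormalBasis (Fin 8) ℝ V) (Φ : V [⋀^Fin 4]→ₗ[ℝ] ℝ)
    (u w : Fin 3 → V) : contractionDefect e Φ w u = contractionDefect e Φ u w := by
  have eta (v : Fin 3 → V) : v = ![v 0, v 1, v 2] := List.ofFn_inj.1 rfl
  rw [eta u, eta w, contractionDefect_apply, contractionDefect_apply]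
  simp only [alternatingMap_swap_pairs Φ (u _) (u _) (w _) (w _), real_inner_comm (u _) (w _),
    mul_comm (Φ ![e _, w 0, w 1, w 2])]
  ring

theorem IsAdapted.phi_apply {Φ : V [⋀^Fin 4]→ₗ[ℝ] ℝ} {Ω : V [⋀^Fin 8]→ₗ[ℝ] ℝ}
    {e : OrthonormalBasis (Fin 8) ℝ V} (h : IsAdapted Φ Ω e) (i j k l : Fin 8) :
    Φ ![e i, e j, e k, e l] = phiTab i j k l := by
  have comp_eq : e ∘ ![i, j, k, l] = ![e i, e j, e k, e l] := List.ofFn_inj.1 rfl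
  simpa [comp_eq, stdPhi_eq_phiTab] using h.phi ![i, j, k, l]

theorem IsAdapted.contractionDefect_eq_zero {Φ : V [⋀^Fin 4]→ₗ[ℝ] ℝ} {Ω : V [⋀^Fin 8]→ₗ[ℝ] ℝ}
    {e : OrthonormalBasis (Fin 8) ℝ V} (h : IsAdapted Φ Ω e) (w : Fin 3 → V) :
    contractionDefect e Φ w = 0 := by
  have on_basis {i a : Fin 3 → Fin 8} (hi : StrictMono i) (ha : StrictMono a) :
      contractionDefect e Φ (e ∘ a) (e ∘ i) = 0 := by
    have eta (v : Fin 3 → Fin 8) : e ∘ v = ![e (v 0), e (v 1), e (v 2)] := List.ofFn_inj.1 rfl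
    have table := congrArg (Int.cast : ℤ → ℝ) <|
      sum_phiTab_mul_phiTab (i 0) (i 1) (hi (by decide)) (i 2) (hi (by decide))
        (a 0) (a 1) (ha (by decide)) (a 2) (ha (by decide))
    push_cast at table
    rw [eta, eta, contractionDefect_apply]
    simp only [h.phi_apply, e.inner_eq_ite, table, ite_mul, one_mul, zero_mul]
    ring
  have on_basis_left {i : Fin 3 → Fin 8} (hi : StrictMono i) :
      contractionDefect e Φ (e ∘ i) = 0 :=
    alternatingMap_ext_of_strictMono e.toBasis fun a ha ↦ by
      simpa using on_basis ha hi
  refine alternatingMap_ext_of_strictMono e.toBasis fun i hi ↦ ?_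
  rw [contractionDefect_symm, e.coe_toBasis, on_basis_left hi, AlternatingMap.zero_apply,
    AlternatingMap.zero_apply]

end StandardForm

theorem append_comp_perm {α : Type*} {k l : ℕ} (u : Fin k → α) (v : Fin l → α)
    (σ : Equiv.Perm (Fin k)) (τ : Equiv.Perm (Fin l)) :
    Fin.append (u ∘ σ) (v ∘ τ) =
      Fin.append u v ∘ finSumFinEquiv.permCongr (Equiv.Perm.sumCongr σ τ) := by
  ext a
  refine Fin.addCases (fun a ↦ ?_) (fun a ↦ ?_) a <;> simp

theorem tupleSign_append_comp_perm {k l m : ℕ} (i : Fin k → Fin m) (j : Fin l → Fin m)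
    (σ : Equiv.Perm (Fin k)) (τ : Equiv.Perm (Fin l)) :
    tupleSign (Fin.append (i ∘ σ) (j ∘ τ)) =
      (Equiv.Perm.sign σ * Equiv.Perm.sign τ : ℤ) * tupleSign (Fin.append i j) := by
  rw [append_comp_perm, tupleSign_comp_perm, Equiv.Perm.sign_permCongr,
    Equiv.Perm.sign_sumCongr, Units.val_mul]

theorem sum_elem4_mul (q : Fin 4 → Fin 8) {G : (Fin 4 → Fin 8) → ℤ}
    (hG : ∀ i (σ : Equiv.Perm (Fin 4)), G (i ∘ σ) = (Equiv.Perm.sign σ : ℤ) * G i) :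
    ∑ i, elem4 q i * G i = 24 * G q := by
  have single (σ : Equiv.Perm (Fin 4)) :
      ∑ i, (if i ∘ σ = q then (Equiv.Perm.sign σ : ℤ) else 0) * G i = G q := by
    rw [Finset.sum_eq_single (q ∘ σ.symm)]
    · simp [Function.comp_assoc, hG, ← mul_assoc, ← Units.val_mul]
    · intro i _ hi
      rw [if_neg fun h ↦ hi (by simp [← h, Function.comp_assoc]), zero_mul]
    · simp
  simp only [elem4_eq_sum_perm, Finset.sum_mul]
  rw [Finset.sum_comm, Finset.sum_congr rfl fun σ _ ↦ single σ]
  simp [Fintype.card_perm, Nat.factorial]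

theorem sum_stdPhi_mul {G : (Fin 4 → Fin 8) → ℤ}
    (hG : ∀ i (σ : Equiv.Perm (Fin 4)), G (i ∘ σ) = (Equiv.Perm.sign σ : ℤ) * G i) :
    ∑ i, stdPhi i * G i = 24 * (-G ![0, 1, 2, 7] + G ![0, 2, 3, 6] - G ![0, 3, 4, 7]
      - G ![0, 5, 6, 7] + G ![0, 1, 4, 6] + G ![0, 2, 4, 5] - G ![0, 1, 3, 5] - G ![3, 4, 5, 6]
      - G ![1, 4, 5, 7] - G ![1, 2, 5, 6] - G ![1, 2, 3, 4] - G ![2, 3, 5, 7] - G ![1, 3, 6, 7]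
      + G ![2, 4, 6, 7]) := by
  simp only [stdPhi, add_mul, sub_mul, neg_mul, Finset.sum_add_distrib, Finset.sum_sub_distrib,
    Finset.sum_neg_distrib, sum_elem4_mul _ hG]
  ring

theorem signed_sum_tupleSign : ∀ a b : Fin 8, a < b → ∀ c, b < c → ∀ d, c < d →
      -tupleSign ![0, 1, 2, 7, a, b, c, d] + tupleSign ![0, 2, 3, 6, a, b, c, d]
      - tupleSign ![0, 3, 4, 7, a, b, c, d] - tupleSign ![0, 5, 6, 7, a, b, c, d]
      + tupleSign ![0, 1, 4, 6, a, b, c, d] + tupleSign ![0, 2, 4, 5, a, b, c, d]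
      - tupleSign ![0, 1, 3, 5, a, b, c, d] - tupleSign ![3, 4, 5, 6, a, b, c, d]
      - tupleSign ![1, 4, 5, 7, a, b, c, d] - tupleSign ![1, 2, 5, 6, a, b, c, d]
      - tupleSign ![1, 2, 3, 4, a, b, c, d] - tupleSign ![2, 3, 5, 7, a, b, c, d]
      - tupleSign ![1, 3, 6, 7, a, b, c, d] + tupleSign ![2, 4, 6, 7, a, b, c, d] =
    phiTab a b c d := by
  decide +kernel

theorem sum_stdPhi_mul_tupleSign (j : Fin 4 → Fin 8) :
    ∑ i, stdPhi i * tupleSign (Fin.append i j) = 24 * stdPhi j := by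
  refine eq_of_eq_of_strictMono
    (F := fun j ↦ ∑ i, stdPhi i * tupleSign (Fin.append i j)) (G := fun j ↦ 24 * stdPhi j)
    (fun j σ ↦ ?_) (fun j σ ↦ ?_) (fun j hj ↦ ?_) j
  · simp_rw [Units.smul_def, smul_eq_mul, Finset.mul_sum]
    refine Finset.sum_congr rfl fun i _ ↦ ?_
    have := tupleSign_append_comp_perm i j 1 σ
    rw [Equiv.Perm.coe_one, Function.comp_id, map_one, Units.val_one, one_mul] at this
    rw [this, mul_left_comm]
  · rw [stdPhi_comp_perm, Units.smul_def, smul_eq_mul, mul_left_comm]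
  · rw [sum_stdPhi_mul fun i σ ↦ ?_, stdPhi_eq_phiTab, ← signed_sum_tupleSign (j 0) (j 1)
      (hj (by decide)) (j 2) (hj (by decide)) (j 3) (hj (by decide))]
    · have append_eq (a b c d : Fin 8) : Fin.append ![a, b, c, d] j =
          ![a, b, c, d, j 0, j 1, j 2, j 3] := List.ofFn_inj.1 rfl
      simp only [append_eq]
    · simpa using tupleSign_append_comp_perm i j σ 1

theorem val_succAbove {n : ℕ} (p : Fin (n + 1)) (a : Fin n) :
    (p.succAbove a : ℕ) = if (a : ℕ) < p then (a : ℕ) else a + 1 := by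
  simp only [Fin.succAbove, Fin.lt_def, Fin.val_castSucc]
  split_ifs <;> simp

theorem removeNth_append_castAdd {α : Type*} {k m n : ℕ} (h : k + m = n) (h' : k + 1 + m = n + 1)
    (u : Fin (k + 1) → α) (v : Fin m → α) (c : Fin (k + 1)) :
    (Fin.cast h' (Fin.castAdd m c)).removeNth (Fin.append u v ∘ Fin.cast h'.symm) =
      Fin.append (c.removeNth u) v ∘ Fin.cast h.symm := by
  have succAbove_left (a : Fin k) :
      (Fin.cast h' (Fin.castAdd m c)).succAbove (Fin.cast h (Fin.castAdd m a)) =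
        Fin.cast h' (Fin.castAdd m (c.succAbove a)) := by
    simp [Fin.ext_iff, val_succAbove]
  have succAbove_right (a : Fin m) :
      (Fin.cast h' (Fin.castAdd m c)).succAbove (Fin.cast h (Fin.natAdd k a)) =
        Fin.cast h' (Fin.natAdd (k + 1) a) := by
    simp only [Fin.ext_iff, val_succAbove, Fin.val_cast, Fin.val_castAdd, Fin.val_natAdd]
    split_ifs <;> omega
  ext a
  obtain ⟨a, rfl⟩ := (finCongr h).surjective a
  refine Fin.addCases (fun a ↦ ?_) (fun a ↦ ?_) a <;>
    simp [Fin.removeNth, succAbove_left, succAbove_right]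

theorem removeNth_append_natAdd {α : Type*} {k m n : ℕ} (h : k + m = n) (h' : k + (m + 1) = n + 1)
    (u : Fin k → α) (v : Fin (m + 1) → α) (c : Fin (m + 1)) :
    (Fin.cast h' (Fin.natAdd k c)).removeNth (Fin.append u v ∘ Fin.cast h'.symm) =
      Fin.append u (c.removeNth v) ∘ Fin.cast h.symm := by
  have succAbove_left (a : Fin k) :
      (Fin.cast h' (Fin.natAdd k c)).succAbove (Fin.cast h (Fin.castAdd m a)) =
        Fin.cast h' (Fin.castAdd (m + 1) a) := by
    simp only [Fin.ext_iff, val_succAbove, Fin.val_cast, Fin.val_castAdd, Fin.val_natAdd]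
    split_ifs <;> omega
  have succAbove_right (a : Fin m) :
      (Fin.cast h' (Fin.natAdd k c)).succAbove (Fin.cast h (Fin.natAdd k a)) =
        Fin.cast h' (Fin.natAdd k (c.succAbove a)) := by
    simp only [Fin.ext_iff, val_succAbove, Fin.val_cast, Fin.val_natAdd]
    split_ifs <;> omega
  ext a
  obtain ⟨a, rfl⟩ := (finCongr h).surjective a
  refine Fin.addCases (fun a ↦ ?_) (fun a ↦ ?_) a <;>
    simp [Fin.removeNth, succAbove_left, succAbove_right]

theorem append_cast_eq_sumElim {α : Type*} {k m n : ℕ} (h : k + m = n) (u : Fin k → α)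
    (v : Fin m → α) :
    Fin.append u v ∘ Fin.cast h.symm = Sum.elim u v ∘ (finSumFinEquiv.trans (finCongr h)).symm := by
  subst h
  ext a
  refine Fin.addCases (fun a ↦ ?_) (fun a ↦ ?_) a <;> simp

theorem comp_append {α β : Type*} {k m : ℕ} (f : α → β) (u : Fin k → α) (v : Fin m → α) :
    f ∘ Fin.append u v = Fin.append (f ∘ u) (f ∘ v) := by
  ext a
  refine Fin.addCases (fun a ↦ ?_) (fun a ↦ ?_) a <;> simp

theorem comp_insertNth {α β : Type*} {k : ℕ} (f : α → β) (c : Fin (k + 1)) (x : α)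
    (u : Fin k → α) :
    f ∘ c.insertNth (α := fun _ ↦ α) x u = c.insertNth (α := fun _ ↦ β) (f x) (f ∘ u) := by
  refine (Fin.insertNth_eq_iff.2 ⟨?_, funext fun a ↦ ?_⟩).symm <;> simp [Fin.removeNth]

theorem tupleSign_comp_cast {m n n' : ℕ} (h : n = n') (v : Fin n' → Fin m) :
    tupleSign (v ∘ Fin.cast h) = tupleSign v := by
  subst h
  rfl

section HodgeStar

variable {ι ι' V : Type*} [Fintype ι] [Fintype ι'] [NormedAddCommGroup V] [InnerProductSpace ℝ V]
  {k m n : ℕ}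

theorem sum_smul_orthonormalBasis {A : Type*} [AddCommGroup A] [Module ℝ A]
    (e : OrthonormalBasis ι ℝ V) (e' : OrthonormalBasis ι' ℝ V) (f : V →ₗ[ℝ] ℝ) (g : V →ₗ[ℝ] A) :
    ∑ i, f (e i) • g (e i) = ∑ i, f (e' i) • g (e' i) := by
  have expand (i : ι) : g (e i) = ∑ j, inner ℝ (e' j) (e i) • g (e' j) := by
    conv_lhs => rw [← e'.sum_repr' (e i)]
    simp
  have collect (j : ι') : f (e' j) = ∑ i, f (e i) * inner ℝ (e' j) (e i) := by
    conv_lhs => rw [← e.sum_repr' (e' j)]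
    simp [real_inner_comm, mul_comm]
  simp only [expand, collect, Finset.smul_sum, Finset.sum_smul, smul_smul]
  exact Finset.sum_comm

theorem sum_multilinear_succ {A : Type*} [AddCommGroup A] [Module ℝ A] (b : ι → V)
    (f : MultilinearMap ℝ (fun _ : Fin (k + 1) ↦ V) ℝ)
    (g : MultilinearMap ℝ (fun _ : Fin (k + 1) ↦ V) A) :
    ∑ i : Fin (k + 1) → ι, f (b ∘ i) • g (b ∘ i) =
      ∑ p, ∑ i : Fin k → ι, f.curryLeft (b p) (b ∘ i) • g.curryLeft (b p) (b ∘ i) := by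
  rw [← (Fin.consEquiv fun _ ↦ ι).sum_comp, Fintype.sum_prod_type]
  simp [Fin.consEquiv, Fin.comp_cons]

theorem sum_multilinear_smul_orthonormalBasis {A : Type*} [AddCommGroup A] [Module ℝ A]
    (e : OrthonormalBasis ι ℝ V) (e' : OrthonormalBasis ι' ℝ V)
    (f : MultilinearMap ℝ (fun _ : Fin k ↦ V) ℝ) (g : MultilinearMap ℝ (fun _ : Fin k ↦ V) A) :
    ∑ i : Fin k → ι, f (e ∘ i) • g (e ∘ i) = ∑ i : Fin k → ι', f (e' ∘ i) • g (e' ∘ i) := by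
  induction k with
  | zero => simp only [Fintype.sum_unique, Subsingleton.elim (e ∘ _) (e' ∘ default)]
  | succ k ih =>
    rw [sum_multilinear_succ, sum_multilinear_succ]
    simp only [fun p ↦ ih (f.curryLeft (e p)) (g.curryLeft (e p))]
    rw [Finset.sum_comm, Finset.sum_comm (s := Finset.univ (α := ι'))]
    refine Finset.sum_congr rfl fun i _ ↦ ?_
    simpa using sum_smul_orthonormalBasis e e' (f.toLinearMap (Fin.cons 0 (e' ∘ i)) 0)
      (g.toLinearMap (Fin.cons 0 (e' ∘ i)) 0)

/-- The multilinear map `u ↦ v ↦ Ω(u, v)`. -/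
def volAppend (h : k + m = n) (Ω : V [⋀^Fin n]→ₗ[ℝ] ℝ) :
    MultilinearMap ℝ (fun _ : Fin k ↦ V) (MultilinearMap ℝ (fun _ : Fin m ↦ V) ℝ) :=
  (Ω.toMultilinearMap.domDomCongr (finSumFinEquiv.trans (finCongr h)).symm).currySum

theorem volAppend_apply (h : k + m = n) (Ω : V [⋀^Fin n]→ₗ[ℝ] ℝ) (u : Fin k → V)
    (v : Fin m → V) : volAppend h Ω u v = Ω (Fin.append u v ∘ Fin.cast h.symm) := by
  rw [append_cast_eq_sumElim]
  rfl

/-- The Hodge star `*α` of a `k`-form with respect to the volume form `Ω`, computed in the basis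
`b`, without the factor `1 / k!`. -/
def starSum (b : ι → V) (h : k + m = n) (Ω : V [⋀^Fin n]→ₗ[ℝ] ℝ) (α : V [⋀^Fin k]→ₗ[ℝ] ℝ) :
    MultilinearMap ℝ (fun _ : Fin m ↦ V) ℝ :=
  ∑ i : Fin k → ι, α (b ∘ i) • volAppend h Ω (b ∘ i)

theorem starSum_apply (b : ι → V) (h : k + m = n) (Ω : V [⋀^Fin n]→ₗ[ℝ] ℝ)
    (α : V [⋀^Fin k]→ₗ[ℝ] ℝ) (v : Fin m → V) :
    starSum b h Ω α v =
      ∑ i : Fin k → ι, α (b ∘ i) * Ω (Fin.append (b ∘ i) v ∘ Fin.cast h.symm) := by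
  simp [starSum, volAppend_apply]

theorem starSum_eq (e : OrthonormalBasis ι ℝ V) (e' : OrthonormalBasis ι' ℝ V) (h : k + m = n)
    (Ω : V [⋀^Fin n]→ₗ[ℝ] ℝ) (α : V [⋀^Fin k]→ₗ[ℝ] ℝ) : starSum e h Ω α = starSum e' h Ω α :=
  sum_multilinear_smul_orthonormalBasis e e' α.toMultilinearMap (volAppend h Ω)

theorem sum_neg_one_pow_mul_removeNth (b : OrthonormalBasis ι ℝ V) (hn : Fintype.card ι = n)
    (Ω : V [⋀^Fin n]→ₗ[ℝ] ℝ) (f : V →ₗ[ℝ] ℝ) (u : Fin (n + 1) → V) :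
    ∑ j : Fin (n + 1), (-1) ^ (j : ℕ) * (f (u j) * Ω (j.removeNth u)) = 0 := by
  have dependent : ¬LinearIndependent ℝ u := fun hu ↦ by
    have := Module.Finite.of_basis b.toBasis
    have := hu.fintype_card_le_finrank
    simp [Module.finrank_eq_card_basis b.toBasis] at this
    omega
  have := (AlternatingMap.alternatizeUncurryFin (f.smulRight Ω)).map_linearDependent u dependent
  simpa [AlternatingMap.alternatizeUncurryFin_apply] using this

theorem sum_mul_inner_mul_removeNth (b : OrthonormalBasis ι ℝ V) (h : k + m = n)
    (Ω : V [⋀^Fin n]→ₗ[ℝ] ℝ) (α : V [⋀^Fin (k + 1)]→ₗ[ℝ] ℝ) (w : V) (v : Fin m → V)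
    (c : Fin (k + 1)) :
    ∑ i : Fin (k + 1) → ι, α (b ∘ i) * ((-1) ^ (c : ℕ) * (inner ℝ w (b (i c)) *
        Ω (Fin.append (c.removeNth (b ∘ i)) v ∘ Fin.cast h.symm))) =
      starSum b h Ω (α.curryLeft w) v := by
  rw [starSum_apply, ← (Fin.insertNthEquiv (fun _ ↦ ι) c).sum_comp, Fintype.sum_prod_type,
    Finset.sum_comm]
  refine Finset.sum_congr rfl fun i _ ↦ ?_
  have expand : α (Matrix.vecCons w (b ∘ i)) =
      ∑ p, inner ℝ w (b p) * α (Matrix.vecCons (b p) (b ∘ i)) := by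
    have := congrArg (fun x ↦ α.curryLeft x (b ∘ i)) (b.sum_repr' w)
    simpa [alternatingMap_sum_apply, real_inner_comm] using this.symm
  simp only [Fin.insertNthEquiv, Equiv.coe_fn_mk, comp_insertNth, Fin.removeNth_insertNth,
    AlternatingMap.map_insertNth, AlternatingMap.curryLeft_apply_apply, expand, Finset.sum_mul]
  refine Finset.sum_congr rfl fun p _ ↦ ?_
  have sq : (-1 : ℝ) ^ (c : ℕ) * (-1) ^ (c : ℕ) = 1 := by rw [← mul_pow]; simp
  simp
  linear_combination α (Matrix.vecCons (b p) (b ∘ i)) * inner ℝ w (b p) *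
    Ω (Fin.append (b ∘ i) v ∘ Fin.cast h.symm) * sq

theorem starSum_curryLeft (b : OrthonormalBasis ι ℝ V) (hn : Fintype.card ι = n)
    (h : k + (m + 1) = n) (h' : k + 1 + m = n) (Ω : V [⋀^Fin n]→ₗ[ℝ] ℝ)
    (α : V [⋀^Fin (k + 1)]→ₗ[ℝ] ℝ) (w : V) (v : Fin (m + 1) → V) :
    (k + 1) * starSum b h Ω (α.curryLeft w) v =
      (-1) ^ k * ∑ j : Fin (m + 1), (-1) ^ (j : ℕ) *
        (inner ℝ w (v j) * starSum b h' Ω α (j.removeNth v)) := by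
  have hk : k + 1 + (m + 1) = n + 1 := by omega
  let term (i : Fin (k + 1) → ι) (j : Fin (n + 1)) : ℝ :=
    let u := Fin.append (b ∘ i) v ∘ Fin.cast hk.symm
    α (b ∘ i) * ((-1) ^ (j : ℕ) * (inner ℝ w (u j) * Ω (j.removeNth u)))
  have left (c : Fin (k + 1)) : ∑ i, term i (Fin.cast hk (Fin.castAdd (m + 1) c)) =
      starSum b h Ω (α.curryLeft w) v := by
    rw [← sum_mul_inner_mul_removeNth b h Ω α w v c]
    simp only [term, removeNth_append_castAdd h hk]
    simp
  have right (c : Fin (m + 1)) : ∑ i, term i (Fin.cast hk (Fin.natAdd (k + 1) c)) =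
      (-1) ^ (k + 1) * ((-1) ^ (c : ℕ) *
        (inner ℝ w (v c) * starSum b h' Ω α (c.removeNth v))) := by
    simp only [term, starSum_apply, Finset.mul_sum]
    refine Finset.sum_congr rfl fun i _ ↦ ?_
    rw [removeNth_append_natAdd h' hk]
    simp [pow_add]
    ring
  have total : ∑ i, ∑ j, term i j = 0 :=
    Finset.sum_eq_zero fun i _ ↦ by
      simp only [term, ← Finset.mul_sum]
      exact mul_eq_zero_of_right _ (sum_neg_one_pow_mul_removeNth b hn Ω (innerₛₗ ℝ w) _)
  rw [Finset.sum_comm, ← (finCongr hk).sum_comp, Fin.sum_univ_add] at total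
  simp only [finCongr_apply, left, right, Finset.sum_const, Finset.card_univ, Fintype.card_fin,
    ← Finset.mul_sum, nsmul_eq_mul] at total
  push_cast at total
  linear_combination total

theorem IsAdapted.vol_comp {Φ : V [⋀^Fin 4]→ₗ[ℝ] ℝ} {Ω : V [⋀^Fin 8]→ₗ[ℝ] ℝ}
    {e : OrthonormalBasis (Fin 8) ℝ V} (h : IsAdapted Φ Ω e) (w : Fin 8 → Fin 8) :
    Ω (e ∘ w) = tupleSign w := by
  refine eq_of_eq_of_strictMono (F := fun w ↦ Ω (e ∘ w)) (G := fun w ↦ (tupleSign w : ℝ))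
    (fun w σ ↦ Ω.map_perm (e ∘ w) σ) (fun w σ ↦ ?_) (fun w hw ↦ ?_) w
  · simp [tupleSign_comp_perm, Units.smul_def]
  · have surjective := Finite.surjective_of_injective hw.injective
    have w_eq : w = id := congrArg (fun f : Fin 8 ≃o Fin 8 ↦ (f : Fin 8 → Fin 8)) <|
      Subsingleton.elim (hw.orderIsoOfSurjective _ surjective) (OrderIso.refl _)
    rw [tupleSign_of_strictMono hw, w_eq]
    simpa using h.vol

theorem multilinearMap_ext_orthonormalBasis {A : Type*} [AddCommMonoid A] [Module ℝ A]
    (b : OrthonormalBasis ι ℝ V) {f g : MultilinearMap ℝ (fun _ : Fin k ↦ V) A}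
    (h : ∀ i : Fin k → ι, f (b ∘ i) = g (b ∘ i)) : f = g :=
  Module.Basis.ext_multilinear (fun _ ↦ b.toBasis) fun i ↦ by
    rw [b.coe_toBasis]
    exact h i

theorem IsAdapted.starSum_phi {Φ : V [⋀^Fin 4]→ₗ[ℝ] ℝ} {Ω : V [⋀^Fin 8]→ₗ[ℝ] ℝ}
    {e : OrthonormalBasis (Fin 8) ℝ V} (h : IsAdapted Φ Ω e) (b : OrthonormalBasis ι ℝ V)
    (h₈ : 4 + 4 = 8) : starSum b h₈ Ω Φ = (24 : ℝ) • Φ.toMultilinearMap := by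
  rw [starSum_eq b e]
  refine multilinearMap_ext_orthonormalBasis e fun j ↦ ?_
  have append_eq (i : Fin 4 → Fin 8) : Fin.append (e ∘ i) (e ∘ j) ∘ Fin.cast h₈.symm =
      e ∘ Fin.append i j ∘ Fin.cast h₈.symm := by
    rw [← Function.comp_assoc, comp_append]
  have selfDual := congrArg (Int.cast : ℤ → ℝ) (sum_stdPhi_mul_tupleSign j)
  push_cast at selfDual
  rw [smul_apply, AlternatingMap.coe_multilinearMap, smul_eq_mul, starSum_apply]
  simp only [append_eq, h.vol_comp, h.phi, tupleSign_comp_cast, selfDual]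

end HodgeStar

section AlternatingArrays

variable {ι : Type*}

/-- The components of a 3-form. -/
structure IsAlt3 (T : ι → ι → ι → ℝ) : Prop where
  swap₁ : ∀ i j k, T j i k = -T i j k
  swap₂ : ∀ i j k, T i k j = -T i j k

/-- The components of a 4-form. -/
structure IsAlt4 (F : ι → ι → ι → ι → ℝ) : Prop where
  swap₁ : ∀ i j k l, F j i k l = -F i j k l
  swap₂ : ∀ i j k l, F i k j l = -F i j k l
  swap₃ : ∀ i j k l, F i j l k = -F i j k l

namespace IsAlt3

variable {T : ι → ι → ι → ℝ}

theorem rotate (hT : IsAlt3 T) (i j k) : T j k i = T i j k := by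
  rw [hT.swap₂, hT.swap₁, neg_neg]

theorem smul (hT : IsAlt3 T) (c : ℝ) : IsAlt3 (c • T) where
  swap₁ i j k := by simp only [Pi.smul_apply, hT.swap₁ i j k, smul_neg]
  swap₂ i j k := by simp only [Pi.smul_apply, hT.swap₂ i j k, smul_neg]

theorem sum_mul_rotate [Fintype ι] (hT : IsAlt3 T) (g : ι → ι → ι → ℝ) :
    ∑ a, ∑ b, ∑ c, T a b c * g b c a = ∑ a, ∑ b, ∑ c, T a b c * g a b c := by
  refine Eq.trans ?_ Finset.sum_comm_cycle.symm
  simp only [hT.rotate]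

end IsAlt3

namespace IsAlt4

variable {F : ι → ι → ι → ι → ℝ}

theorem swap_pairs (hF : IsAlt4 F) (i j k l) : F k l i j = F i j k l := by
  rw [hF.swap₂, hF.swap₁, hF.swap₃, hF.swap₂]; ring

theorem rotate (hF : IsAlt4 F) (i j k l) : F l i j k = -F i j k l := by
  rw [hF.swap₁, hF.swap₂, hF.swap₃]; ring

theorem self₁₂ (hF : IsAlt4 F) (i k l) : F i i k l = 0 :=
  self_eq_neg.1 (hF.swap₁ i i k l)

theorem self₂₃ (hF : IsAlt4 F) (i j l) : F i j j l = 0 :=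
  self_eq_neg.1 (hF.swap₂ i j j l)

theorem self₂₄ (hF : IsAlt4 F) (i j l) : F i j l j = 0 := by
  rw [hF.swap₃, hF.self₂₃, neg_zero]

theorem self₁₃ (hF : IsAlt4 F) (i j l) : F i j i l = 0 := by
  rw [hF.swap₂, hF.self₁₂, neg_zero]

theorem self₁₄ (hF : IsAlt4 F) (i j k) : F i j k i = 0 := by
  rw [hF.swap₃, hF.self₁₃, neg_zero]

end IsAlt4

variable [Fintype ι] (F : ι → ι → ι → ι → ℝ)

/-- The array `T_{abi} F_{abjk}`. -/
def contr₂ (T : ι → ι → ι → ℝ) (i j k : ι) : ℝ :=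
  ∑ a, ∑ b, T a b i * F a b j k

/-- The covector `T_{abc} F_{abcs}`. -/
def contr₃ : (ι → ι → ι → ℝ) →ₗ[ℝ] ι → ℝ where
  toFun T s := ∑ a, ∑ b, ∑ c, T a b c * F a b c s
  map_add' T S := by
    ext s
    simp only [Pi.add_apply, add_mul, Finset.sum_add_distrib]
  map_smul' r T := by
    ext s
    simp only [Pi.smul_apply, smul_eq_mul, mul_assoc, Finset.mul_sum, RingHom.id_apply]

/-- The endomorphism `β_{ij} ↦ β_{ab} F_{abij}` of 2-tensors. -/
def opPhi : (ι → ι → ℝ) →ₗ[ℝ] ι → ι → ℝ where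
  toFun β i j := ∑ a, ∑ b, β a b * F a b i j
  map_add' β γ := by
    ext i j
    simp only [Pi.add_apply, add_mul, Finset.sum_add_distrib]
  map_smul' r β := by
    ext i j
    simp only [Pi.smul_apply, smul_eq_mul, mul_assoc, Finset.mul_sum, RingHom.id_apply]

theorem contr₃_apply (T : ι → ι → ι → ℝ) (s) :
    contr₃ F T s = ∑ a, ∑ b, ∑ c, T a b c * F a b c s :=
  rfl

theorem opPhi_apply (β : ι → ι → ℝ) (i j) : opPhi F β i j = ∑ a, ∑ b, β a b * F a b i j :=
  rfl

theorem sum_contr₃_mul (T : ι → ι → ι → ℝ) (g : ι → ℝ) :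
    ∑ s, contr₃ F T s * g s = ∑ a, ∑ b, ∑ c, T a b c * ∑ s, F a b c s * g s := by
  simp only [contr₃_apply, Finset.sum_mul, Finset.mul_sum, mul_assoc]
  rw [Finset.sum_comm]
  refine Finset.sum_congr rfl fun a _ ↦ ?_
  rw [Finset.sum_comm]
  exact Finset.sum_congr rfl fun b _ ↦ Finset.sum_comm

variable {F}

theorem IsAlt4.contr₂_swap (hF : IsAlt4 F) (T : ι → ι → ι → ℝ) (i j k) :
    contr₂ F T i k j = -contr₂ F T i j k := by
  simp only [contr₂, hF.swap₃ _ _ j k, mul_neg, Finset.sum_neg_distrib]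

theorem IsAlt4.contr₃_swap (hF : IsAlt4 F) (T : ι → ι → ι → ℝ) :
    contr₃ F (fun a b c ↦ T b a c) = -contr₃ F T := by
  ext s
  simp only [contr₃_apply, Pi.neg_apply, ← Finset.sum_neg_distrib]
  rw [Finset.sum_comm]
  refine Finset.sum_congr rfl fun a _ ↦ Finset.sum_congr rfl fun b _ ↦
    Finset.sum_congr rfl fun c _ ↦ ?_
  rw [hF.swap₁ a b c s, mul_neg]

theorem IsAlt4.contr₃_rotate (hF : IsAlt4 F) (T : ι → ι → ι → ℝ) :
    contr₃ F (fun a b c ↦ T b c a) = contr₃ F T := by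
  ext s
  rw [contr₃_apply, contr₃_apply]
  refine Eq.trans ?_ Finset.sum_comm_cycle.symm
  refine Finset.sum_congr rfl fun a _ ↦ Finset.sum_congr rfl fun b _ ↦
    Finset.sum_congr rfl fun c _ ↦ ?_
  rw [hF.swap₂ b a c s, hF.swap₁ a b c s, neg_neg]

theorem IsAlt4.contr₃_cyclic_sum (hF : IsAlt4 F) (T : ι → ι → ι → ℝ) :
    contr₃ F (fun a b c ↦ T a b c + T b c a + T c a b) = (3 : ℝ) • contr₃ F T := by
  have rotated := hF.contr₃_rotate fun a b c ↦ T c a b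
  change contr₃ F (T + (fun a b c ↦ T b c a) + fun a b c ↦ T c a b) = _
  rw [map_add, map_add, ← rotated, hF.contr₃_rotate T]
  module

end AlternatingArrays

section SpinArrays

/-- The Kronecker symbol, with real values. -/
abbrev kd (i j : Fin 8) : ℝ := if i = j then 1 else 0

/-- The components of a `Spin(7)`-form in an orthonormal basis, characterized by their symmetry
and the value of the contraction of two copies over one index. -/
structure IsSpinArray (F : Fin 8 → Fin 8 → Fin 8 → Fin 8 → ℝ) : Prop extends IsAlt4 F where
  contract : ∀ i j k a b c, ∑ p, F i j k p * F a b c p =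
    kd i a * (kd j b * kd k c - kd j c * kd k b)
      - kd i b * (kd j a * kd k c - kd j c * kd k a)
      + kd i c * (kd j a * kd k b - kd j b * kd k a)
      - kd i a * F j k b c - kd i b * F j k c a - kd i c * F j k a b
      - kd j a * F k i b c - kd j b * F k i c a - kd j c * F k i a b
      - kd k a * F i j b c - kd k b * F i j c a - kd k c * F i j a b

namespace IsSpinArray

variable {F : Fin 8 → Fin 8 → Fin 8 → Fin 8 → ℝ}

theorem contract₂ (hF : IsSpinArray F) (i j k l) : ∑ p, ∑ q, F i j p q * F k l p q =
    6 * (kd i k * kd j l - kd i l * kd j k) - 4 * F i j k l := by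
  simp only [hF.contract, Finset.sum_add_distrib, Finset.sum_sub_distrib, hF.self₂₄, hF.self₂₃,
    mul_zero, mul_sub, kd, mul_ite, ite_mul, mul_one, one_mul, zero_mul, Finset.sum_ite_eq,
    Finset.sum_ite_eq', Finset.mem_univ, if_true, Finset.sum_const, Finset.card_univ,
    Fintype.card_fin, Finset.sum_ite_irrel, nsmul_eq_mul]
  rw [hF.swap₁ i j k l, hF.swap₃ i j k l]
  split_ifs <;> simp_all [hF.self₁₃, hF.self₁₄] <;> ring

theorem contract₃ (hF : IsSpinArray F) (i j) :
    ∑ p, ∑ q, ∑ s, F i p q s * F j p q s = 42 * kd i j := by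
  simp only [hF.contract₂, Finset.sum_sub_distrib, hF.self₂₄, mul_zero, mul_sub, kd, mul_ite,
    mul_one, Finset.sum_ite_eq', Finset.mem_univ, if_true, Finset.sum_const, Finset.card_univ,
    Fintype.card_fin, nsmul_eq_mul]
  split_ifs <;> simp_all
  norm_num

theorem sum_mul_contract₂ (hF : IsSpinArray F) {β : Fin 8 → Fin 8 → ℝ}
    (hβ : ∀ i j, β j i = -β i j) (i j) :
    ∑ a, ∑ b, β a b * ∑ c, ∑ d, F a b c d * F i j c d = 12 * β i j - 4 * opPhi F β i j := by
  simp only [hF.contract₂, mul_sub, Finset.sum_sub_distrib, opPhi_apply, Finset.mul_sum,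
    mul_left_comm (β _ _) (_ : ℝ), kd, mul_ite, mul_one, mul_zero, Finset.sum_ite_eq',
    Finset.mem_univ, if_true]
  rw [hβ i j]
  ring

theorem opPhi_opPhi (hF : IsSpinArray F) {β : Fin 8 → Fin 8 → ℝ} (hβ : ∀ i j, β j i = -β i j) :
    opPhi F (opPhi F β) = (12 : ℝ) • β - (4 : ℝ) • opPhi F β := by
  ext i j
  rw [Pi.sub_apply, Pi.sub_apply, Pi.smul_apply, Pi.smul_apply, Pi.smul_apply, Pi.smul_apply,
    smul_eq_mul, smul_eq_mul, ← hF.sum_mul_contract₂ hβ]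
  simp only [opPhi_apply, Finset.sum_mul, Finset.mul_sum]
  rw [Finset.sum_congr rfl fun a _ ↦ Finset.sum_comm, Finset.sum_comm]
  refine Finset.sum_congr rfl fun c _ ↦ ?_
  rw [Finset.sum_congr rfl fun a _ ↦ Finset.sum_comm, Finset.sum_comm]
  refine Finset.sum_congr rfl fun d _ ↦ Finset.sum_congr rfl fun a _ ↦
    Finset.sum_congr rfl fun b _ ↦ ?_
  rw [hF.swap_pairs i j a b, mul_assoc]

theorem sum_mul_contract₃ (hF : IsSpinArray F) (τ : Fin 8 → ℝ) (m) :
    ∑ j, ∑ k, ∑ l, (∑ s, τ s * F s j k l) * F m j k l = 42 * τ m := by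
  calc ∑ j, ∑ k, ∑ l, (∑ s, τ s * F s j k l) * F m j k l
      = ∑ s, τ s * ∑ j, ∑ k, ∑ l, F s j k l * F m j k l := by
        simp only [Finset.sum_mul, Finset.mul_sum, mul_assoc]
        rw [Finset.sum_congr rfl fun i _ ↦ Finset.sum_comm_cycle, Finset.sum_comm]
    _ = 42 * τ m := by
        simp only [hF.contract₃, kd, mul_ite, mul_one, mul_zero, Finset.sum_ite_eq',
          Finset.mem_univ, if_true]
        ring

theorem contr₃_sum_mul (hF : IsSpinArray F) (τ : Fin 8 → ℝ) :
    contr₃ F (fun i j k ↦ ∑ t, τ t * F t i j k) = (-42 : ℝ) • τ := by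
  ext s
  rw [Pi.smul_apply, smul_eq_mul, neg_mul, ← hF.sum_mul_contract₃ τ s]
  simp only [contr₃_apply, ← Finset.sum_neg_distrib]
  refine Finset.sum_congr rfl fun i _ ↦ Finset.sum_congr rfl fun j _ ↦
    Finset.sum_congr rfl fun k _ ↦ ?_
  rw [hF.rotate i j k s, mul_neg, neg_neg]

theorem sum_mul_contract (hF : IsSpinArray F) {T : Fin 8 → Fin 8 → Fin 8 → ℝ} (hT : IsAlt3 T)
    (i j k) : ∑ a, ∑ b, ∑ c, T a b c * ∑ s, F a b c s * F i j k s =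
      6 * T i j k - 3 * (contr₂ F T i j k + contr₂ F T j k i + contr₂ F T k i j) := by
  have third : ∀ i j k, ∑ a, ∑ b, ∑ c, T a b c * (kd c i * F a b j k) = contr₂ F T i j k := by
    intro i j k
    simp only [kd, ite_mul, one_mul, zero_mul, mul_ite, mul_zero, Finset.sum_ite_eq',
      Finset.mem_univ, if_true, contr₂]
  have first : ∀ i j k, ∑ a, ∑ b, ∑ c, T a b c * (kd a i * F b c j k) = contr₂ F T i j k :=
    fun i j k ↦ (hT.sum_mul_rotate fun a b c ↦ kd c i * F a b j k).trans (third i j k)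
  have second : ∀ i j k, ∑ a, ∑ b, ∑ c, T a b c * (kd b i * F c a j k) = contr₂ F T i j k :=
    fun i j k ↦ (hT.sum_mul_rotate fun a b c ↦ kd a i * F b c j k).trans (first i j k)
  have delta : ∀ i j k, ∑ a, ∑ b, ∑ c, T a b c * (kd a i * (kd b j * kd c k)) = T i j k := by
    intro i j k
    simp [kd]
  have expand : ∀ a b c, T a b c * ∑ s, F a b c s * F i j k s =
      T a b c * (kd a i * (kd b j * kd c k)) - T a b c * (kd a i * (kd b k * kd c j))
      - T a b c * (kd a j * (kd b i * kd c k)) + T a b c * (kd a j * (kd b k * kd c i))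
      + T a b c * (kd a k * (kd b i * kd c j)) - T a b c * (kd a k * (kd b j * kd c i))
      - T a b c * (kd a i * F b c j k) - T a b c * (kd a j * F b c k i)
      - T a b c * (kd a k * F b c i j)
      - T a b c * (kd b i * F c a j k) - T a b c * (kd b j * F c a k i)
      - T a b c * (kd b k * F c a i j)
      - T a b c * (kd c i * F a b j k) - T a b c * (kd c j * F a b k i)
      - T a b c * (kd c k * F a b i j) := by
    intro a b c
    rw [hF.contract]
    ring
  simp only [expand, Finset.sum_sub_distrib, Finset.sum_add_distrib, first, second, third, delta]
  linarith [hT.swap₂ i j k, hT.swap₁ i j k, hT.rotate i j k, hT.rotate k i j, hT.swap₂ k i j]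

theorem contr₂_cyclic_sum (hF : IsSpinArray F) {T : Fin 8 → Fin 8 → Fin 8 → ℝ} (hT : IsAlt3 T)
    (i j k) : contr₂ F T i j k + contr₂ F T j k i + contr₂ F T k i j =
      2 * T i j k + 1 / 3 * ∑ s, contr₃ F T s * F s i j k := by
  have h := hF.sum_mul_contract hT i j k
  rw [← sum_contr₃_mul] at h
  simp only [hF.rotate i j k, mul_neg, Finset.sum_neg_distrib]
  linarith

theorem contr₃_contr₂_cyclic_sum (hF : IsSpinArray F) {T : Fin 8 → Fin 8 → Fin 8 → ℝ}
    (hT : IsAlt3 T) :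
    contr₃ F (fun i j k ↦ contr₂ F T i j k + contr₂ F T j k i + contr₂ F T k i j) =
      (-12 : ℝ) • contr₃ F T := by
  have decomposition :
      (fun i j k ↦ contr₂ F T i j k + contr₂ F T j k i + contr₂ F T k i j) =
        (2 : ℝ) • T + (1 / 3 : ℝ) • fun i j k ↦ ∑ t, contr₃ F T t * F t i j k := by
    ext i j k
    exact hF.contr₂_cyclic_sum hT i j k
  rw [decomposition, map_add, map_smul, map_smul, hF.contr₃_sum_mul]
  module

theorem contr₂_skew (hF : IsSpinArray F) {T : Fin 8 → Fin 8 → Fin 8 → ℝ} (hT : IsAlt3 T)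
    (i j k) : contr₂ F T i j k - contr₂ F T j i k =
      2 * T k i j + 1 / 3 * ∑ s, contr₃ F T s * F s k i j - contr₂ F T k i j := by
  linarith [hF.contr₂_cyclic_sum hT k i j, hF.contr₂_swap T j k i]

theorem sum_mul_swapped_contract₂ (hF : IsSpinArray F) {ρ : Fin 8 → Fin 8 → ℝ}
    (hρ : ∀ i j, ρ j i = -ρ i j) (i m) :
    ∑ j, ∑ k, ∑ l, (∑ s, ρ j s * F i s k l) * F m j k l = -6 * ρ i m - 4 * opPhi F ρ i m := by
  have reindexed : ∀ j s, F i s m j = F j s i m := fun j s ↦ by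
    rw [hF.swap_pairs m j i s, hF.swap₁ j m i s, hF.swap₂ j i m s, hF.swap₃ j i s m,
      hF.swap₂ j s i m]
    ring
  have diagonal : ∀ j, ρ j j = 0 := fun j ↦ self_eq_neg.1 (hρ j j)
  calc ∑ j, ∑ k, ∑ l, (∑ s, ρ j s * F i s k l) * F m j k l
      = ∑ j, ∑ s, ρ j s * ∑ k, ∑ l, F i s k l * F m j k l := by
        simp only [Finset.sum_mul, Finset.mul_sum, mul_assoc]
        exact Finset.sum_congr rfl fun j _ ↦ Finset.sum_comm_cycle
    _ = -6 * ρ i m - 4 * opPhi F ρ i m := by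
        simp only [hF.contract₂, mul_sub, Finset.sum_sub_distrib, opPhi_apply, Finset.mul_sum,
          reindexed, mul_left_comm (ρ _ _) (_ : ℝ)]
        simp [kd, diagonal]

/-- An infinitesimal stabilizer of the `Spin(7)`-form lies in `Λ²₂₁`, the `2`-eigenspace of
`opPhi` on skew 2-tensors. -/
theorem opPhi_eq_two_smul (hF : IsSpinArray F) {ρ : Fin 8 → Fin 8 → ℝ}
    (hρ : ∀ i j, ρ j i = -ρ i j)
    (stab : ∀ i j k l, ∑ s, (ρ i s * F s j k l + ρ j s * F i s k l + ρ k s * F i j s l +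
      ρ l s * F i j k s) = 0) : opPhi F ρ = (2 : ℝ) • ρ := by
  ext i m
  have contracted : ∑ j, ∑ k, ∑ l, (∑ s, (ρ i s * F s j k l + ρ j s * F i s k l +
      ρ k s * F i j s l + ρ l s * F i j k s)) * F m j k l = 0 := by
    simp only [stab, zero_mul, Finset.sum_const_zero]
  simp only [Finset.sum_add_distrib, add_mul] at contracted
  have first := hF.sum_mul_contract₃ (ρ i) m
  have second := hF.sum_mul_swapped_contract₂ hρ i m
  have third : ∑ j, ∑ k, ∑ l, (∑ s, ρ k s * F i j s l) * F m j k l =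
      ∑ j, ∑ k, ∑ l, (∑ s, ρ j s * F i s k l) * F m j k l := by
    rw [Finset.sum_comm]
    refine Finset.sum_congr rfl fun j _ ↦ Finset.sum_congr rfl fun k _ ↦
      Finset.sum_congr rfl fun l _ ↦ ?_
    simp only [hF.swap₂ m j k l, hF.swap₂ i _ k l, mul_neg, Finset.sum_neg_distrib, neg_mul,
      neg_neg]
  have fourth : ∑ j, ∑ k, ∑ l, (∑ s, ρ l s * F i j k s) * F m j k l =
      ∑ j, ∑ k, ∑ l, (∑ s, ρ k s * F i j s l) * F m j k l := by
    refine Finset.sum_congr rfl fun j _ ↦ ?_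
    rw [Finset.sum_comm]
    refine Finset.sum_congr rfl fun k _ ↦ Finset.sum_congr rfl fun l _ ↦ ?_
    simp only [hF.swap₃ m j k l, hF.swap₃ i j _ l, mul_neg, Finset.sum_neg_distrib, neg_mul,
      neg_neg]
  rw [Pi.smul_apply, Pi.smul_apply, smul_eq_mul]
  linarith

end IsSpinArray

end SpinArrays

section CurvatureArrays

/-- The quadratic expression `T_{abs} T_{scd} + T_{bcs} T_{sad} + T_{cas} T_{sbd}` of the first
Bianchi identity. -/
def torsionSq {ι : Type*} [Fintype ι] (T : ι → ι → ι → ℝ) (a b c d : ι) : ℝ :=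
  ∑ s, (T a b s * T s c d + T b c s * T s a d + T c a s * T s b d)

theorem IsAlt3.torsionSq_rotate {ι : Type*} [Fintype ι] {T : ι → ι → ι → ℝ} (hT : IsAlt3 T)
    (a b c d) : torsionSq T b c d a = -torsionSq T a b c d := by
  simp only [torsionSq, ← Finset.sum_neg_distrib]
  refine Finset.sum_congr rfl fun t _ ↦ ?_
  rw [hT.swap₂ t a d, hT.rotate t c d, hT.rotate t a b, hT.swap₂ t b a, hT.rotate t c a,
    hT.rotate t d b, hT.swap₂ t b d]
  ring

/-- The components of the curvature `r` of a `Spin(7)`-connection with skew torsion `T`, together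
with those of the covariant derivative `N` of the torsion. -/
structure IsCurvatureArray (F : Fin 8 → Fin 8 → Fin 8 → Fin 8 → ℝ)
    (T : Fin 8 → Fin 8 → Fin 8 → ℝ) (N r : Fin 8 → Fin 8 → Fin 8 → Fin 8 → ℝ) : Prop where
  spin : IsSpinArray F
  alt : IsAlt3 T
  altN : ∀ a, IsAlt3 (N a)
  swap₁ : ∀ a b c d, r b a c d = -r a b c d
  swap₂ : ∀ a b c d, r a b d c = -r a b c d
  stab : ∀ a b i j k l, ∑ s, (r a b i s * F s j k l + r a b j s * F i s k l +
    r a b k s * F i j s l + r a b l s * F i j k s) = 0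
  bianchi : ∀ a b c d, r a b c d + r b c a d + r c a b d =
    N a b c d + N b c a d + N c a b d + torsionSq T a b c d

section Contractions

variable {ι : Type*} [Fintype ι]

/-- The skew part `P_{uv} - P_{vu}` of `P_{uv} = N_{uabc} F_{abcv}`; when `N` is the covariant
derivative of a 3-form `T`, this is the covariant exterior derivative of `contr₃ F T`. -/
def skewContr₃ (F N : ι → ι → ι → ι → ℝ) (u v : ι) : ℝ :=
  contr₃ F (N u) v - contr₃ F (N v) u

/-- The contraction `N_{aubc} F_{abcv}`. -/
def mixedContr₃ (F N : ι → ι → ι → ι → ℝ) (u v : ι) : ℝ := contr₃ F (fun a ↦ N a u) v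

/-- The divergence `N_{aauv}`. -/
def divergence (N : ι → ι → ι → ι → ℝ) (u v : ι) : ℝ := ∑ a, N a a u v

/-- The 2-form `τ_s T_{suv}` with `τ_s = T_{abc} F_{abcs}`. -/
def tauT (F : ι → ι → ι → ι → ℝ) (T : ι → ι → ι → ℝ) (u v : ι) : ℝ :=
  ∑ s, contr₃ F T s * T s u v

/-- The contraction `T_{uat} T_{jst} F_{jsva}`. -/
def quadContr (F : ι → ι → ι → ι → ℝ) (T : ι → ι → ι → ℝ) (u v : ι) : ℝ :=
  ∑ a, ∑ t, T u a t * contr₂ F T t v a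

variable {F : ι → ι → ι → ι → ℝ}

theorem IsAlt4.contr₃_torsionSq (hF : IsAlt4 F) {T : ι → ι → ι → ℝ} (hT : IsAlt3 T) (u v) :
    contr₃ F (torsionSq T u) v = -3 * quadContr F T u v := by
  set S : ι → ι → ι → ℝ := fun a j s ↦ ∑ t, T u a t * T t j s with hS
  have contracted : contr₃ F S v = -quadContr F T u v := by
    simp only [contr₃_apply, hS, quadContr, contr₂, Finset.sum_mul, Finset.mul_sum,
      ← Finset.sum_neg_distrib]
    refine Finset.sum_congr rfl fun a _ ↦ ?_
    rw [Finset.sum_comm_cycle]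
    refine Finset.sum_congr rfl fun t _ ↦ Finset.sum_congr rfl fun j _ ↦
      Finset.sum_congr rfl fun s _ ↦ ?_
    rw [hF.rotate j s v a, hT.rotate t j s]
    ring
  have decomposition : torsionSq T u = fun a j s ↦ S a j s + S j s a + S s a j := by
    ext a j s
    simp only [torsionSq, hS, ← Finset.sum_add_distrib]
    refine Finset.sum_congr rfl fun t _ ↦ ?_
    rw [hT.rotate t a j, hT.rotate t u s, hT.swap₁ u j t, hT.swap₂ t s a]
    ring
  rw [decomposition, hF.contr₃_cyclic_sum, Pi.smul_apply, contracted, smul_eq_mul]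
  ring

theorem IsAlt4.mixedContr₃_eq (hF : IsAlt4 F) {N : ι → ι → ι → ι → ℝ}
    (hN : ∀ a, IsAlt3 (N a)) (u v) :
    mixedContr₃ F N u v = -∑ a, contr₂ F (N a) u v a := by
  simp only [mixedContr₃, contr₃_apply, contr₂, ← Finset.sum_neg_distrib]
  refine Finset.sum_congr rfl fun a _ ↦ Finset.sum_congr rfl fun j _ ↦
    Finset.sum_congr rfl fun s _ ↦ ?_
  rw [hF.rotate j s v a, (hN a).rotate u j s]
  ring

theorem sum_contr₂_self {N : ι → ι → ι → ι → ℝ} (hN : ∀ a, IsAlt3 (N a)) (u v) :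
    ∑ a, contr₂ F (N a) a u v = opPhi F (divergence N) u v := by
  simp only [contr₂, opPhi_apply, divergence, Finset.sum_mul]
  refine Eq.trans ?_ Finset.sum_comm_cycle.symm
  refine Finset.sum_congr rfl fun s _ ↦ Finset.sum_congr rfl fun a _ ↦
    Finset.sum_congr rfl fun b _ ↦ ?_
  rw [(hN s).rotate s a b]

theorem IsAlt4.opPhi_skewContr₃ (hF : IsAlt4 F) (N : ι → ι → ι → ι → ℝ) (u v) :
    opPhi F (skewContr₃ F N) u v = -2 * ∑ a, ∑ s, contr₃ F (N a) s * F s a u v := by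
  have transposed : ∑ a, ∑ b, contr₃ F (N b) a * F a b u v =
      ∑ a, ∑ s, contr₃ F (N a) s * F s a u v :=
    Finset.sum_comm
  have swapped : ∑ a, ∑ b, contr₃ F (N a) b * F a b u v =
      -∑ a, ∑ s, contr₃ F (N a) s * F s a u v := by
    simp only [← Finset.sum_neg_distrib]
    refine Finset.sum_congr rfl fun a _ ↦ Finset.sum_congr rfl fun b _ ↦ ?_
    rw [hF.swap₁ b a u v, mul_neg]
  simp only [opPhi_apply, skewContr₃, sub_mul, Finset.sum_sub_distrib, transposed, swapped]
  ring

end Contractions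

namespace IsSpinArray

variable {F : Fin 8 → Fin 8 → Fin 8 → Fin 8 → ℝ}

theorem mixedContr₃_skew (hF : IsSpinArray F) {N : Fin 8 → Fin 8 → Fin 8 → Fin 8 → ℝ}
    (hN : ∀ a, IsAlt3 (N a)) (u v) :
    mixedContr₃ F N u v - mixedContr₃ F N v u = -2 * divergence N u v +
      1 / 6 * opPhi F (skewContr₃ F N) u v + opPhi F (divergence N) u v := by
  have cyclic := Finset.sum_congr rfl fun (a : Fin 8) (_ : a ∈ Finset.univ) ↦
    hF.contr₂_skew (hN a) u v a
  simp only [Finset.sum_sub_distrib, Finset.sum_add_distrib, ← Finset.mul_sum] at cyclic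
  rw [sum_contr₂_self hN] at cyclic
  rw [hF.mixedContr₃_eq hN, hF.mixedContr₃_eq hN, hF.opPhi_skewContr₃, divergence]
  linarith

variable {T : Fin 8 → Fin 8 → Fin 8 → ℝ}

theorem sum_contr₃_mul_contr₂_skew (hF : IsSpinArray F) (hT : IsAlt3 T) (u v) :
    ∑ s, contr₃ F T s * contr₂ F T u v s - ∑ s, contr₃ F T s * contr₂ F T v u s =
      2 * tauT F T u v - opPhi F (tauT F T) u v := by
  set N : Fin 8 → Fin 8 → Fin 8 → Fin 8 → ℝ := fun a ↦ contr₃ F T a • T with hN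
  have altN : ∀ a, IsAlt3 (N a) := fun a ↦ hT.smul _
  have mixed : ∀ u v, mixedContr₃ F N u v = -∑ s, contr₃ F T s * contr₂ F T u v s := by
    intro u v
    rw [hF.mixedContr₃_eq altN]
    simp only [hN, contr₂, Pi.smul_apply, smul_eq_mul, Finset.mul_sum, mul_assoc]
  have skew : skewContr₃ F N = 0 := by
    ext u v
    simp only [skewContr₃, hN, map_smul, Pi.smul_apply, smul_eq_mul, Pi.zero_apply]
    ring
  have div : divergence N = tauT F T := rfl
  have h := hF.mixedContr₃_skew altN u v
  rw [mixed, mixed, skew, div, map_zero, Pi.zero_apply, Pi.zero_apply] at h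
  linarith

theorem two_mul_quadContr (hF : IsSpinArray F) (hT : IsAlt3 T) (u v) :
    2 * quadContr F T u v + ∑ a, ∑ t, T u a t * contr₂ F T v a t =
      2 * (∑ a, ∑ t, T u a t * T t v a) - 1 / 3 * ∑ s, contr₃ F T s * contr₂ F T u v s := by
  have transposed : quadContr F T u v = ∑ a, ∑ t, T u a t * contr₂ F T a t v := by
    rw [quadContr, Finset.sum_comm]
    refine Finset.sum_congr rfl fun a _ ↦ Finset.sum_congr rfl fun t _ ↦ ?_
    rw [hT.swap₂ u a t, hF.contr₂_swap T a t v, neg_mul_neg]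
  have lee : ∑ a, ∑ t, T u a t * ∑ s, contr₃ F T s * F s t v a =
      -∑ s, contr₃ F T s * contr₂ F T u v s := by
    simp only [contr₂, Finset.mul_sum, ← Finset.sum_neg_distrib]
    rw [Finset.sum_comm_cycle]
    refine Finset.sum_congr rfl fun s _ ↦ Finset.sum_congr rfl fun a _ ↦
      Finset.sum_congr rfl fun t _ ↦ ?_
    rw [hT.rotate u a t, hF.rotate t v a s, hF.swap₂ t a v s, hF.swap₁ a t v s]
    ring
  have cyclic : ∀ a t, T u a t * contr₂ F T t v a + T u a t * contr₂ F T v a t +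
      T u a t * contr₂ F T a t v = 2 * (T u a t * T t v a) +
        1 / 3 * (T u a t * ∑ s, contr₃ F T s * F s t v a) := by
    intro a t
    linear_combination T u a t * hF.contr₂_cyclic_sum hT t v a
  have summed := Finset.sum_congr rfl fun (a : Fin 8) (_ : a ∈ Finset.univ) ↦
    Finset.sum_congr rfl fun (t : Fin 8) (_ : t ∈ Finset.univ) ↦ cyclic a t
  simp only [Finset.sum_add_distrib, ← Finset.mul_sum] at summed
  rw [lee, ← transposed, ← quadContr] at summed
  linarith

theorem quadContr_skew (hF : IsSpinArray F) (hT : IsAlt3 T) (u v) :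
    quadContr F T u v - quadContr F T v u =
      -(1 / 6) * (2 * tauT F T u v - opPhi F (tauT F T) u v) := by
  have phi_symm : ∑ a, ∑ t, T u a t * contr₂ F T v a t =
      ∑ a, ∑ t, T v a t * contr₂ F T u a t := by
    simp only [contr₂, Finset.mul_sum]
    rw [Finset.sum_congr rfl fun j _ ↦ Finset.sum_comm, Finset.sum_comm]
    refine Finset.sum_congr rfl fun a _ ↦ ?_
    rw [Finset.sum_congr rfl fun j _ ↦ Finset.sum_comm, Finset.sum_comm]
    refine Finset.sum_congr rfl fun b _ ↦ Finset.sum_congr rfl fun c _ ↦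
      Finset.sum_congr rfl fun d _ ↦ ?_
    rw [hF.swap_pairs c d a b, hT.rotate v a b, ← hT.rotate u c d]
    ring
  have square_symm : ∑ a, ∑ t, T u a t * T t v a = ∑ a, ∑ t, T v a t * T t u a := by
    refine Finset.sum_congr rfl fun a _ ↦ Finset.sum_congr rfl fun t _ ↦ ?_
    rw [← hT.rotate t v a, ← hT.rotate t u a, mul_comm]
  linarith [hF.two_mul_quadContr hT u v, hF.two_mul_quadContr hT v u,
    hF.sum_contr₃_mul_contr₂_skew hT u v]

end IsSpinArray

namespace IsCurvatureArray

variable {F : Fin 8 → Fin 8 → Fin 8 → Fin 8 → ℝ} {T : Fin 8 → Fin 8 → Fin 8 → ℝ}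
  {N r : Fin 8 → Fin 8 → Fin 8 → Fin 8 → ℝ}

theorem ricci_eq_contr₃ (h : IsCurvatureArray F T N r) (u v) :
    ∑ a, r a u v a = 1 / 2 * contr₃ F (r u) v := by
  rw [contr₃_apply, Finset.mul_sum]
  refine Finset.sum_congr rfl fun a _ ↦ ?_
  have spin_valued := congrFun₂ (h.spin.opPhi_eq_two_smul (h.swap₂ a u) (h.stab a u)) v a
  rw [opPhi_apply, Pi.smul_apply, Pi.smul_apply, smul_eq_mul] at spin_valued
  have rotated : ∑ j, ∑ s, r a u j s * F j s v a = ∑ j, ∑ s, r u a j s * F a j s v := by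
    refine Finset.sum_congr rfl fun j _ ↦ Finset.sum_congr rfl fun s _ ↦ ?_
    rw [h.swap₁ u a, h.spin.rotate j s v a, neg_mul_comm]
  linarith

/-- The Bianchi identity reduces the contraction of `r` to the torsion, because a 4-tensor that
is skew in the first and in the last two indices satisfies `2 (r_{uajs} + r_{ujsa} + r_{usaj}) =
b_{uajs} + b_{ujsa} + b_{usaj} + b_{ajsu}` for its cyclic sums `b_{abcd}` over the first three
indices. -/
theorem contr₃_curvature (h : IsCurvatureArray F T N r) (u v) :
    contr₃ F (r u) v = 1 / 2 * (contr₃ F (N u) v - mixedContr₃ F N u v) +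
      1 / 3 * contr₃ F (torsionSq T u) v := by
  set b : Fin 8 → Fin 8 → Fin 8 → Fin 8 → ℝ := fun a b c d ↦ r a b c d + r b c a d + r c a b d
  have cyclic : (fun a j s ↦ r u a j s + r u j s a + r u s a j) =
      (1 / 2 : ℝ) • ((fun a j s ↦ b u a j s + b u j s a + b u s a j) + fun a j s ↦ b a j s u) := by
    ext a j s
    simp only [b, Pi.smul_apply, Pi.add_apply, smul_eq_mul]
    linarith [h.swap₁ u a s j, h.swap₂ u a j s, h.swap₁ u j a s, h.swap₂ u j s a,
      h.swap₁ u s j a, h.swap₂ u s a j, h.swap₂ a j s u, h.swap₂ j s a u, h.swap₂ s a j u]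
  have leading : b u = N u - (fun a j s ↦ N a u j s) + (fun a j s ↦ N j u a s) +
      torsionSq T u := by
    ext a j s
    simp only [Pi.add_apply, Pi.sub_apply]
    linarith [h.bianchi u a j s, (h.altN a).swap₁ u j s]
  have trailing : (fun a j s ↦ b a j s u) =
      (fun a j s ↦ N a u j s + N j u s a + N s u a j) - torsionSq T u := by
    ext a j s
    simp only [Pi.sub_apply]
    linarith [h.bianchi a j s u, (h.altN a).rotate u j s, (h.altN j).rotate u s a,
      (h.altN s).rotate u a j, h.alt.torsionSq_rotate u a j s]
  have contracted := congrFun (congrArg (contr₃ F) cyclic) v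
  rw [h.spin.contr₃_cyclic_sum, map_smul, map_add, h.spin.contr₃_cyclic_sum, leading, trailing,
    map_sub, map_add, map_add, map_sub, h.spin.contr₃_swap fun a j s ↦ N a u j s,
    h.spin.contr₃_cyclic_sum fun a j s ↦ N a u j s] at contracted
  simp only [Pi.add_apply, Pi.sub_apply, Pi.smul_apply, Pi.neg_apply, smul_eq_mul] at contracted
  rw [mixedContr₃]
  linarith

theorem ricci_skew (h : IsCurvatureArray F T N r) (u v) :
    ∑ a, r a u v a - ∑ a, r a v u a =
      1 / 4 * (skewContr₃ F N u v - (mixedContr₃ F N u v - mixedContr₃ F N v u)) -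
        1 / 2 * (quadContr F T u v - quadContr F T v u) := by
  rw [h.ricci_eq_contr₃, h.ricci_eq_contr₃, h.contr₃_curvature, h.contr₃_curvature,
    h.spin.contr₃_torsionSq h.alt, h.spin.contr₃_torsionSq h.alt, skewContr₃]
  ring

theorem divergence_relation (h : IsCurvatureArray F T N r)
    (hdiv : ∀ u v, ∑ a, r a u v a - ∑ a, r a v u a = divergence N u v) :
    (2 : ℝ) • divergence N + opPhi F (divergence N) =
      skewContr₃ F N - (1 / 6 : ℝ) • opPhi F (skewContr₃ F N) + (2 / 3 : ℝ) • tauT F T -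
        (1 / 3 : ℝ) • opPhi F (tauT F T) := by
  ext u v
  simp only [Pi.add_apply, Pi.sub_apply, Pi.smul_apply, smul_eq_mul]
  linarith [hdiv u v, h.ricci_skew u v, h.spin.mixedContr₃_skew h.altN u v,
    h.spin.quadContr_skew h.alt u v]

end IsCurvatureArray

end CurvatureArrays

section QuadraticOperator

variable {E : Type*} [AddCommGroup E] [Module ℝ E] {P : E →ₗ[ℝ] E} {V W X : E}

theorem eq_zero_iff_of_quadratic (hV : P (P V) = (12 : ℝ) • V - (4 : ℝ) • P V)
    (hW : P (P W) = (12 : ℝ) • W - (4 : ℝ) • P W) (hX : P (P X) = (12 : ℝ) • X - (4 : ℝ) • P X)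
    (h : (2 : ℝ) • V + P V = W - (1 / 6 : ℝ) • P W + (2 / 3 : ℝ) • X - (1 / 3 : ℝ) • P X) :
    V = 0 ↔ W = -(1 / 3 : ℝ) • X + (1 / 6 : ℝ) • P X := by
  have hP := congrArg P h
  simp only [map_add, map_sub, map_smul, hV, hW, hX] at hP
  constructor
  · rintro rfl
    simp only [map_zero] at h hP
    linear_combination (norm := module) (-(5 / 4 : ℝ)) • h - (1 / 8 : ℝ) • hP
  · rintro rfl
    simp only [map_add, map_smul, hX] at h hP
    linear_combination (norm := module) (1 / 8 : ℝ) • h + (1 / 16 : ℝ) • hP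

theorem eq_neg_smul_of_quadratic (hX : P (P X) = (12 : ℝ) • X - (4 : ℝ) • P X)
    (h : W = -(1 / 3 : ℝ) • X + (1 / 6 : ℝ) • P X) : W = -(1 / 6 : ℝ) • P W := by
  rw [h, map_add, map_smul, map_smul, hX]
  module

end QuadraticOperator

section CoordinateFields

open Filter Topology

variable {E M : Type*} [NormedAddCommGroup E] [NormedSpace ℝ E] [TopologicalSpace M]
  [ChartedSpace E M]

theorem mvfderiv_congr {y : M} {f f' : M → ℝ} (h : f =ᶠ[𝓝 y] f') :
    d% f y = d% f' y := by
  ext w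
  change mfderiv 𝓘(ℝ, E) 𝓘(ℝ, ℝ) f y w = mfderiv 𝓘(ℝ, E) 𝓘(ℝ, ℝ) f' y w
  rw [h.mfderiv_eq]
  rfl

/-- The vector field on the model space with constant value `c`. -/
def constField (c z : E) : TangentSpace 𝓘(ℝ, E) z := c

theorem contMDiffAt_constField (c z : E) : CMDiffAt ∞ (T% (constField c)) z :=
  contMDiffAt_vectorSpace_iff_contDiffAt.2 (contDiffAt_const (c := c))

theorem mlieBracket_constField (c c' : E) :
    mlieBracket 𝓘(ℝ, E) (constField c) (constField c') = 0 := by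
  rw [← mlieBracketWithin_univ, mlieBracketWithin_eq_lieBracketWithin]
  funext z
  change fderivWithin ℝ (fun _ : E ↦ c') Set.univ z c -
    fderivWithin ℝ (fun _ : E ↦ c) Set.univ z c' = 0
  simp

variable [IsManifold 𝓘(ℝ, E) ∞ M]

/-- The local extension of a tangent vector at `x` that has constant coordinates in the chart at
`x`. On an 8-manifold this is `extV`. -/
abbrev coordField {x : M} (v : TangentSpace 𝓘(ℝ, E) x) (y : M) : TangentSpace 𝓘(ℝ, E) y :=
  extend E v y

/-- The differential at `y` of the chart at `x`. -/
def chartDeriv (x y : M) : TangentSpace 𝓘(ℝ, E) y →L[ℝ] E :=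
  (trivializationAt E (TangentSpace 𝓘(ℝ, E)) x).continuousLinearMapAt ℝ y

theorem mfderiv_extChartAt {x y : M} (hy : y ∈ (chartAt E x).source) :
    mfderiv 𝓘(ℝ, E) 𝓘(ℝ, E) (extChartAt 𝓘(ℝ, E) x) y = chartDeriv x y :=
  (TangentBundle.continuousLinearMapAt_trivializationAt (I := 𝓘(ℝ, E)) hy).symm

theorem chartDeriv_coordField {x y : M} (v : TangentSpace 𝓘(ℝ, E) x)
    (hy : y ∈ (chartAt E x).source) :
    chartDeriv x y (coordField v y) = chartDeriv x x v := by
  have hb : y ∈ (trivializationAt E (TangentSpace 𝓘(ℝ, E)) x).baseSet := hy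
  have h := (trivializationAt E (TangentSpace 𝓘(ℝ, E) : M → Type _) x).coe_linearMapAt_of_mem
    (R := ℝ) (FiberBundle.mem_baseSet_trivializationAt' x)
  have hv : coordField v y =
      (trivializationAt E (TangentSpace 𝓘(ℝ, E)) x).symmL ℝ y (chartDeriv x x v) := by
    rw [chartDeriv, Trivialization.continuousLinearMapAt_apply, h,
      Trivialization.symmL_apply _ hb]
    rfl
  rw [hv, chartDeriv]
  exact Trivialization.continuousLinearMapAt_symmL _ hb _

theorem coordField_eventuallyEq_mpullback {x : M} (v : TangentSpace 𝓘(ℝ, E) x) :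
    coordField v =ᶠ[𝓝 x]
      mpullback 𝓘(ℝ, E) 𝓘(ℝ, E) (extChartAt 𝓘(ℝ, E) x) (constField (chartDeriv x x v)) := by
  filter_upwards [(chartAt E x).open_source.mem_nhds (mem_chart_source E x)] with y hy
  have hi : (mfderiv 𝓘(ℝ, E) 𝓘(ℝ, E) (extChartAt 𝓘(ℝ, E) x) y).IsInvertible :=
    isInvertible_mfderiv_extChartAt (by rwa [extChartAt_source])
  rw [mpullback_apply, ← chartDeriv_coordField v hy, ← mfderiv_extChartAt hy]
  exact (hi.inverse_apply_self _).symm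

theorem minSmoothness_two_le : minSmoothness ℝ 2 ≤ ∞ := by
  rw [minSmoothness_of_isRCLikeNormedField]
  exact WithTop.coe_le_coe.2 (le_top : (2 : ℕ∞) ≤ ⊤)

/-- Both fields have constant coordinates in the chart at `x`. -/
theorem eventually_mlieBracket_coordField [CompleteSpace E] {x : M} (u v : TangentSpace 𝓘(ℝ, E) x) :
    ∀ᶠ y in 𝓝 x, mlieBracket 𝓘(ℝ, E) (coordField u) (coordField v) y = 0 := by
  filter_upwards [(coordField_eventuallyEq_mpullback u).eventually_nhds,
    (coordField_eventuallyEq_mpullback v).eventually_nhds,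
    (chartAt E x).open_source.mem_nhds (mem_chart_source E x)] with y hu hv hy
  have : IsManifold 𝓘(ℝ, E) (minSmoothness ℝ 2) M := by
    rw [minSmoothness_of_isRCLikeNormedField]
    infer_instance
  have hd (c : E) : MDiffAt (T% (constField c)) (extChartAt 𝓘(ℝ, E) x y) :=
    (contMDiffAt_constField c _).mdifferentiableAt (by simp)
  rw [EventuallyEq.mlieBracket_vectorField_eq hu hv,
    ← mpullback_mlieBracket (n := ∞) (hd _) (hd _) (contMDiffAt_extChartAt' hy)
      minSmoothness_two_le, mlieBracket_constField, mpullback_zero]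
  rfl

theorem mlieBracket_coordField [CompleteSpace E] {x : M} (u v : TangentSpace 𝓘(ℝ, E) x) :
    mlieBracket 𝓘(ℝ, E) (coordField u) (coordField v) x = 0 :=
  (eventually_mlieBracket_coordField u v).self_of_nhds

theorem contDiffAt_comp_extChartAt_symm {x y : M} (hy : y ∈ (chartAt E x).source) {n : ℕ∞ω}
    (hn : n ≤ ∞) {f : M → ℝ} (hf : CMDiffAt n f y) :
    ContDiffAt ℝ n (f ∘ (extChartAt 𝓘(ℝ, E) x).symm) (extChartAt 𝓘(ℝ, E) x y) := by
  have hs : y ∈ (extChartAt 𝓘(ℝ, E) x).source := by rwa [extChartAt_source]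
  rw [← contMDiffAt_iff_contDiffAt]
  refine ContMDiffAt.comp_of_eq (y := y) hf ?_ ((extChartAt 𝓘(ℝ, E) x).left_inv hs)
  exact ((contMDiffOn_extChartAt_symm (n := ∞) x).contMDiffAt
    ((isOpen_extChartAt_target x).mem_nhds ((extChartAt 𝓘(ℝ, E) x).map_source hs))).of_le hn

theorem mvfderiv_comp_extChartAt {x y : M} (hy : y ∈ (chartAt E x).source) {g : E → ℝ}
    (hg : DifferentiableAt ℝ g (extChartAt 𝓘(ℝ, E) x y)) (w : TangentSpace 𝓘(ℝ, E) y) :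
    d% (g ∘ extChartAt 𝓘(ℝ, E) x) y w =
      fderiv ℝ g (extChartAt 𝓘(ℝ, E) x y) (chartDeriv x y w) := by
  rw [mvfderiv_comp_apply y hg.mdifferentiableAt (mdifferentiableAt_extChartAt hy),
    mfderiv_extChartAt hy]
  exact congrArg (fun L : E →L[ℝ] ℝ ↦ L (chartDeriv (E := E) x y w)) mfderiv_eq_fderiv

theorem mvfderiv_eq_fderiv {x y : M} {f : M → ℝ} (hy : y ∈ (chartAt E x).source)
    (hf : CMDiffAt 1 f y) (w : TangentSpace 𝓘(ℝ, E) y) :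
    d% f y w = fderiv ℝ (f ∘ (extChartAt 𝓘(ℝ, E) x).symm) (extChartAt 𝓘(ℝ, E) x y)
      (chartDeriv x y w) := by
  have h : f =ᶠ[𝓝 y] (f ∘ (extChartAt 𝓘(ℝ, E) x).symm) ∘ extChartAt 𝓘(ℝ, E) x := by
    filter_upwards [(isOpen_extChartAt_source (I := 𝓘(ℝ, E)) x).mem_nhds
      (by rwa [extChartAt_source])] with z hz
    rw [Function.comp_apply, Function.comp_apply, (extChartAt 𝓘(ℝ, E) x).left_inv hz]
  rw [mvfderiv_congr h, mvfderiv_comp_extChartAt hy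
    ((contDiffAt_comp_extChartAt_symm hy (by simp) hf).differentiableAt (by simp))]

theorem mvfderiv_mvfderiv_coordField {x : M} {f : M → ℝ} (hf : CMDiffAt ∞ f x)
    (u v : TangentSpace 𝓘(ℝ, E) x) :
    d% (fun y ↦ d% f y (coordField v y)) x u =
      fderiv ℝ (fderiv ℝ (f ∘ (extChartAt 𝓘(ℝ, E) x).symm)) (extChartAt 𝓘(ℝ, E) x x)
        (chartDeriv x x u) (chartDeriv x x v) := by
  have hx := mem_chart_source E x
  have hdf : DifferentiableAt ℝ (fderiv ℝ (f ∘ (extChartAt 𝓘(ℝ, E) x).symm))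
      (extChartAt 𝓘(ℝ, E) x x) :=
    ((contDiffAt_comp_extChartAt_symm hx le_rfl hf).fderiv_right (m := ∞) (by simp))
      |>.differentiableAt (by simp)
  have heq : (fun y ↦ d% f y (coordField v y)) =ᶠ[𝓝 x]
      (fun z ↦ fderiv ℝ (f ∘ (extChartAt 𝓘(ℝ, E) x).symm) z (chartDeriv x x v)) ∘
        extChartAt 𝓘(ℝ, E) x := by
    filter_upwards [(chartAt E x).open_source.mem_nhds hx,
      (contMDiffAt_iff_contMDiffAt_nhds (by simp)).1 (hf.of_le (m := 1) (by simp))] with y hy hfy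
    rw [mvfderiv_eq_fderiv hy hfy, chartDeriv_coordField v hy]
    rfl
  rw [mvfderiv_congr heq,
    mvfderiv_comp_extChartAt hx (hdf.clm_apply (differentiableAt_const _)),
    fderiv_clm_apply hdf (differentiableAt_const _), fderiv_fun_const]
  simp only [Pi.zero_apply, ContinuousLinearMap.comp_zero, zero_add]
  rfl

theorem mvfderiv_mvfderiv_coordField_comm {x : M} {f : M → ℝ} (hf : CMDiffAt ∞ f x)
    (u v : TangentSpace 𝓘(ℝ, E) x) :
    d% (fun y ↦ d% f y (coordField v y)) x u = d% (fun y ↦ d% f y (coordField u y)) x v := by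
  rw [mvfderiv_mvfderiv_coordField hf, mvfderiv_mvfderiv_coordField hf]
  exact ((contDiffAt_comp_extChartAt_symm (mem_chart_source E x) le_rfl hf).isSymmSndFDerivAt
    minSmoothness_two_le).eq _ _

end CoordinateFields

section Smoothness

open Filter Topology

variable {E M : Type*} [NormedAddCommGroup E] [NormedSpace ℝ E] [TopologicalSpace M]
  [ChartedSpace E M]

theorem mdifferentiableAt_fun_sum {ι : Type} [Fintype ι] {f : ι → M → ℝ} {x : M}
    (hf : ∀ i, MDiffAt (f i) x) : MDiffAt (fun y ↦ ∑ i, f i y) x := by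
  rw [← Finset.sum_fn]
  exact MDifferentiableAt.sum fun i _ ↦ hf i

theorem mdifferentiableAt_fun_prod {ι : Type} [Fintype ι] {f : ι → M → ℝ} {x : M}
    (hf : ∀ i, MDiffAt (f i) x) : MDiffAt (fun y ↦ ∏ i, f i y) x := by
  rw [← Finset.prod_fn]
  exact MDifferentiableAt.prod fun i _ ↦ hf i

theorem mvfderiv_fun_sum {ι : Type} [Fintype ι] {f : ι → M → ℝ} {x : M}
    (hf : ∀ i, MDiffAt (f i) x) (u : TangentSpace 𝓘(ℝ, E) x) :
    d% (fun y ↦ ∑ i, f i y) x u = ∑ i, d% (f i) x u := by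
  have h : d% (∑ i, f i) x = ∑ i, d% (f i) x :=
    (HasMFDerivAt.sum (t := Finset.univ) fun i _ ↦ (hf i).hasMFDerivAt).mfderiv
  rw [← Finset.sum_fn, h, FunLike.coe_sum, Finset.sum_apply]

theorem mvfderiv_fun_sum_mul {ι : Type} [Fintype ι] {f g : ι → M → ℝ} {x : M}
    (hf : ∀ i, MDiffAt (f i) x) (hg : ∀ i, MDiffAt (g i) x) (u : TangentSpace 𝓘(ℝ, E) x) :
    d% (fun y ↦ ∑ i, f i y * g i y) x u = ∑ i, (f i x * d% (g i) x u + g i x * d% (f i) x u) :=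
  (mvfderiv_fun_sum (fun i ↦ (hf i).mul (hg i)) u).trans <|
    Finset.sum_congr rfl fun i _ ↦ congrArg (· u) (mvfderiv_mul (hf i) (hg i))

theorem mvfderiv_const_mul {f : M → ℝ} {x : M} (hf : MDiffAt f x) (c : ℝ)
    (u : TangentSpace 𝓘(ℝ, E) x) : d% (fun y ↦ c * f y) x u = c * d% f x u := by
  have h := mvfderiv_mul (f := fun _ : M ↦ c) mdifferentiableAt_const hf
  rw [mvfderiv_const, smul_zero, add_zero] at h
  exact congrArg (· u) h

variable [IsManifold 𝓘(ℝ, E) ∞ M]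

/-- Differentiability at `x` of the vector field `Y`. -/
abbrev DiffAt (Y : (y : M) → TangentSpace 𝓘(ℝ, E) y) (x : M) : Prop := MDiffAt (T% Y) x

/-- Smoothness at `x` of the vector field `Y`. -/
abbrev SmoothAt (Y : (y : M) → TangentSpace 𝓘(ℝ, E) y) (x : M) : Prop := CMDiffAt ∞ (T% Y) x

theorem SmoothAt.diffAt {Y : (y : M) → TangentSpace 𝓘(ℝ, E) y} {x : M} (h : SmoothAt Y x) :
    DiffAt Y x :=
  ContMDiffAt.mdifferentiableAt h (by simp)

theorem DiffAt.congr {Y Z : (y : M) → TangentSpace 𝓘(ℝ, E) y} {x : M} (h : DiffAt Y x)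
    (hYZ : ∀ᶠ y in 𝓝 x, Y y = Z y) : DiffAt Z x :=
  MDifferentiableAt.congr_of_eventuallyEq h (hYZ.mono fun y hy ↦ by simp only [hy])

theorem smoothAt_coordField {x : M} (v : TangentSpace 𝓘(ℝ, E) x) : SmoothAt (coordField v) x :=
  contMDiffAt_extend 𝓘(ℝ, E) E v

theorem eventually_smoothAt_coordField {x : M} (v : TangentSpace 𝓘(ℝ, E) x) :
    ∀ᶠ y in 𝓝 x, SmoothAt (coordField v) y := by
  obtain ⟨U, hU, h⟩ := exists_contMDiffOn_extend (k := ∞) 𝓘(ℝ, E) E v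
  filter_upwards [eventually_mem_nhds_iff.2 hU] with y hy using h.contMDiffAt hy

theorem eventually_eq_sum_coordField {ι : Type*} [Fintype ι] (b : Module.Basis ι ℝ E) (x : M)
    (Y : (y : M) → TangentSpace 𝓘(ℝ, E) y) :
    ∀ᶠ y in 𝓝 x, Y y =
      ∑ i, (trivializationAt E (TangentSpace 𝓘(ℝ, E)) x).localFrameCoeff 𝓘(ℝ, E) b i y (Y y) •
        coordField ((trivializationAt E (TangentSpace 𝓘(ℝ, E)) x).localFrame b i x) y := by
  set t := trivializationAt E (TangentSpace 𝓘(ℝ, E)) x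
  have hx : x ∈ t.baseSet := mem_baseSet_trivializationAt E (TangentSpace 𝓘(ℝ, E)) x
  filter_upwards [t.open_baseSet.mem_nhds hx] with y hy
  refine (t.eq_sum_localFrameCoeff_smul (I := 𝓘(ℝ, E)) (b := b) (s := Y) hy).trans
    (Finset.sum_congr rfl fun i _ ↦ ?_)
  congr 1
  rw [t.localFrame_apply_of_mem_baseSet b hx, t.localFrame_apply_of_mem_baseSet b hy]
  exact congrArg (t.symm y) (congrArg Prod.snd (t.apply_mk_symm hx (b i))).symm

variable [FiniteDimensional ℝ E] [T2Space M]
  {D : CovariantDerivative 𝓘(ℝ, E) E (fun x : M ↦ TangentSpace 𝓘(ℝ, E) x)}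

theorem diffAt_covariantDerivative (hD : D.ContMDiffCovariantDerivative ∞) {x : M}
    {Y Z : (y : M) → TangentSpace 𝓘(ℝ, E) y} (hY : ∀ᶠ y in 𝓝 x, SmoothAt Y y)
    (hZ : DiffAt Z x) : DiffAt (fun y ↦ D Y y (Z y)) x := by
  obtain ⟨U, hU, hUo, hxU⟩ := eventually_nhds_iff.1 hY
  obtain ⟨f, -, hf⟩ := (SmoothBumpFunction.nhds_basis_tsupport (I := 𝓘(ℝ, E)) x).mem_iff.1
    (hUo.mem_nhds hxU)
  have smooth_cutoff : CMDiff ∞ (T% ((f : M → ℝ) • Y)) :=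
    ContMDiffOn.smul_section_of_tsupport f.contMDiff.contMDiffOn hUo hf
      fun y hy ↦ (hU y hy).contMDiffWithinAt
  have diffAt_cutoff : DiffAt (fun y ↦ D ((f : M → ℝ) • Y) y (Z y)) x :=
    (((hD.contMDiff.contMDiff smooth_cutoff.contMDiffOn).contMDiffAt
      Filter.univ_mem).mdifferentiableAt (by simp)).clm_bundle_apply hZ
  refine diffAt_cutoff.congr ?_
  filter_upwards [hY, f.eventuallyEq_one.eventually_nhds] with y hy hfy
  have D_cutoff : D ((f : M → ℝ) • Y) y = D Y y := by
    refine D.isCovariantDerivativeOn.congr_of_eventuallyEq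
      (smooth_cutoff.contMDiffAt.mdifferentiableAt (by simp)) hy.diffAt Filter.univ_mem ?_
    filter_upwards [hfy] with z hz
    simp [hz]
  rw [D_cutoff]

theorem diffAt_torsion_coordField (hD : D.ContMDiffCovariantDerivative ∞) {x : M}
    (u v : TangentSpace 𝓘(ℝ, E) x) :
    DiffAt (fun y ↦ D.torsion y (coordField u y) (coordField v y)) x := by
  have : CompleteSpace E := FiniteDimensional.complete ℝ E
  have sub_diffAt : DiffAt (fun y ↦ D (coordField v) y (coordField u y) -
      D (coordField u) y (coordField v y)) x :=
    mdifferentiableAt_sub_section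
      (diffAt_covariantDerivative hD (eventually_smoothAt_coordField v)
        (smoothAt_coordField u).diffAt)
      (diffAt_covariantDerivative hD (eventually_smoothAt_coordField u)
        (smoothAt_coordField v).diffAt)
  refine sub_diffAt.congr ?_
  filter_upwards [eventually_smoothAt_coordField u, eventually_smoothAt_coordField v,
    eventually_mlieBracket_coordField u v] with y hu hv huv
  rw [D.torsion_apply hu.diffAt hv.diffAt, huv, sub_zero]

theorem diffAt_torsion (hD : D.ContMDiffCovariantDerivative ∞) {x : M}
    {Y Z : (y : M) → TangentSpace 𝓘(ℝ, E) y} (hY : DiffAt Y x) (hZ : DiffAt Z x) :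
    DiffAt (fun y ↦ D.torsion y (Y y) (Z y)) x := by
  let b := Module.finBasis ℝ E
  set t := trivializationAt E (TangentSpace 𝓘(ℝ, E)) x
  have hx : x ∈ t.baseSet := mem_baseSet_trivializationAt E (TangentSpace 𝓘(ℝ, E)) x
  have sum_diffAt : DiffAt (fun y ↦ ∑ i, ∑ j, (t.localFrameCoeff 𝓘(ℝ, E) b i y (Y y) *
      t.localFrameCoeff 𝓘(ℝ, E) b j y (Z y)) •
        D.torsion y (coordField (t.localFrame b i x) y) (coordField (t.localFrame b j x) y)) x :=
    .sum_section fun i _ ↦ .sum_section fun j _ ↦ .smul_section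
      ((mdifferentiableAt_localFrameCoeff b hx hY i).mul
        (mdifferentiableAt_localFrameCoeff b hx hZ j)) (diffAt_torsion_coordField hD _ _)
  refine sum_diffAt.congr ?_
  filter_upwards [eventually_eq_sum_coordField b x Y, eventually_eq_sum_coordField b x Z]
    with y hy hz
  conv_rhs => rw [hy, hz]
  simp only [map_sum, map_smul, FunLike.coe_sum, Finset.sum_apply, FunLike.coe_smul,
    Pi.smul_apply, smul_smul, Finset.smul_sum]
  rw [Finset.sum_comm]
  exact Finset.sum_congr rfl fun i _ ↦ Finset.sum_congr rfl fun j _ ↦ by rw [mul_comm]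

end Smoothness

section AdaptedBasis

variable {V : Type*} [NormedAddCommGroup V] [InnerProductSpace ℝ V]

/-- A 4-form as a curried 4-linear map, which makes its linearity in each slot available to the
simplifier. -/
def curry₄ (Φ : V [⋀^Fin 4]→ₗ[ℝ] ℝ) : V →ₗ[ℝ] V →ₗ[ℝ] V →ₗ[ℝ] V →ₗ[ℝ] ℝ :=
  let curry₁ : V [⋀^Fin 1]→ₗ[ℝ] ℝ →ₗ[ℝ] V →ₗ[ℝ] ℝ :=
    LinearMap.compRight ℝ AlternatingMap.constLinearEquivOfIsEmpty.symm.toLinearMap ∘ₗ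
      AlternatingMap.curryLeftLinearMap
  (AlternatingMap.curryLeftLinearMap ∘ₗ Φ.curryLeft).compr₂
    (LinearMap.compRight ℝ curry₁ ∘ₗ AlternatingMap.curryLeftLinearMap)

theorem curry₄_apply (Φ : V [⋀^Fin 4]→ₗ[ℝ] ℝ) (x y z t : V) :
    curry₄ Φ x y z t = Φ ![x, y, z, t] :=
  congrArg Φ (List.ofFn_inj.1 rfl)

theorem alternatingMap_rotate (Φ : V [⋀^Fin 4]→ₗ[ℝ] ℝ) (x y z t : V) :
    Φ ![y, z, t, x] = -Φ ![x, y, z, t] := by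
  rw [alternatingMap_swap₂₃, alternatingMap_swap₁₂, alternatingMap_swap₀₁, neg_neg]

theorem IsAdapted.isSpinArray {Φ : V [⋀^Fin 4]→ₗ[ℝ] ℝ} {Ω : V [⋀^Fin 8]→ₗ[ℝ] ℝ}
    {e : OrthonormalBasis (Fin 8) ℝ V} (h : IsAdapted Φ Ω e) (b : OrthonormalBasis (Fin 8) ℝ V) :
    IsSpinArray fun i j k l ↦ Φ ![b i, b j, b k, b l] where
  swap₁ _ _ _ _ := alternatingMap_swap₀₁ Φ _ _ _ _
  swap₂ _ _ _ _ := alternatingMap_swap₁₂ Φ _ _ _ _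
  swap₃ _ _ _ _ := alternatingMap_swap₂₃ Φ _ _ _ _
  contract i j k a b' c := by
    have contract_e := contractionDefect_apply e Φ (b i) (b j) (b k) (b a) (b b') (b c)
    have basis_change : ∑ p, Φ ![e p, b i, b j, b k] * Φ ![e p, b a, b b', b c] =
        ∑ p, Φ ![b i, b j, b k, b p] * Φ ![b a, b b', b c, b p] := by
      simpa only [curry₄_apply, smul_eq_mul, alternatingMap_rotate Φ (e _), neg_mul_neg] using
        sum_smul_orthonormalBasis e b (curry₄ Φ (b i) (b j) (b k)) (curry₄ Φ (b a) (b b') (b c))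
    rw [h.contractionDefect_eq_zero, basis_change,
      AlternatingMap.zero_apply] at contract_e
    simp only [kd, alternatingMap_swap₀₁ Φ (b i) (b k), alternatingMap_swap₂₃ Φ _ _ (b a) (b c)]
    simp only [OrthonormalBasis.inner_eq_ite, alternatingMap_swap_pairs Φ _ _ (b a) (b b'),
      alternatingMap_swap_pairs Φ _ _ (b a) (b c), alternatingMap_swap_pairs Φ _ _ (b b') (b c)]
      at contract_e ⊢
    linarith

end AdaptedBasis

theorem multilinearMap_eq_sum_orthonormalBasis {ι κ V : Type*}
    [Fintype ι] [Fintype κ] [DecidableEq κ] [NormedAddCommGroup V] [InnerProductSpace ℝ V]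
    (b : OrthonormalBasis ι ℝ V) (f : MultilinearMap ℝ (fun _ : κ ↦ V) ℝ) (v : κ → V) :
    f v = ∑ i : κ → ι, (∏ a, inner ℝ (b (i a)) (v a)) * f (b ∘ i) := by
  have v_eq : v = fun a ↦ ∑ j, inner ℝ (b j) (v a) • b j :=
    funext fun a ↦ (b.sum_repr' (v a)).symm
  conv_lhs => rw [v_eq]
  exact (f.map_sum fun a j ↦ inner ℝ (b j) (v a) • b j).trans
    (Finset.sum_congr rfl fun i _ ↦ f.map_smul_univ _ _)

section AdaptedFrame

open Filter Topology

variable {M : Type*} [TopologicalSpace M] [ChartedSpace E8 M] [IsManifold I8 ∞ M]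
  [RiemannianBundle (fun x : M ↦ TangentSpace I8 x)]

theorem Structure.exists_adapted_frame (S : Structure M) (x : M) :
    ∃ e : Fin 8 → (y : M) → TangentSpace I8 y, (∀ i, SmoothAt (e i) x) ∧
      ∀ᶠ y in 𝓝 x, ∃ b : OrthonormalBasis (Fin 8) ℝ (TM y),
        IsAdapted (S.Phi y).toAlternatingMap (S.vol y).toAlternatingMap b ∧ ∀ i, b i = e i y := by
  obtain ⟨U, hU, hx, e, he, h⟩ := S.exists_frame x
  refine ⟨e, fun i ↦ (he i).contMDiffAt (hU.mem_nhds hx), ?_⟩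
  filter_upwards [hU.mem_nhds hx] with y hy
  obtain ⟨orthonormal, vol_eq, phi_eq⟩ := h y hy
  have card_eq : Fintype.card (Fin 8) = Module.finrank ℝ (TM y) := by
    rw [finrank_TM, Fintype.card_fin]
  have span_eq : ⊤ ≤ Submodule.span ℝ (Set.range fun i ↦ e i y) :=
    (orthonormal.linearIndependent.span_eq_top_of_card_eq_finrank' card_eq).ge
  refine ⟨OrthonormalBasis.mk orthonormal span_eq, ⟨?_, ?_⟩,
    fun i ↦ by rw [OrthonormalBasis.coe_mk]⟩
  · rw [OrthonormalBasis.coe_mk]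
    exact vol_eq
  · rw [OrthonormalBasis.coe_mk]
    exact phi_eq

theorem Structure.exists_isAdapted (S : Structure M) (x : M) :
    ∃ b : OrthonormalBasis (Fin 8) ℝ (TM x),
      IsAdapted (S.Phi x).toAlternatingMap (S.vol x).toAlternatingMap b := by
  obtain ⟨e, -, he⟩ := S.exists_adapted_frame x
  obtain ⟨b, hb, -⟩ := he.self_of_nhds
  exact ⟨b, hb⟩

/-- The components of `Φ` in the orthonormal basis `onb x`. -/
def Structure.phiArray (S : Structure M) (x : M) (i j k l : Fin 8) : ℝ :=
  S.Phi x ![onb x i, onb x j, onb x k, onb x l]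

theorem Structure.isSpinArray_phiArray (S : Structure M) (x : M) : IsSpinArray (S.phiArray x) := by
  obtain ⟨e, he⟩ := S.exists_isAdapted x
  exact he.isSpinArray (onb x)

theorem Structure.exists_frame_phi_eq_sum (S : Structure M) (x : M) :
    ∃ e : Fin 8 → (y : M) → TangentSpace I8 y, (∀ i, SmoothAt (e i) x) ∧
      ∀ Y : Fin 4 → (y : M) → TangentSpace I8 y,
        (fun y ↦ S.phi y fun a ↦ Y a y) =ᶠ[𝓝 x] fun y ↦
          ∑ i : Fin 4 → Fin 8, (∏ a, inner ℝ (e (i a) y) (Y a y)) * (stdPhi i : ℝ) := by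
  obtain ⟨e, smooth, adapted⟩ := S.exists_adapted_frame x
  refine ⟨e, smooth, fun Y ↦ ?_⟩
  filter_upwards [adapted] with y ⟨b, hb, hbe⟩
  simp only [← hbe, ← hb.phi]
  exact multilinearMap_eq_sum_orthonormalBasis b (S.Phi y).toMultilinearMap _

variable [IsContMDiffRiemannianBundle I8 ∞ E8 (fun x : M ↦ TangentSpace I8 x)]

theorem SmoothAt.inner {Y Z : (y : M) → TangentSpace I8 y} {x : M} (hY : SmoothAt Y x)
    (hZ : SmoothAt Z x) : ContMDiffAt I8 𝓘(ℝ, ℝ) ∞ (fun y ↦ inner ℝ (Y y) (Z y)) x :=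
  ContMDiffAt.inner_bundle (F := E8) hY hZ

theorem DiffAt.inner {Y Z : (y : M) → TangentSpace I8 y} {x : M} (hY : DiffAt Y x)
    (hZ : DiffAt Z x) : MDifferentiableAt I8 𝓘(ℝ, ℝ) (fun y ↦ inner ℝ (Y y) (Z y)) x :=
  MDifferentiableAt.inner_bundle (F := E8) hY hZ

theorem Structure.contMDiffAt_phi (S : Structure M) {x : M}
    {Y : Fin 4 → (y : M) → TangentSpace I8 y} (hY : ∀ a, SmoothAt (Y a) x) :
    ContMDiffAt I8 𝓘(ℝ, ℝ) ∞ (fun y ↦ S.phi y fun a ↦ Y a y) x := by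
  obtain ⟨e, he, phi_eq⟩ := S.exists_frame_phi_eq_sum x
  refine ContMDiffAt.congr_of_eventuallyEq ?_ (phi_eq Y)
  exact ContMDiffAt.sum fun i _ ↦
    (contMDiffAt_finsetProd fun a _ ↦ (he (i a)).inner (hY a)).mul contMDiffAt_const

theorem Structure.mdifferentiableAt_phi (S : Structure M) {x : M}
    {Y : Fin 4 → (y : M) → TangentSpace I8 y} (hY : ∀ a, DiffAt (Y a) x) :
    MDifferentiableAt I8 𝓘(ℝ, ℝ) (fun y ↦ S.phi y fun a ↦ Y a y) x := by
  obtain ⟨e, he, phi_eq⟩ := S.exists_frame_phi_eq_sum x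
  refine MDifferentiableAt.congr_of_eventuallyEq ?_ (phi_eq Y)
  exact mdifferentiableAt_fun_sum fun i ↦
    (mdifferentiableAt_fun_prod fun a ↦ (he (i a)).diffAt.inner (hY a)).mul mdifferentiableAt_const

end AdaptedFrame

section TorsionDerivative

open Filter Topology

variable {M : Type*} [TopologicalSpace M] [ChartedSpace E8 M] [IsManifold I8 ∞ M]
  [RiemannianBundle (fun x : M ↦ TangentSpace I8 x)]

/-- The torsion `T(u, v, w) = g(T(u, v), w)` at a point, as a trilinear map; see `torsionForm`. -/
def tor (D : Connection M) (x : M) : TM x →ₗ[ℝ] TM x →ₗ[ℝ] TM x →ₗ[ℝ] ℝ :=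
  (ContinuousLinearMap.toLinearMap₁₂ (D.torsion x)).compr₂ (innerₗ (TM x))

theorem tor_apply (D : Connection M) (x : M) (u v w : TM x) :
    tor D x u v w = inner ℝ (D.torsion x u v) w := rfl

theorem tor_swap₁ (D : Connection M) (x : M) (u v w : TM x) :
    tor D x v u w = -tor D x u v w := by
  rw [tor_apply, D.torsion_antisymm, inner_neg_left, tor_apply]

/-- The derivative `(∇_u T)(Y₁, Y₂, Y₃)` in terms of vector fields. It is tensorial in each of them,
which is how `nablaTorsion` is seen to be a tensor. -/
def nablaTorsionAux (D : Connection M) (Y₁ Y₂ Y₃ : (y : M) → TangentSpace I8 y) (x : M)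
    (u : TM x) : ℝ :=
  mvfderiv I8 (fun y ↦ tor D y (Y₁ y) (Y₂ y) (Y₃ y)) x u - tor D x (D Y₁ x u) (Y₂ x) (Y₃ x)
    - tor D x (Y₁ x) (D Y₂ x u) (Y₃ x) - tor D x (Y₁ x) (Y₂ x) (D Y₃ x u)

/-- The covariant derivative `(∇_u T)(v₁, v₂, v₃)` of the torsion, computed with extensions of the
three vectors. -/
def nablaTorsion (D : Connection M) (x : M) (u v₁ v₂ v₃ : TM x) : ℝ :=
  nablaTorsionAux D (extV v₁) (extV v₂) (extV v₃) x u

theorem nablaTorsionAux_swap₁ (D : Connection M) (Y₁ Y₂ Y₃ : (y : M) → TangentSpace I8 y) (x : M)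
    (u : TM x) : nablaTorsionAux D Y₂ Y₁ Y₃ x u = -nablaTorsionAux D Y₁ Y₂ Y₃ x u := by
  have tor_swap : (fun y ↦ tor D y (Y₂ y) (Y₁ y) (Y₃ y)) =
      -fun y ↦ tor D y (Y₁ y) (Y₂ y) (Y₃ y) :=
    funext fun y ↦ tor_swap₁ D y _ _ _
  simp only [nablaTorsionAux, tor_swap, mvfderiv_neg, neg_apply, tor_swap₁ D x (Y₁ x) (D Y₂ x u),
    tor_swap₁ D x (D Y₁ x u) (Y₂ x), tor_swap₁ D x (Y₁ x) (Y₂ x)]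
  ring

theorem nablaTorsion_swap₁ (D : Connection M) (x : M) (u v₁ v₂ v₃ : TM x) :
    nablaTorsion D x u v₂ v₁ v₃ = -nablaTorsion D x u v₁ v₂ v₃ :=
  nablaTorsionAux_swap₁ D _ _ _ x u

theorem isLinearMap_nablaTorsion (D : Connection M) (x : M) (v₁ v₂ v₃ : TM x) :
    IsLinearMap ℝ fun u ↦ nablaTorsion D x u v₁ v₂ v₃ where
  map_add u u' := by
    simp only [nablaTorsion, nablaTorsionAux, map_add, LinearMap.add_apply]
    ring
  map_smul c u := by
    simp only [nablaTorsion, nablaTorsionAux, map_smul, LinearMap.smul_apply, smul_eq_mul]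
    ring

variable [IsContMDiffRiemannianBundle I8 ∞ E8 (fun x : M ↦ TangentSpace I8 x)]
  {S : Structure M} {D : Connection M}

section Smooth

variable [T2Space M] (smooth : D.ContMDiffCovariantDerivative ∞) {x : M}
include smooth

theorem mdifferentiableAt_tor {Y₁ Y₂ Y₃ : (y : M) → TangentSpace I8 y} (h₁ : DiffAt Y₁ x)
    (h₂ : DiffAt Y₂ x) (h₃ : DiffAt Y₃ x) :
    MDifferentiableAt I8 𝓘(ℝ, ℝ) (fun y ↦ tor D y (Y₁ y) (Y₂ y) (Y₃ y)) x :=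
  (diffAt_torsion smooth h₁ h₂).inner h₃

theorem tensorialAt_nablaTorsionAux {Y₂ Y₃ : (y : M) → TangentSpace I8 y} (h₂ : DiffAt Y₂ x)
    (h₃ : DiffAt Y₃ x) (u : TM x) :
    TensorialAt I8 E8 (fun Y : (y : M) → TangentSpace I8 y ↦ nablaTorsionAux D Y Y₂ Y₃ x u) x where
  smul {f Y} hf hY := by
    have tor_smul : (fun y ↦ tor D y ((f • Y) y) (Y₂ y) (Y₃ y)) =
        f * fun y ↦ tor D y (Y y) (Y₂ y) (Y₃ y) := by
      funext y
      simp only [Pi.smul_apply', map_smul, LinearMap.smul_apply, smul_eq_mul, Pi.mul_apply]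
    have leibniz : D (f • Y) x u = f x • D Y x u + mvfderiv I8 f x u • Y x := by
      rw [D.isCovariantDerivativeOn.leibniz (s := Set.univ) hY hf]
      rfl
    have smul_at : (f • Y) x = f x • Y x := rfl
    simp only [nablaTorsionAux, tor_smul, leibniz, smul_at,
      mvfderiv_mul hf (mdifferentiableAt_tor smooth hY h₂ h₃), map_add, map_smul,
      LinearMap.add_apply, LinearMap.smul_apply, add_apply, smul_apply, smul_eq_mul]
    ring
  add {Y Y'} hY hY' := by
    have tor_add : (fun y ↦ tor D y ((Y + Y') y) (Y₂ y) (Y₃ y)) =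
        (fun y ↦ tor D y (Y y) (Y₂ y) (Y₃ y)) + fun y ↦ tor D y (Y' y) (Y₂ y) (Y₃ y) := by
      funext y
      simp only [Pi.add_apply, map_add, LinearMap.add_apply]
    have nabla_add : D (Y + Y') x u = D Y x u + D Y' x u := by
      rw [D.isCovariantDerivativeOn.add (s := Set.univ) hY hY']
      rfl
    have add_at : (Y + Y') x = Y x + Y' x := rfl
    simp only [nablaTorsionAux, tor_add, nabla_add, add_at,
      mvfderiv_add (mdifferentiableAt_tor smooth hY h₂ h₃)
        (mdifferentiableAt_tor smooth hY' h₂ h₃), map_add, LinearMap.add_apply, add_apply]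
    ring

theorem isBilinearMap_nablaTorsion₁₂ (u v₃ : TM x) :
    IsBilinearMap ℝ fun v₁ v₂ ↦ nablaTorsion D x u v₁ v₂ v₃ := by
  have linear (v₂ : TM x) : IsLinearMap ℝ fun v₁ ↦ nablaTorsion D x u v₁ v₂ v₃ := by
    have tensorial := tensorialAt_nablaTorsionAux smooth (smoothAt_coordField v₂).diffAt
      (smoothAt_coordField v₃).diffAt u
    have hom_eq : (fun v₁ ↦ nablaTorsion D x u v₁ v₂ v₃) = TensorialAt.mkHom _ x tensorial :=
      funext fun v₁ ↦ (tensorial.mkHom_apply_eq_extend v₁).symm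
    rw [hom_eq]
    exact ⟨map_add _, map_smul _⟩
  exact {
    add_left := fun v₁ v₁' v₂ ↦ (linear v₂).map_add v₁ v₁'
    smul_left := fun c v₁ v₂ ↦ (linear v₂).map_smul c v₁
    add_right := fun v₁ v₂ v₂' ↦ by
      simp only [nablaTorsion_swap₁ D x u _ v₁, (linear v₁).map_add, neg_add]
    smul_right := fun c v₁ v₂ ↦ by
      simp only [nablaTorsion_swap₁ D x u _ v₁, (linear v₁).map_smul, smul_neg] }

end Smooth

namespace Structure.IsTorsionConnection

theorem tor_swap₂ (hD : S.IsTorsionConnection D) (x : M) (u v w : TM x) :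
    tor D x u w v = -tor D x u v w :=
  hD.skew x u w v

theorem nablaTorsionAux_swap₂ (hD : S.IsTorsionConnection D)
    (Y₁ Y₂ Y₃ : (y : M) → TangentSpace I8 y) (x : M) (u : TM x) :
    nablaTorsionAux D Y₁ Y₃ Y₂ x u = -nablaTorsionAux D Y₁ Y₂ Y₃ x u := by
  have tor_swap : (fun y ↦ tor D y (Y₁ y) (Y₃ y) (Y₂ y)) =
      -fun y ↦ tor D y (Y₁ y) (Y₂ y) (Y₃ y) :=
    funext fun y ↦ hD.tor_swap₂ y _ _ _
  simp only [nablaTorsionAux, tor_swap, mvfderiv_neg, neg_apply, hD.tor_swap₂ x _ (Y₂ x) (Y₃ x),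
    hD.tor_swap₂ x _ (Y₂ x) (D Y₃ x u), hD.tor_swap₂ x _ (D Y₂ x u) (Y₃ x)]
  ring

theorem nablaTorsion_swap₂ (hD : S.IsTorsionConnection D) (x : M) (u v₁ v₂ v₃ : TM x) :
    nablaTorsion D x u v₁ v₃ v₂ = -nablaTorsion D x u v₁ v₂ v₃ :=
  hD.nablaTorsionAux_swap₂ _ _ _ x u

variable [T2Space M]

theorem isBilinearMap_nablaTorsion₂₃ (hD : S.IsTorsionConnection D) (x : M) (u v₁ : TM x) :
    IsBilinearMap ℝ fun v₂ v₃ ↦ nablaTorsion D x u v₁ v₂ v₃ := by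
  have rotate (v₂ v₃ : TM x) : nablaTorsion D x u v₁ v₂ v₃ = nablaTorsion D x u v₂ v₃ v₁ := by
    rw [hD.nablaTorsion_swap₂ x u v₂ v₁, nablaTorsion_swap₁ D x u v₁, neg_neg]
  simpa only [rotate] using isBilinearMap_nablaTorsion₁₂ hD.smooth u v₁

theorem nablaTorsionAux_eq (hD : S.IsTorsionConnection D) {x : M}
    {Y₁ Y₂ Y₃ : (y : M) → TangentSpace I8 y} (h₁ : DiffAt Y₁ x) (h₂ : DiffAt Y₂ x)
    (h₃ : DiffAt Y₃ x) (u : TM x) :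
    nablaTorsionAux D Y₁ Y₂ Y₃ x u = nablaTorsion D x u (Y₁ x) (Y₂ x) (Y₃ x) := by
  have e₁ : DiffAt (extV (Y₁ x)) x := (smoothAt_coordField (Y₁ x)).diffAt
  have e₂ : DiffAt (extV (Y₂ x)) x := (smoothAt_coordField (Y₂ x)).diffAt
  have e₃ : DiffAt (extV (Y₃ x)) x := (smoothAt_coordField (Y₃ x)).diffAt
  have slot₁ := (tensorialAt_nablaTorsionAux hD.smooth h₂ h₃ u).pointwise h₁ e₁
    (FiberBundle.extend_apply_self E8 _).symm
  have slot₂ := (tensorialAt_nablaTorsionAux hD.smooth e₁ h₃ u).pointwise h₂ e₂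
    (FiberBundle.extend_apply_self E8 _).symm
  have slot₃ := (tensorialAt_nablaTorsionAux hD.smooth e₁ e₂ u).pointwise h₃ e₃
    (FiberBundle.extend_apply_self E8 _).symm
  rw [nablaTorsionAux_swap₁, nablaTorsionAux_swap₁ D (extV (Y₁ x)) (extV (Y₂ x))] at slot₂
  rw [nablaTorsionAux_swap₁, hD.nablaTorsionAux_swap₂, nablaTorsionAux_swap₁ D (extV (Y₁ x)),
    hD.nablaTorsionAux_swap₂ (extV (Y₁ x)) (extV (Y₂ x))] at slot₃
  rw [nablaTorsion]
  linarith

end Structure.IsTorsionConnection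

end TorsionDerivative

section CurvatureIdentities

open Filter Topology

variable {M : Type*} [TopologicalSpace M] [ChartedSpace E8 M] [IsManifold I8 ∞ M]

theorem coordField_self {x : M} (v : TM x) : extV v x = v := FiberBundle.extend_apply_self E8 v

theorem diffAt_coordField {x : M} (v : TM x) : DiffAt (extV v) x := (smoothAt_coordField v).diffAt

theorem eventually_diffAt_coordField {x : M} (v : TM x) : ∀ᶠ y in 𝓝 x, DiffAt (extV v) y :=
  (eventually_smoothAt_coordField v).mono fun _ h ↦ h.diffAt

/-- The vector field `∇_V W` for the coordinate extensions `V`, `W` of two tangent vectors. -/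
def nablaExt (D : Connection M) {x : M} (v w : TM x) (y : M) : TangentSpace I8 y :=
  D (extV w) y (extV v y)

theorem nablaExt_self (D : Connection M) {x : M} (v w : TM x) :
    nablaExt D v w x = D (extV w) x v := by
  rw [nablaExt, coordField_self]

theorem curvature_eq (D : Connection M) {x : M} (u v w : TM x) :
    curvature D x u v w = D (nablaExt D v w) x u - D (nablaExt D u w) x v := by
  rw [curvature, curvatureFields, mlieBracket_coordField, map_zero, sub_zero, coordField_self,
    coordField_self]
  rfl

theorem curvature_swap (D : Connection M) {x : M} (u v w : TM x) :
    curvature D x v u w = -curvature D x u v w := by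
  rw [curvature_eq, curvature_eq, neg_sub]

theorem torsion_eq (D : Connection M) {x : M} (u v : TM x) :
    D.torsion x u v = D (extV v) x u - D (extV u) x v := by
  rw [D.torsion_apply_eq_extend, mlieBracket_coordField, sub_zero]
  simp only [FiberBundle.extend_apply_self]

theorem eventually_torsion_eq (D : Connection M) {x : M} (v w : TM x) :
    ∀ᶠ y in 𝓝 x, D.torsion y (extV v y) (extV w y) = nablaExt D v w y - nablaExt D w v y := by
  filter_upwards [eventually_diffAt_coordField v, eventually_diffAt_coordField w,
    eventually_mlieBracket_coordField v w] with y hv hw bracket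
  rw [D.torsion_apply hv hw, bracket, sub_zero]
  rfl

theorem diffAt_nablaExt [T2Space M] {D : Connection M} (smooth : D.ContMDiffCovariantDerivative ∞)
    {x : M} (v w : TM x) : DiffAt (nablaExt D v w) x :=
  diffAt_covariantDerivative smooth (eventually_smoothAt_coordField w) (diffAt_coordField v)

variable [RiemannianBundle (fun x : M ↦ TangentSpace I8 x)]
  [IsContMDiffRiemannianBundle I8 ∞ E8 (fun x : M ↦ TangentSpace I8 x)]
  {S : Structure M} {D : Connection M}

namespace Structure.IsTorsionConnection

theorem mvfderiv_inner (hD : S.IsTorsionConnection D) {x : M}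
    {Y Z : (y : M) → TangentSpace I8 y} (hY : DiffAt Y x) (hZ : DiffAt Z x) (u : TM x) :
    mvfderiv I8 (fun y ↦ inner ℝ (Y y) (Z y)) x u =
      inner ℝ (D Y x u) (Z x) + inner ℝ (Y x) (D Z x u) := by
  simpa only [coordField_self] using hD.metric.mvfderiv_inner_eq (extV u) hY hZ

variable [T2Space M]

theorem inner_nabla_torsion (hD : S.IsTorsionConnection D) {x : M} (u v w z : TM x) :
    inner ℝ (D (nablaExt D v w) x u - D (nablaExt D w v) x u) z =
      nablaTorsion D x u v w z + tor D x (D (extV v) x u) w z + tor D x v (D (extV w) x u) z := by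
  set T : (y : M) → TangentSpace I8 y := fun y ↦ D.torsion y (extV v y) (extV w y)
  have diff_vw := diffAt_nablaExt hD.smooth v w
  have diff_wv := diffAt_nablaExt hD.smooth w v
  have diff_T : DiffAt T x := diffAt_torsion hD.smooth (diffAt_coordField v) (diffAt_coordField w)
  have nabla_eq : D (nablaExt D v w) x = D (nablaExt D w v) x + D T x := by
    rw [← D.isCovariantDerivativeOn.add (s := Set.univ) diff_wv diff_T]
    refine D.isCovariantDerivativeOn.congr_of_eventuallyEq (s := Set.univ) diff_vw
      (mdifferentiableAt_add_section diff_wv diff_T) Filter.univ_mem ?_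
    filter_upwards [eventually_torsion_eq D v w] with y hy
    rw [Pi.add_apply, show T y = _ from hy]
    abel
  have nabla_T : inner ℝ (D T x u) z =
      mvfderiv I8 (fun y ↦ tor D y (extV v y) (extV w y) (extV z y)) x u -
        tor D x v w (D (extV z) x u) := by
    have product_rule := hD.mvfderiv_inner diff_T (diffAt_coordField z) u
    simp only [T, coordField_self, ← tor_apply] at product_rule
    exact eq_sub_of_add_eq product_rule.symm
  rw [nabla_eq, add_apply, add_sub_cancel_left, nabla_T, nablaTorsion, nablaTorsionAux]
  simp only [coordField_self]
  ring

theorem bianchi (hD : S.IsTorsionConnection D) {x : M} (u v w z : TM x) :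
    inner ℝ (curvature D x u v w) z + inner ℝ (curvature D x v w u) z +
        inner ℝ (curvature D x w u v) z =
      nablaTorsion D x u v w z + nablaTorsion D x v w u z + nablaTorsion D x w u v z +
        (tor D x (D.torsion x u v) w z + tor D x (D.torsion x v w) u z +
          tor D x (D.torsion x w u) v z) := by
  have h_u := hD.inner_nabla_torsion u v w z
  have h_v := hD.inner_nabla_torsion v w u z
  have h_w := hD.inner_nabla_torsion w u v z
  rw [tor_swap₁ D x _ v] at h_u
  rw [tor_swap₁ D x _ w] at h_v
  rw [tor_swap₁ D x _ u] at h_w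
  simp only [curvature_eq, torsion_eq, map_sub, LinearMap.sub_apply, inner_sub_left]
    at h_u h_v h_w ⊢
  linarith

theorem mvfderiv_mvfderiv_inner (hD : S.IsTorsionConnection D) {x : M} (u v w z : TM x) :
    mvfderiv I8 (fun y ↦ mvfderiv I8 (fun y ↦ inner ℝ (extV w y) (extV z y)) y (extV v y)) x u =
      inner ℝ (D (nablaExt D v w) x u) z + inner ℝ (D (extV w) x v) (D (extV z) x u) +
        (inner ℝ (D (extV w) x u) (D (extV z) x v) + inner ℝ w (D (nablaExt D v z) x u)) := by
  have diff_vw := diffAt_nablaExt hD.smooth v w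
  have diff_vz := diffAt_nablaExt hD.smooth v z
  have first_derivative :
      (fun y ↦ mvfderiv I8 (fun y ↦ inner ℝ (extV w y) (extV z y)) y (extV v y)) =ᶠ[𝓝 x]
        (fun y ↦ inner ℝ (nablaExt D v w y) (extV z y)) +
          fun y ↦ inner ℝ (extV w y) (nablaExt D v z y) := by
    filter_upwards [eventually_diffAt_coordField w, eventually_diffAt_coordField z] with y hw hz
    exact hD.mvfderiv_inner hw hz (extV v y)
  rw [mvfderiv_congr first_derivative, mvfderiv_add (diff_vw.inner (diffAt_coordField z))
    ((diffAt_coordField w).inner diff_vz), add_apply, hD.mvfderiv_inner diff_vw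
    (diffAt_coordField z), hD.mvfderiv_inner (diffAt_coordField w) diff_vz]
  simp only [coordField_self, nablaExt_self]

theorem curvature_skew (hD : S.IsTorsionConnection D) {x : M} (u v w z : TM x) :
    inner ℝ (curvature D x u v z) w = -inner ℝ (curvature D x u v w) z := by
  have symmetric := mvfderiv_mvfderiv_coordField_comm
    ((smoothAt_coordField w).inner (smoothAt_coordField z)) u v
  rw [hD.mvfderiv_mvfderiv_inner, hD.mvfderiv_mvfderiv_inner] at symmetric
  rw [curvature_eq, curvature_eq, inner_sub_left, inner_sub_left, real_inner_comm w,
    real_inner_comm w]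
  linarith

theorem mvfderiv_mvfderiv_phi (hD : S.IsTorsionConnection D) {x : M} (u v : TM x)
    (w : Fin 4 → TM x) :
    mvfderiv I8 (fun y ↦ mvfderiv I8 (fun y ↦ S.phi y fun j ↦ extV (w j) y) y (extV v y)) x u =
      ∑ i, ∑ k, S.Phi x (Function.update (Function.update w i (D (extV (w i)) x v)) k
        (D (Function.update (fun j ↦ extV (w j)) i (nablaExt D v (w i)) k) x u)) := by
  set W : Fin 4 → (y : M) → TangentSpace I8 y := fun i ↦ extV (w i)
  have W_self : (fun j ↦ W j x) = w := funext fun j ↦ coordField_self _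
  have update_apply (i : Fin 4) (A : (y : M) → TangentSpace I8 y) (y : M) :
      (fun j ↦ Function.update W i A j y) = Function.update (fun j ↦ W j y) i (A y) :=
    funext fun j ↦ Function.apply_update (fun _ (Y : (y : M) → TangentSpace I8 y) ↦ Y y) W i A j
  have diff_update (i k : Fin 4) : DiffAt (Function.update W i (nablaExt D v (w i)) k) x := by
    rcases eq_or_ne k i with rfl | hki
    · rw [Function.update_self]
      exact diffAt_nablaExt hD.smooth v (w k)
    · rw [Function.update_of_ne hki]
      exact diffAt_coordField (w k)
  have first_derivative : (fun y ↦ mvfderiv I8 (fun y ↦ S.phi y fun j ↦ W j y) y (extV v y)) =ᶠ[𝓝 x]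
      fun y ↦ ∑ i, S.phi y fun j ↦ Function.update W i (nablaExt D v (w i)) j y := by
    filter_upwards [Filter.eventually_all.2 fun i ↦ eventually_diffAt_coordField (w i)] with y hy
    rw [hD.parallel y W hy]
    simp only [update_apply]
    rfl
  rw [mvfderiv_congr first_derivative,
    mvfderiv_fun_sum fun i ↦ S.mdifferentiableAt_phi (diff_update i)]
  refine Finset.sum_congr rfl fun i _ ↦ ?_
  rw [hD.parallel x _ (diff_update i), update_apply, W_self, nablaExt_self]
  rfl

theorem curvature_stabilizes (hD : S.IsTorsionConnection D) {x : M} (u v : TM x)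
    (w : Fin 4 → TM x) :
    ∑ i, S.Phi x (Function.update w i (curvature D x u v (w i))) = 0 := by
  have symmetric := mvfderiv_mvfderiv_coordField_comm
    (S.contMDiffAt_phi fun i ↦ smoothAt_coordField (w i)) u v
  rw [hD.mvfderiv_mvfderiv_phi, hD.mvfderiv_mvfderiv_phi, ← sub_eq_zero] at symmetric
  rw [← symmetric]
  conv_rhs =>
    enter [2]
    rw [Finset.sum_comm]
  rw [← Finset.sum_sub_distrib]
  refine Finset.sum_congr rfl fun i _ ↦ ?_
  rw [← Finset.sum_sub_distrib, Finset.sum_eq_single i]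
  · simp only [Function.update_self, Function.update_idem, curvature_eq]
    exact (S.Phi x).map_update_sub w i _ _
  · intro k _ hki
    rw [Function.update_of_ne hki, Function.update_of_ne hki.symm, Function.update_comm hki,
      sub_self]
  · exact fun hi ↦ absurd (Finset.mem_univ i) hi

end Structure.IsTorsionConnection

end CurvatureIdentities

section CodifferentialAlgebra

variable {ι V : Type*} [Fintype ι] [NormedAddCommGroup V] [InnerProductSpace ℝ V] {k m n : ℕ}

theorem append_insertNth_comp_cast {α : Type*} (h : k + m = n) (h' : k + 1 + m = n + 1)
    (c : Fin (k + 1)) (p : α) (u : Fin k → α) (v : Fin m → α) :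
    Fin.append (c.insertNth (α := fun _ ↦ α) p u) v ∘ Fin.cast h'.symm =
      (Fin.cast h' (Fin.castAdd m c)).insertNth (α := fun _ ↦ α) p
        (Fin.append u v ∘ Fin.cast h.symm) := by
  refine (Fin.insertNth_eq_iff.2 ⟨by simp, ?_⟩).symm
  rw [removeNth_append_castAdd h h', Fin.removeNth_insertNth]

theorem append_vecCons_comp_cast {α : Type*} (h : k + m = n) (h' : k + (m + 1) = n + 1)
    (p : α) (u : Fin k → α) (v : Fin m → α) :
    Fin.append u (Matrix.vecCons p v) ∘ Fin.cast h'.symm =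
      (Fin.cast h' (Fin.natAdd k 0)).insertNth (α := fun _ ↦ α) p
        (Fin.append u v ∘ Fin.cast h.symm) := by
  refine (Fin.insertNth_eq_iff.2 ⟨by simp, ?_⟩).symm
  rw [removeNth_append_natAdd h h']
  rfl

theorem alternatingMap_append_insertNth (h : k + 1 + m = n) (h' : k + (m + 1) = n)
    (Ω : V [⋀^Fin n]→ₗ[ℝ] ℝ) (c : Fin (k + 1)) (p : V) (u : Fin k → V) (v : Fin m → V) :
    Ω (Fin.append (c.insertNth (α := fun _ ↦ V) p u) v ∘ Fin.cast h.symm) =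
      (-1) ^ (c + k : ℕ) * Ω (Fin.append u (Matrix.vecCons p v) ∘ Fin.cast h'.symm) := by
  obtain ⟨n, rfl⟩ : ∃ n', n = n' + 1 := ⟨k + m, by omega⟩
  have hn : k + m = n := by omega
  rw [append_insertNth_comp_cast hn h, append_vecCons_comp_cast hn h', AlternatingMap.map_insertNth,
    AlternatingMap.map_insertNth]
  have sq : (-1 : ℝ) ^ k * (-1) ^ k = 1 := by rw [← mul_pow]; simp
  simp only [pow_add, Fin.val_cast, Fin.val_castAdd, Fin.val_natAdd, Fin.val_zero, add_zero,
    zsmul_eq_mul]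
  push_cast
  linear_combination -(-1 : ℝ) ^ (c : ℕ) *
    Ω (Matrix.vecCons p (Fin.append u v ∘ Fin.cast hn.symm)) * sq

/-- `K p q` plays the role of `∇_p q`: the left-hand side is the contraction of `dΦ` with the
volume form, for parallel `Φ`. -/
theorem sum_skew_derivation_mul_append (b : ι → V) (h : k + 1 + 1 + m = n)
    (h' : k + (m + 1 + 1) = n) (Ω : V [⋀^Fin n]→ₗ[ℝ] ℝ) (Φ : V [⋀^Fin (k + 1)]→ₗ[ℝ] ℝ)
    (K : V → V → V) (v : Fin m → V) :
    ∑ i : Fin (k + 1 + 1) → ι, (∑ c : Fin (k + 1 + 1), (-1 : ℝ) ^ (c : ℕ) * ∑ d : Fin (k + 1),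
        Φ (Function.update (c.removeNth (b ∘ i)) d (K (b (i c)) (b (i (c.succAbove d)))))) *
        Ω (Fin.append (b ∘ i) v ∘ Fin.cast h.symm) =
      -((k + 2) * (k + 1)) * ∑ p, ∑ q, starSum b h' Ω (Φ.curryLeft (K (b p) (b q)))
        (Matrix.vecCons (b q) (Matrix.vecCons (b p) v)) := by
  have h'' : k + 1 + (m + 1) = n := by omega
  have term (c : Fin (k + 1 + 1)) (d : Fin (k + 1)) : ∑ i : Fin (k + 1 + 1) → ι,
      (-1 : ℝ) ^ (c : ℕ) * Φ (Function.update (c.removeNth (b ∘ i)) d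
        (K (b (i c)) (b (i (c.succAbove d))))) * Ω (Fin.append (b ∘ i) v ∘ Fin.cast h.symm) =
      -∑ p, ∑ q, starSum b h' Ω (Φ.curryLeft (K (b p) (b q)))
        (Matrix.vecCons (b q) (Matrix.vecCons (b p) v)) := by
    rw [← (Fin.insertNthEquiv (fun _ ↦ ι) c).sum_comp, Fintype.sum_prod_type,
      ← Finset.sum_neg_distrib]
    refine Finset.sum_congr rfl fun p _ ↦ ?_
    rw [← (Fin.insertNthEquiv (fun _ ↦ ι) d).sum_comp, Fintype.sum_prod_type,
      ← Finset.sum_neg_distrib]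
    refine Finset.sum_congr rfl fun q _ ↦ ?_
    rw [starSum_apply, ← Finset.sum_neg_distrib]
    refine Finset.sum_congr rfl fun i _ ↦ ?_
    simp only [Fin.insertNthEquiv, Equiv.coe_fn_mk, comp_insertNth, Fin.removeNth_insertNth,
      Fin.insertNth_apply_same, Fin.insertNth_apply_succAbove,
      alternatingMap_append_insertNth h h'', alternatingMap_append_insertNth h'' h']
    rw [Fin.update_insertNth, AlternatingMap.map_insertNth]
    have signs : (-1 : ℝ) ^ (c : ℕ) * (-1) ^ (c : ℕ) * ((-1) ^ (d : ℕ) * (-1) ^ (d : ℕ)) *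
        ((-1) ^ k * (-1) ^ k) = 1 := by
      simp [← mul_pow]
    simp only [pow_add, zsmul_eq_mul, Function.comp_def, AlternatingMap.curryLeft_apply_apply]
    push_cast
    generalize Φ _ = A, Ω _ = B
    linear_combination -A * B * signs
  calc _ = ∑ _ : Fin (k + 1 + 1), ∑ _ : Fin (k + 1), -∑ p, ∑ q,
        starSum b h' Ω (Φ.curryLeft (K (b p) (b q)))
          (Matrix.vecCons (b q) (Matrix.vecCons (b p) v)) := by
        simp only [Finset.mul_sum, Finset.sum_mul]
        rw [Finset.sum_comm]
        refine Finset.sum_congr rfl fun c _ ↦ ?_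
        rw [Finset.sum_comm]
        exact Finset.sum_congr rfl fun _ _ ↦ term c _
    _ = _ := by
        simp only [Finset.sum_const, Finset.card_univ, Fintype.card_fin, nsmul_eq_mul]
        push_cast
        ring

end CodifferentialAlgebra

section CodifferentialPhi

variable {V : Type*} [NormedAddCommGroup V] [InnerProductSpace ℝ V]

theorem removeNth_succ_vecCons {α : Type*} {n : ℕ} (a : α) (v : Fin (n + 1) → α)
    (j : Fin (n + 1)) :
    j.succ.removeNth (Matrix.vecCons a v) = Matrix.vecCons a (j.removeNth v) := by
  funext i
  refine Fin.cases (by simp [Fin.removeNth]) (fun i ↦ ?_) i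
  simp [Fin.removeNth, Fin.succ_succAbove_succ]

theorem alternatingMap_vecCons_swap {n : ℕ} (f : V [⋀^Fin (n + 2)]→ₗ[ℝ] ℝ) (p q : V)
    (v : Fin n → V) : f (Matrix.vecCons q (Matrix.vecCons p v)) =
      -f (Matrix.vecCons p (Matrix.vecCons q v)) := by
  rw [← f.map_swap _ (Fin.zero_ne_one)]
  congr 1
  ext i
  refine Fin.cases ?_ (fun i ↦ Fin.cases ?_ (fun i ↦ ?_) i) i
  · simp
  · simp
  · rw [Function.comp_apply, Equiv.swap_apply_of_ne_of_ne (Fin.succ_ne_zero _)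
      (by simp [Fin.ext_iff])]
    rfl

variable {Φ : V [⋀^Fin 4]→ₗ[ℝ] ℝ} {Ω : V [⋀^Fin 8]→ₗ[ℝ] ℝ}
  {e : OrthonormalBasis (Fin 8) ℝ V}

theorem IsAdapted.starSum_curryLeft_phi (h : IsAdapted Φ Ω e) (b : OrthonormalBasis (Fin 8) ℝ V)
    (h₈ : 3 + 5 = 8) (w p q : V) (v : Fin 3 → V) :
    starSum b h₈ Ω (Φ.curryLeft w) (Matrix.vecCons q (Matrix.vecCons p v)) =
      -6 * (inner ℝ w q * Φ (Matrix.vecCons p v) - inner ℝ w p * Φ (Matrix.vecCons q v)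
        - ∑ j : Fin 3, (-1 : ℝ) ^ (j : ℕ) *
          (inner ℝ w (v j) * Φ (Matrix.vecCons p (Matrix.vecCons q (j.removeNth v))))) := by
  have expansion := starSum_curryLeft b (Fintype.card_fin 8) h₈ (by norm_num : 3 + 1 + 4 = 8) Ω Φ w
    (Matrix.vecCons q (Matrix.vecCons p v))
  have removeNth_zero {n : ℕ} (a : V) (u : Fin n → V) :
      (0 : Fin (n + 1)).removeNth (Matrix.vecCons a u) = u := rfl
  simp only [h.starSum_phi, Fin.sum_univ_succ (n := 4), Fin.sum_univ_succ (n := 3), smul_apply,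
    smul_eq_mul, AlternatingMap.coe_multilinearMap, removeNth_zero, removeNth_succ_vecCons,
    alternatingMap_vecCons_swap Φ p q, Matrix.cons_val_zero, Matrix.cons_val_succ, Fin.val_succ,
    Fin.val_zero, pow_succ, mul_left_comm _ (24 : ℝ), mul_neg, mul_one, neg_mul, neg_neg,
    Finset.sum_neg_distrib, ← Finset.mul_sum] at expansion
  push_cast at expansion
  linear_combination (1 / 4 : ℝ) * expansion

theorem IsAdapted.sum_starSum_curryLeft_phi (h : IsAdapted Φ Ω e)
    (b : OrthonormalBasis (Fin 8) ℝ V) (h₈ : 3 + 5 = 8) (K : V → V → V)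
    (skew : ∀ p q, inner ℝ (K p q - K q p) q = 0) (v : Fin 3 → V) :
    ∑ p, ∑ q, starSum b h₈ Ω (Φ.curryLeft (K (b p) (b q)))
        (Matrix.vecCons (b q) (Matrix.vecCons (b p) v)) =
      3 * ∑ p, ∑ q, ∑ j : Fin 3, (-1 : ℝ) ^ (j : ℕ) * (inner ℝ (K (b p) (b q) - K (b q) (b p)) (v j)
        * Φ (Matrix.vecCons (b p) (Matrix.vecCons (b q) (j.removeNth v)))) := by
  set G : V → V → ℝ := fun p q ↦ starSum b h₈ Ω (Φ.curryLeft (K p q))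
    (Matrix.vecCons q (Matrix.vecCons p v)) with hG
  have symmetrized (p q : V) : G p q + G q p = 6 * ∑ j : Fin 3, (-1 : ℝ) ^ (j : ℕ) *
      (inner ℝ (K p q - K q p) (v j) *
        Φ (Matrix.vecCons p (Matrix.vecCons q (j.removeNth v)))) := by
    have skew₁ := skew p q
    have skew₂ := skew q p
    rw [inner_sub_left] at skew₁ skew₂
    simp only [hG, h.starSum_curryLeft_phi, alternatingMap_vecCons_swap Φ p q, inner_sub_left,
      sub_mul, mul_sub, mul_neg, Finset.sum_sub_distrib, Finset.sum_neg_distrib]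
    linear_combination -6 * Φ (Matrix.vecCons p v) * skew₁ - 6 * Φ (Matrix.vecCons q v) * skew₂
  have swap : ∑ p, ∑ q, G (b p) (b q) = ∑ p, ∑ q, G (b q) (b p) := Finset.sum_comm
  have total : ∑ p, ∑ q, (G (b p) (b q) + G (b q) (b p)) = 2 * ∑ p, ∑ q, G (b p) (b q) := by
    simp only [Finset.sum_add_distrib]
    linear_combination -swap
  simp only [symmetrized, ← Finset.mul_sum] at total
  linear_combination -(1 / 2 : ℝ) * total

theorem IsAdapted.sum_skew_derivation_phi_mul (h : IsAdapted Φ Ω e)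
    (b : OrthonormalBasis (Fin 8) ℝ V) (h₈ : 5 + 3 = 8) (K : V → V → V)
    (skew : ∀ p q, inner ℝ (K p q - K q p) q = 0) (v : Fin 3 → V) :
    ∑ i : Fin 5 → Fin 8, (∑ c : Fin 5, (-1 : ℝ) ^ (c : ℕ) * ∑ d : Fin 4,
        Φ (Function.update (c.removeNth (b ∘ i)) d (K (b (i c)) (b (i (c.succAbove d)))))) *
        Ω (Fin.append (b ∘ i) v ∘ Fin.cast h₈.symm) =
      -60 * ∑ p, ∑ q, ∑ j : Fin 3, (-1 : ℝ) ^ (j : ℕ) *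
        (inner ℝ (K (b p) (b q) - K (b q) (b p)) (v j) *
          Φ (Matrix.vecCons (b p) (Matrix.vecCons (b q) (j.removeNth v)))) := by
  refine (sum_skew_derivation_mul_append (k := 3) b h₈ rfl Ω Φ K v).trans ?_
  have := h.sum_starSum_curryLeft_phi b rfl K skew v
  push_cast
  linear_combination (-20 : ℝ) * this

end CodifferentialPhi

section DeltaPhi

variable {M : Type*} [TopologicalSpace M] [ChartedSpace E8 M] [IsManifold I8 ∞ M]
  [RiemannianBundle (fun x : M ↦ TangentSpace I8 x)]

/-- The components of the torsion in the orthonormal basis `onb x`. -/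
def torArray (D : Connection M) (x : M) (i j k : Fin 8) : ℝ :=
  tor D x (onb x i) (onb x j) (onb x k)

namespace Structure

theorem star_eq_starSum (S : Structure M) {k m : ℕ} (h : k + m = 8) (η : Field k M) (x : M)
    (α : TM x [⋀^Fin k]→ₗ[ℝ] ℝ) (hη : ∀ w, η x w = α w) (v : Fin m → TM x) :
    S.star h η x v = 1 / (k ! : ℝ) * starSum (onb x) h (S.vol x).toAlternatingMap α v := by
  rw [star, starSum_apply]
  simp only [hη]
  rfl

theorem star_phi (S : Structure M) (h : 3 + 1 + (3 + 1) = 8) :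
    S.star (k := 3 + 1) (m := 3 + 1) h S.phi = S.phi := by
  funext x v
  obtain ⟨e, he⟩ := S.exists_isAdapted x
  rw [S.star_eq_starSum (k := 4) (m := 4) h S.phi x (S.Phi x).toAlternatingMap
    (fun _ ↦ rfl), he.starSum_phi, smul_apply, smul_eq_mul,
    show (4 ! : ℝ) = 24 by norm_num [Nat.factorial], ← mul_assoc, one_div_mul_cancel (by norm_num),
    one_mul]
  rfl

variable [IsContMDiffRiemannianBundle I8 ∞ E8 (fun x : M ↦ TangentSpace I8 x)]
  {S : Structure M} {D : Connection M}

namespace IsTorsionConnection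

theorem extD_phi (hD : S.IsTorsionConnection D) (x : M) (v : Fin 5 → TM x) :
    extD (n := 3) S.phi x v = ∑ i : Fin 5, (-1 : ℝ) ^ (i : ℕ) * ∑ j : Fin 4,
      S.Phi x (Function.update (i.removeNth v) j (D (extV (v (i.succAbove j))) x (v i))) := by
  have phi_zero (w : Fin 3 → TM x) : S.phi x (Matrix.vecCons 0 w) = 0 :=
    (S.Phi x).map_coord_zero 0 rfl
  have parallel (i : Fin 5) := hD.parallel x (fun j ↦ extV (v (i.succAbove j)))
    (fun j ↦ diffAt_coordField _) (v i)
  simp only [coordField_self] at parallel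
  rw [extD]
  simp only [mlieBracket_coordField, phi_zero, mul_zero, Finset.sum_const_zero, sub_zero]
  exact Finset.sum_congr rfl fun i _ ↦ congrArg _ (parallel i)

theorem deltaPhi_eq (hD : S.IsTorsionConnection D) (x : M) (v : Fin 3 → TM x) :
    S.deltaPhi x v = 1 / 2 * ∑ p, ∑ q, ∑ j : Fin 3, (-1 : ℝ) ^ (j : ℕ) *
      (tor D x (onb x p) (onb x q) (v j) *
        S.Phi x (Matrix.vecCons (onb x p) (Matrix.vecCons (onb x q) (j.removeNth v)))) := by
  obtain ⟨e, he⟩ := S.exists_isAdapted x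
  let K (p q : TM x) : TM x := D (extV q) x p
  have torsion (p q : TM x) : K p q - K q p = D.torsion x p q := (torsion_eq D p q).symm
  have skew (p q : TM x) : inner ℝ (K p q - K q p) q = 0 := by
    have := hD.tor_swap₂ x p q q
    rw [tor_apply] at this
    rw [torsion]
    linarith
  have contraction := he.sum_skew_derivation_phi_mul (onb x) rfl K skew v
  simp only [torsion, ← tor_apply] at contraction
  rw [deltaPhi, codiff, S.star_phi, star]
  simp only [hD.extD_phi]
  rw [show ((3 + 2) ! : ℝ) = 120 by norm_num [Nat.factorial]]
  have scale (t : ℝ) : -(1 / 120 * (-60 * t)) = 1 / 2 * t := by ring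
  exact (congrArg (fun t ↦ -(1 / 120 * t)) contraction).trans (scale _)

theorem isAlt3_torArray (hD : S.IsTorsionConnection D) (x : M) : IsAlt3 (torArray D x) :=
  ⟨fun _ _ _ ↦ tor_swap₁ D x _ _ _, fun _ _ _ ↦ hD.tor_swap₂ x _ _ _⟩

theorem deltaPhi_onb (hD : S.IsTorsionConnection D) (x : M) (i j k : Fin 8) :
    S.deltaPhi x ![onb x i, onb x j, onb x k] = 1 / 2 *
      (contr₂ (S.phiArray x) (torArray D x) i j k + contr₂ (S.phiArray x) (torArray D x) j k i +
        contr₂ (S.phiArray x) (torArray D x) k i j) := by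
  have components (p q : Fin 8) : ∑ l : Fin 3, (-1 : ℝ) ^ (l : ℕ) *
      (tor D x (onb x p) (onb x q) (![onb x i, onb x j, onb x k] l) *
        S.Phi x (Matrix.vecCons (onb x p) (Matrix.vecCons (onb x q)
          (l.removeNth ![onb x i, onb x j, onb x k])))) =
      torArray D x p q i * S.phiArray x p q j k - torArray D x p q j * S.phiArray x p q i k +
        torArray D x p q k * S.phiArray x p q i j := by
    have removeNth₀ : (0 : Fin 3).removeNth ![onb x i, onb x j, onb x k] = ![onb x j, onb x k] :=
      List.ofFn_inj.1 rfl
    have removeNth₁ : (1 : Fin 3).removeNth ![onb x i, onb x j, onb x k] = ![onb x i, onb x k] :=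
      List.ofFn_inj.1 rfl
    have removeNth₂ : (2 : Fin 3).removeNth ![onb x i, onb x j, onb x k] = ![onb x i, onb x j] :=
      List.ofFn_inj.1 rfl
    rw [Fin.sum_univ_three, removeNth₀, removeNth₁, removeNth₂]
    simp [torArray, phiArray, sub_eq_add_neg]
  rw [hD.deltaPhi_eq, (S.isSpinArray_phiArray x).contr₂_swap _ j i k]
  simp only [components, contr₂, Finset.sum_add_distrib, Finset.sum_sub_distrib, ← sub_eq_add_neg]

end IsTorsionConnection

end Structure

end DeltaPhi

section TriPairing

variable {ι ι' V : Type*} [Fintype ι] [Fintype ι'] [NormedAddCommGroup V] [InnerProductSpace ℝ V]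

/-- The contraction `∑ F(bᵢ, bⱼ, bₖ) G(bᵢ, bⱼ, bₖ)` of two covariant 3-tensors; for orthonormal `b`
it does not depend on `b`. -/
def triPairing (b : ι → V) (F G : V →ₗ[ℝ] V →ₗ[ℝ] V →ₗ[ℝ] ℝ) : ℝ :=
  ∑ i, ∑ j, ∑ k, F (b i) (b j) (b k) * G (b i) (b j) (b k)

theorem triPairing_eq (e : OrthonormalBasis ι ℝ V) (e' : OrthonormalBasis ι' ℝ V)
    (F G : V →ₗ[ℝ] V →ₗ[ℝ] V →ₗ[ℝ] ℝ) : triPairing e F G = triPairing e' F G := by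
  calc triPairing e F G
      = ∑ i, ∑ j, ∑ k, F (e i) (e j) (e' k) * G (e i) (e j) (e' k) :=
        Finset.sum_congr rfl fun i _ ↦ Finset.sum_congr rfl fun j _ ↦
          sum_smul_orthonormalBasis e e' (F (e i) (e j)) (G (e i) (e j))
    _ = ∑ i, ∑ k, ∑ j, F (e i) (e' j) (e' k) * G (e i) (e' j) (e' k) := by
        refine Finset.sum_congr rfl fun i _ ↦ Finset.sum_comm.trans
          (Finset.sum_congr rfl fun k _ ↦ ?_)
        exact sum_smul_orthonormalBasis e e' ((F (e i)).flip (e' k)) ((G (e i)).flip (e' k))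
    _ = ∑ k, ∑ j, ∑ i, F (e' i) (e' j) (e' k) * G (e' i) (e' j) (e' k) := by
        refine Finset.sum_comm.trans (Finset.sum_congr rfl fun k _ ↦ Finset.sum_comm.trans
          (Finset.sum_congr rfl fun j _ ↦ ?_))
        exact sum_smul_orthonormalBasis e e' ((F.flip (e' j)).flip (e' k))
          ((G.flip (e' j)).flip (e' k))
    _ = triPairing e' F G :=
        Finset.sum_comm_cycle.trans (Finset.sum_congr rfl fun _ _ ↦ Finset.sum_comm)

theorem sum_skew_derivation_mul (b : OrthonormalBasis ι ℝ V) {d : ι → V}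
    (skew : ∀ i j, inner ℝ (b j) (d i) = -inner ℝ (b i) (d j)) (f g : V →ₗ[ℝ] ℝ) :
    ∑ i, (f (d i) * g (b i) + f (b i) * g (d i)) = 0 := by
  have expand (f : V →ₗ[ℝ] ℝ) (i : ι) : f (d i) = ∑ j, inner ℝ (b j) (d i) * f (b j) := by
    conv_lhs => rw [← b.sum_repr' (d i)]
    simp
  have exchange : ∑ i, f (d i) * g (b i) = -∑ i, f (b i) * g (d i) := by
    simp only [expand, Finset.sum_mul, Finset.mul_sum]
    rw [Finset.sum_comm, ← Finset.sum_neg_distrib]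
    refine Finset.sum_congr rfl fun j _ ↦ ?_
    rw [← Finset.sum_neg_distrib]
    refine Finset.sum_congr rfl fun i _ ↦ ?_
    rw [skew]
    ring
  rw [Finset.sum_add_distrib, exchange, neg_add_cancel]

theorem triPairing_skew_derivation (b : OrthonormalBasis ι ℝ V) {d : ι → V}
    (skew : ∀ i j, inner ℝ (b j) (d i) = -inner ℝ (b i) (d j))
    (F G : V →ₗ[ℝ] V →ₗ[ℝ] V →ₗ[ℝ] ℝ) :
    ∑ i, ∑ j, ∑ k,
      ((F (d i) (b j) (b k) + F (b i) (d j) (b k) + F (b i) (b j) (d k)) * G (b i) (b j) (b k) +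
        F (b i) (b j) (b k) *
          (G (d i) (b j) (b k) + G (b i) (d j) (b k) + G (b i) (b j) (d k))) = 0 := by
  have slot₁ : ∑ i, ∑ j, ∑ k, (F (d i) (b j) (b k) * G (b i) (b j) (b k) +
      F (b i) (b j) (b k) * G (d i) (b j) (b k)) = 0 := by
    refine Finset.sum_comm_cycle.trans (Finset.sum_eq_zero fun k _ ↦ Finset.sum_comm.trans
      (Finset.sum_eq_zero fun j _ ↦ ?_))
    exact sum_skew_derivation_mul b skew ((F.flip (b j)).flip (b k)) ((G.flip (b j)).flip (b k))
  have slot₂ : ∑ i, ∑ j, ∑ k, (F (b i) (d j) (b k) * G (b i) (b j) (b k) +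
      F (b i) (b j) (b k) * G (b i) (d j) (b k)) = 0 :=
    Finset.sum_eq_zero fun i _ ↦ Finset.sum_comm.trans (Finset.sum_eq_zero fun k _ ↦
      sum_skew_derivation_mul b skew ((F (b i)).flip (b k)) ((G (b i)).flip (b k)))
  have slot₃ : ∑ i, ∑ j, ∑ k, (F (b i) (b j) (d k) * G (b i) (b j) (b k) +
      F (b i) (b j) (b k) * G (b i) (b j) (d k)) = 0 :=
    Finset.sum_eq_zero fun i _ ↦ Finset.sum_eq_zero fun j _ ↦
      sum_skew_derivation_mul b skew (F (b i) (b j)) (G (b i) (b j))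
  simp only [add_mul, mul_add, Finset.sum_add_distrib] at slot₁ slot₂ slot₃ ⊢
  linear_combination slot₁ + slot₂ + slot₃

end TriPairing

section LeeForm

open Filter Topology

variable {M : Type*} [TopologicalSpace M] [ChartedSpace E8 M] [IsManifold I8 ∞ M]
  [RiemannianBundle (fun x : M ↦ TangentSpace I8 x)]

theorem sum_fin_three_fun {ι A : Type*} [Fintype ι] [AddCommMonoid A] (f : (Fin 3 → ι) → A) :
    ∑ i, f i = ∑ i, ∑ j, ∑ k, f ![i, j, k] := by
  rw [← (Fin.consEquiv fun _ ↦ ι).sum_comp, Fintype.sum_prod_type]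
  refine Finset.sum_congr rfl fun i _ ↦ ?_
  rw [← (finTwoArrowEquiv ι).symm.sum_comp, Fintype.sum_prod_type]
  rfl

namespace Structure

/-- The 4-form `Φ` at a point, in curried form. -/
abbrev phiTensor (S : Structure M) (x : M) : TM x →ₗ[ℝ] TM x →ₗ[ℝ] TM x →ₗ[ℝ] TM x →ₗ[ℝ] ℝ :=
  curry₄ (S.Phi x).toAlternatingMap

end Structure

variable [IsContMDiffRiemannianBundle I8 ∞ E8 (fun x : M ↦ TangentSpace I8 x)]
  {S : Structure M} {D : Connection M}

namespace Structure.IsTorsionConnection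

theorem lee_onb (hD : S.IsTorsionConnection D) (x : M) (s : Fin 8) :
    S.lee x ![onb x s] = -(1 / 7) * contr₃ (S.phiArray x) (torArray D x) s := by
  have h := congrFun ((S.isSpinArray_phiArray x).contr₃_contr₂_cyclic_sum (hD.isAlt3_torArray x)) s
  have components : S.lee x ![onb x s] = 1 / 42 * ∑ i, ∑ j, ∑ k,
      S.deltaPhi x ![onb x i, onb x j, onb x k] * S.phiArray x i j k s := by
    rw [lee, sum_fin_three_fun]
    simp only [show ∀ i j k : Fin 8, frame x ![i, j, k] = ![onb x i, onb x j, onb x k] from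
      fun _ _ _ ↦ List.ofFn_inj.1 rfl]
    rfl
  rw [components]
  simp only [hD.deltaPhi_onb, mul_assoc, ← Finset.mul_sum]
  rw [contr₃_apply, Pi.smul_apply, smul_eq_mul] at h
  rw [h]
  ring

theorem lee_eq (hD : S.IsTorsionConnection D) (x : M) (w : Fin 1 → TM x) :
    S.lee x w = 1 / 7 * triPairing (onb x) (tor D x) (S.phiTensor x (w 0)) := by
  let A : TM x →ₗ[ℝ] ℝ := (1 / 42 : ℝ) • ∑ i : Fin 3 → Fin 8, S.deltaPhi x (frame x i) •
    S.phiTensor x (onb x (i 0)) (onb x (i 1)) (onb x (i 2))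
  let B : TM x →ₗ[ℝ] ℝ := (1 / 7 : ℝ) • ∑ i, ∑ j, ∑ k, tor D x (onb x i) (onb x j) (onb x k) •
    (((S.phiTensor x).flip (onb x i)).flip (onb x j)).flip (onb x k)
  have lee_apply (w : Fin 1 → TM x) : S.lee x w = A (w 0) := by
    simp only [A, LinearMap.smul_apply, LinearMap.sum_apply, smul_eq_mul, curry₄_apply]
    rfl
  have pairing_apply (v : TM x) : 1 / 7 * triPairing (onb x) (tor D x) (S.phiTensor x v) = B v := by
    simp only [B, LinearMap.smul_apply, LinearMap.sum_apply, LinearMap.flip_apply, smul_eq_mul,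
      triPairing]
  have h : A = B := (onb x).toBasis.ext fun s ↦ by
    rw [OrthonormalBasis.coe_toBasis, ← pairing_apply, ← show ![onb x s] 0 = onb x s from rfl,
      ← lee_apply, hD.lee_onb, contr₃_apply, triPairing, neg_mul, ← mul_neg]
    simp only [← Finset.sum_neg_distrib]
    refine congrArg _ (Finset.sum_congr rfl fun i _ ↦ Finset.sum_congr rfl fun j _ ↦
      Finset.sum_congr rfl fun k _ ↦ ?_)
    rw [curry₄_apply, ← mul_neg]
    exact congrArg _ ((S.isSpinArray_phiArray x).rotate i j k s).symm
  rw [lee_apply, h, ← pairing_apply]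

end Structure.IsTorsionConnection

end LeeForm

section LeeDerivative

open Filter Topology

variable {M : Type*} [TopologicalSpace M] [ChartedSpace E8 M] [IsManifold I8 ∞ M]
  [RiemannianBundle (fun x : M ↦ TangentSpace I8 x)]

theorem Structure.exists_orthonormal_frame (S : Structure M) (x : M) :
    ∃ e : Fin 8 → (y : M) → TangentSpace I8 y, (∀ i, SmoothAt (e i) x) ∧ (∀ i, e i x = onb x i) ∧
      ∀ᶠ y in 𝓝 x, ∃ b : OrthonormalBasis (Fin 8) ℝ (TM y), ∀ i, b i = e i y := by
  obtain ⟨e, smooth, adapted⟩ := S.exists_adapted_frame x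
  obtain ⟨b₀, -, hb₀⟩ := adapted.self_of_nhds
  refine ⟨fun i y ↦ ∑ j, inner ℝ (b₀ j) (onb x i) • e j y, fun i ↦ ?_, fun i ↦ ?_, ?_⟩
  · exact ContMDiffAt.sum_section fun j _ ↦ contMDiffAt_const.smul_section (smooth j)
  · simpa only [← hb₀] using b₀.sum_repr' (onb x i)
  · filter_upwards [adapted] with y ⟨b, _, hb⟩
    refine ⟨(onb x).map (b₀.repr.trans b.repr.symm), fun i ↦ ?_⟩
    simp only [OrthonormalBasis.map_apply, LinearIsometryEquiv.trans_apply, ← hb,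
      ← b.sum_repr_symm, b₀.repr_apply_apply]

theorem Structure.phiTensor_eq_phi (S : Structure M) (Y : Fin 4 → (y : M) → TangentSpace I8 y)
    (y : M) : S.phiTensor y (Y 0 y) (Y 1 y) (Y 2 y) (Y 3 y) = S.phi y fun a ↦ Y a y := by
  rw [curry₄_apply]
  exact congrArg (S.Phi y) (List.ofFn_inj.1 rfl)

variable [IsContMDiffRiemannianBundle I8 ∞ E8 (fun x : M ↦ TangentSpace I8 x)]
  {S : Structure M} {D : Connection M}

theorem Structure.mdifferentiableAt_phiTensor (S : Structure M) {x : M}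
    {Y₀ Y₁ Y₂ Y₃ : (y : M) → TangentSpace I8 y} (h₀ : DiffAt Y₀ x) (h₁ : DiffAt Y₁ x)
    (h₂ : DiffAt Y₂ x) (h₃ : DiffAt Y₃ x) :
    MDifferentiableAt I8 𝓘(ℝ, ℝ) (fun y ↦ S.phiTensor y (Y₀ y) (Y₁ y) (Y₂ y) (Y₃ y)) x := by
  have h := S.mdifferentiableAt_phi (Y := ![Y₀, Y₁, Y₂, Y₃]) (x := x)
    (fun a ↦ by fin_cases a <;> assumption)
  simp only [← S.phiTensor_eq_phi] at h
  exact h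

namespace Structure.IsTorsionConnection

theorem mvfderiv_phiTensor (hD : S.IsTorsionConnection D) {x : M}
    {Y₀ Y₁ Y₂ Y₃ : (y : M) → TangentSpace I8 y} (h₀ : DiffAt Y₀ x) (h₁ : DiffAt Y₁ x)
    (h₂ : DiffAt Y₂ x) (h₃ : DiffAt Y₃ x) (u : TM x) :
    mvfderiv I8 (fun y ↦ S.phiTensor y (Y₀ y) (Y₁ y) (Y₂ y) (Y₃ y)) x u =
      S.phiTensor x (D Y₀ x u) (Y₁ x) (Y₂ x) (Y₃ x) + S.phiTensor x (Y₀ x) (D Y₁ x u) (Y₂ x) (Y₃ x)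
        + S.phiTensor x (Y₀ x) (Y₁ x) (D Y₂ x u) (Y₃ x)
        + S.phiTensor x (Y₀ x) (Y₁ x) (Y₂ x) (D Y₃ x u) := by
  have parallel := hD.parallel x ![Y₀, Y₁, Y₂, Y₃] (fun a ↦ by fin_cases a <;> assumption) u
  simp only [← S.phiTensor_eq_phi, Fin.sum_univ_four] at parallel
  refine parallel.trans ?_
  simp only [curry₄_apply]
  refine congrArg₂ _ (congrArg₂ _ (congrArg₂ _ ?_ ?_) ?_) ?_ <;>
    exact congrArg (S.Phi x) (List.ofFn_inj.1 rfl)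

theorem inner_nabla_skew (hD : S.IsTorsionConnection D) {x : M} {ι : Type*}
    {e : ι → (y : M) → TangentSpace I8 y} (he : ∀ i, DiffAt (e i) x)
    (orthonormal : ∀ᶠ y in 𝓝 x, Orthonormal ℝ fun i ↦ e i y) (u : TM x) (i j : ι) :
    inner ℝ (e j x) (D (e i) x u) = -inner ℝ (e i x) (D (e j) x u) := by
  classical
  have constant : (fun y ↦ inner ℝ (e i y) (e j y)) =ᶠ[𝓝 x] fun _ ↦ if i = j then 1 else 0 := by
    filter_upwards [orthonormal] with y hy
    exact orthonormal_iff_ite.1 hy i j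
  have h := hD.mvfderiv_inner (he i) (he j) u
  rw [mvfderiv_congr constant, mvfderiv_const, zero_apply, real_inner_comm] at h
  linarith

variable [T2Space M]

theorem mvfderiv_tor (hD : S.IsTorsionConnection D) {x : M}
    {Y₁ Y₂ Y₃ : (y : M) → TangentSpace I8 y} (h₁ : DiffAt Y₁ x) (h₂ : DiffAt Y₂ x)
    (h₃ : DiffAt Y₃ x) (u : TM x) :
    mvfderiv I8 (fun y ↦ tor D y (Y₁ y) (Y₂ y) (Y₃ y)) x u =
      nablaTorsion D x u (Y₁ x) (Y₂ x) (Y₃ x) + (tor D x (D Y₁ x u) (Y₂ x) (Y₃ x)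
        + tor D x (Y₁ x) (D Y₂ x u) (Y₃ x) + tor D x (Y₁ x) (Y₂ x) (D Y₃ x u)) := by
  rw [← hD.nablaTorsionAux_eq h₁ h₂ h₃ u, nablaTorsionAux]
  ring

theorem nablaForm_lee (hD : S.IsTorsionConnection D) (x : M) (u v : TM x) :
    nablaForm D S.lee x u v = 1 / 7 * ∑ i, ∑ j, ∑ k,
      nablaTorsion D x u (onb x i) (onb x j) (onb x k) *
        S.phiTensor x v (onb x i) (onb x j) (onb x k) := by
  obtain ⟨e, smooth, e_self, orthonormal⟩ := S.exists_orthonormal_frame x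
  have diff (i : Fin 8) : DiffAt (e i) x := (smooth i).diffAt
  have skew (i j : Fin 8) : inner ℝ (onb x j) (D (e i) x u) = -inner ℝ (onb x i) (D (e j) x u) := by
    rw [← e_self, ← e_self]
    refine hD.inner_nabla_skew diff (orthonormal.mono fun y ⟨b, hb⟩ ↦ ?_) u i j
    simpa only [← hb] using b.orthonormal
  let t (p : Fin 8 × Fin 8 × Fin 8) (y : M) : ℝ := tor D y (e p.1 y) (e p.2.1 y) (e p.2.2 y)
  let f (p : Fin 8 × Fin 8 × Fin 8) (y : M) : ℝ :=
    S.phiTensor y (extV v y) (e p.1 y) (e p.2.1 y) (e p.2.2 y)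
  have lee_eq_sum : (fun y ↦ S.lee y ![extV v y]) =ᶠ[𝓝 x] fun y ↦ 1 / 7 * ∑ p, t p y * f p y := by
    filter_upwards [orthonormal] with y ⟨b, hb⟩
    rw [hD.lee_eq, triPairing_eq _ b, Fintype.sum_prod_type]
    simp only [Fintype.sum_prod_type, triPairing, hb]
    rfl
  have diff_t (p) : MDifferentiableAt I8 𝓘(ℝ, ℝ) (t p) x :=
    mdifferentiableAt_tor hD.smooth (diff _) (diff _) (diff _)
  have diff_f (p) : MDifferentiableAt I8 𝓘(ℝ, ℝ) (f p) x :=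
    S.mdifferentiableAt_phiTensor (diffAt_coordField v) (diff _) (diff _) (diff _)
  have diff_tf (p) : MDifferentiableAt I8 𝓘(ℝ, ℝ) (fun y ↦ t p y * f p y) x :=
    (diff_t p).mul (diff_f p)
  have leibniz : mvfderiv I8 (fun y ↦ S.lee y ![extV v y]) x u =
      1 / 7 * ∑ p, (t p x * mvfderiv I8 (f p) x u + f p x * mvfderiv I8 (t p) x u) := by
    rw [mvfderiv_congr lee_eq_sum, mvfderiv_const_mul (mdifferentiableAt_fun_sum diff_tf),
      mvfderiv_fun_sum_mul diff_t diff_f]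
  have cancel := triPairing_skew_derivation (onb x) skew (tor D x) (S.phiTensor x v)
  rw [nablaForm, leibniz, hD.lee_eq]
  simp only [t, f, hD.mvfderiv_tor (diff _) (diff _) (diff _),
    hD.mvfderiv_phiTensor (diffAt_coordField v) (diff _) (diff _) (diff _), e_self,
    coordField_self, Fintype.sum_prod_type, triPairing]
  change _ - 1 / 7 * ∑ i, ∑ j, ∑ k, _ * S.phiTensor x (D (extV v) x u) _ _ _ = _
  rw [← mul_sub, ← sub_eq_zero, ← mul_sub, mul_eq_zero]
  refine .inr (Eq.trans ?_ cancel)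
  simp only [← Finset.sum_sub_distrib]
  refine Finset.sum_congr rfl fun i _ ↦ Finset.sum_congr rfl fun j _ ↦
    Finset.sum_congr rfl fun k _ ↦ ?_
  ring

end Structure.IsTorsionConnection

end LeeDerivative

section Ricci

theorem sum_inner_mul_orthonormalBasis {ι V : Type*} [Fintype ι] [NormedAddCommGroup V]
    [InnerProductSpace ℝ V] (b : OrthonormalBasis ι ℝ V) (f : V →ₗ[ℝ] ℝ) (v : V) :
    ∑ s, inner ℝ v (b s) * f (b s) = f v := by
  conv_rhs => rw [← b.sum_repr' v, map_sum]
  exact Finset.sum_congr rfl fun s _ ↦ by rw [map_smul, smul_eq_mul, real_inner_comm]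

variable {M : Type*} [TopologicalSpace M] [ChartedSpace E8 M] [IsManifold I8 ∞ M]
  [RiemannianBundle (fun x : M ↦ TangentSpace I8 x)]

/-- The components of the covariant derivative of the torsion in the orthonormal basis `onb x`. -/
def nablaTorsionArray (D : Connection M) (x : M) (a i j k : Fin 8) : ℝ :=
  nablaTorsion D x (onb x a) (onb x i) (onb x j) (onb x k)

/-- The components `g(R(eᵢ, eⱼ)eₖ, eₗ)` of the curvature in the orthonormal basis `onb x`. -/
def curvatureArray (D : Connection M) (x : M) (i j k l : Fin 8) : ℝ :=
  inner ℝ (curvature D x (onb x i) (onb x j) (onb x k)) (onb x l)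

theorem Structure.phiTensor_onb (S : Structure M) (x : M) (i j k l : Fin 8) :
    S.phiTensor x (onb x i) (onb x j) (onb x k) (onb x l) = S.phiArray x i j k l :=
  curry₄_apply (S.Phi x).toAlternatingMap _ _ _ _

theorem sum_tor_mul_tor (D : Connection M) (x : M) (u v w z : TM x) :
    ∑ s, tor D x u v (onb x s) * tor D x (onb x s) w z = tor D x (D.torsion x u v) w z :=
  sum_inner_mul_orthonormalBasis (onb x) (((tor D x).flip w).flip z) (D.torsion x u v)

variable [IsContMDiffRiemannianBundle I8 ∞ E8 (fun x : M ↦ TangentSpace I8 x)] [T2Space M]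
  {S : Structure M} {D : Connection M}

namespace Structure.IsTorsionConnection

theorem ricci_sub_ricci (hD : S.IsTorsionConnection D) (x : M) (u v : TM x) :
    ricci D x u v - ricci D x v u = ∑ a, nablaTorsion D x (onb x a) (onb x a) u v := by
  let e := onb x
  have trace_bianchi (a : Fin 8) :
      inner ℝ (curvature D x (e a) u v) (e a) - inner ℝ (curvature D x (e a) v u) (e a) =
        nablaTorsion D x (e a) (e a) u v +
          (tor D x (D.torsion x (e a) u) v (e a) + tor D x (D.torsion x v (e a)) u (e a)) := by
    have h := hD.bianchi (e a) u v (e a)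
    rw [curvature_swap D (e a) v u, inner_neg_left, nablaTorsion_swap₁ D x v,
      hD.nablaTorsion_swap₂ x (e a), nablaTorsion_swap₁ D x (e a)] at h
    linarith [hD.curvature_skew u v (e a) (e a), hD.tor_swap₂ x (D.torsion x u v) (e a) (e a),
      hD.nablaTorsion_swap₂ x v u (e a) (e a), hD.nablaTorsion_swap₂ x u v (e a) (e a)]
  have quadratic_terms_cancel : ∑ a, tor D x (D.torsion x v (e a)) u (e a) =
      -∑ a, tor D x (D.torsion x (e a) u) v (e a) := by
    simp only [← sum_tor_mul_tor, ← Finset.sum_neg_distrib]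
    refine Finset.sum_comm.trans (Finset.sum_congr rfl fun a _ ↦ Finset.sum_congr rfl fun s _ ↦ ?_)
    rw [tor_swap₁ D x v (e s)]
    ring
  rw [ricci, ricci, ← Finset.sum_sub_distrib, Finset.sum_congr rfl fun a _ ↦ trace_bianchi a,
    Finset.sum_add_distrib, Finset.sum_add_distrib, quadratic_terms_cancel, add_neg_cancel,
    add_zero]

theorem curvatureArray_stabilizes (hD : S.IsTorsionConnection D) (x : M) (a b i j k l : Fin 8) :
    ∑ s, (curvatureArray D x a b i s * S.phiArray x s j k l +
      curvatureArray D x a b j s * S.phiArray x i s k l +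
      curvatureArray D x a b k s * S.phiArray x i j s l +
      curvatureArray D x a b l s * S.phiArray x i j k s) = 0 := by
  let e := onb x
  let F := S.phiTensor x
  have expand (f : TM x →ₗ[ℝ] ℝ) (c : Fin 8) :
      ∑ s, curvatureArray D x a b c s * f (e s) = f (curvature D x (e a) (e b) (e c)) :=
    sum_inner_mul_orthonormalBasis e f _
  have stable := hD.curvature_stabilizes (e a) (e b) ![e i, e j, e k, e l]
  have update_eq (m : Fin 4) (w : TM x) : S.Phi x (Function.update ![e i, e j, e k, e l] m w) =
      ![F w (e j) (e k) (e l), F (e i) w (e k) (e l), F (e i) (e j) w (e l),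
        F (e i) (e j) (e k) w] m := by
    fin_cases m <;> exact congrArg (S.Phi x) (List.ofFn_inj.1 rfl)
  simp only [update_eq, Fin.sum_univ_four] at stable
  simp only [← S.phiTensor_onb, Finset.sum_add_distrib]
  refine (congrArg₂ _ (congrArg₂ _ (congrArg₂ _
    (expand (((F.flip (e j)).flip (e k)).flip (e l)) i)
    (expand (((F (e i)).flip (e k)).flip (e l)) j)) (expand ((F (e i) (e j)).flip (e l)) k))
    (expand (F (e i) (e j) (e k)) l)).trans stable

theorem isCurvatureArray (hD : S.IsTorsionConnection D) (x : M) :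
    IsCurvatureArray (S.phiArray x) (torArray D x) (nablaTorsionArray D x)
      (curvatureArray D x) where
  spin := S.isSpinArray_phiArray x
  alt := hD.isAlt3_torArray x
  altN _ := ⟨fun _ _ _ ↦ nablaTorsion_swap₁ D x _ _ _ _,
    fun _ _ _ ↦ hD.nablaTorsion_swap₂ x _ _ _ _⟩
  swap₁ _ _ _ _ := by rw [curvatureArray, curvature_swap, inner_neg_left, curvatureArray]
  swap₂ _ _ _ _ := hD.curvature_skew _ _ _ _
  stab := hD.curvatureArray_stabilizes x
  bianchi a b c d := by
    have h := hD.bianchi (onb x a) (onb x b) (onb x c) (onb x d)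
    simp only [← sum_tor_mul_tor, ← Finset.sum_add_distrib] at h
    exact h

end Structure.IsTorsionConnection

end Ricci

section WedgePhi

theorem sum_sign_mul_comp_perm {κ ι : Type*} [Fintype κ] [DecidableEq κ] [Fintype ι]
    (H : (κ → ι) → ℝ) {A : (κ → ι) → ℝ}
    (hA : ∀ I (σ : Equiv.Perm κ), A (I ∘ σ) = (Equiv.Perm.sign σ : ℤ) * A I) :
    ∑ I, (∑ σ : Equiv.Perm κ, (Equiv.Perm.sign σ : ℤ) * H (I ∘ σ)) * A I =
      (Fintype.card κ)! * ∑ I, H I * A I := by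
  have reindex (σ : Equiv.Perm κ) :
      ∑ I, (Equiv.Perm.sign σ : ℤ) * H (I ∘ σ) * A I = ∑ I, H I * A I := by
    rw [← Equiv.sum_comp (σ.symm.arrowCongr (Equiv.refl ι)) fun I ↦ H I * A I]
    refine Finset.sum_congr rfl fun I _ ↦ ?_
    rw [mul_comm (_ : ℝ) (H _), mul_assoc, ← hA]
    rfl
  simp only [Finset.sum_mul]
  rw [Finset.sum_comm, Finset.sum_congr rfl fun σ _ ↦ reindex σ, Finset.sum_const,
    Finset.card_univ, Fintype.card_perm, nsmul_eq_mul]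

theorem volAppend_comp_perm {V : Type*} [NormedAddCommGroup V] [InnerProductSpace ℝ V]
    {k m n : ℕ} (h : k + m = n) (Ω : V [⋀^Fin n]→ₗ[ℝ] ℝ) (u : Fin k → V) (v : Fin m → V)
    (σ : Equiv.Perm (Fin k)) :
    volAppend h Ω (u ∘ σ) v = (Equiv.Perm.sign σ : ℤ) * volAppend h Ω u v := by
  subst h
  have append_eq := append_comp_perm u v σ 1
  rw [Equiv.Perm.coe_one, Function.comp_id] at append_eq
  simp only [volAppend_apply, Fin.cast_refl, Function.comp_id]
  rw [append_eq, Ω.map_perm, Equiv.Perm.sign_permCongr, Equiv.Perm.sign_sumCongr,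
    Equiv.Perm.sign_one, mul_one, Units.smul_def, zsmul_eq_mul]

theorem IsAdapted.sum_phi_mul_volAppend {ι V : Type*} [Fintype ι] [NormedAddCommGroup V]
    [InnerProductSpace ℝ V] {Φ : V [⋀^Fin 4]→ₗ[ℝ] ℝ} {Ω : V [⋀^Fin 8]→ₗ[ℝ] ℝ}
    {e : OrthonormalBasis (Fin 8) ℝ V} (h : IsAdapted Φ Ω e) (b : OrthonormalBasis ι ℝ V)
    (h₈ : 2 + 4 + 2 = 8) (p v : Fin 2 → V) :
    ∑ j : Fin 4 → ι, Φ (b ∘ j) * volAppend h₈ Ω (Fin.append p (b ∘ j)) v =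
      24 * Φ ![p 0, p 1, v 0, v 1] := by
  have even_shuffle (q : Fin 4 → V) : volAppend h₈ Ω (Fin.append p q) v =
      Ω (Fin.append q ![p 0, p 1, v 0, v 1]) := by
    have append_eq : Fin.append (Fin.append p q) v ∘ Fin.cast h₈.symm =
        Fin.append q ![p 0, p 1, v 0, v 1] ∘ (Fin.cycleRange 5 ^ 4 : Equiv.Perm (Fin 8)) := by
      ext a
      fin_cases a <;> rfl
    rw [volAppend_apply, append_eq, Ω.map_perm, map_pow, Fin.sign_cycleRange]
    norm_num
  have star := congrArg (· ![p 0, p 1, v 0, v 1]) (h.starSum_phi b rfl)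
  simp only [starSum_apply] at star
  simp only [even_shuffle]
  exact star

variable {M : Type*} [TopologicalSpace M] [ChartedSpace E8 M] [IsManifold I8 ∞ M]
  [RiemannianBundle (fun x : M ↦ TangentSpace I8 x)]

namespace Structure

theorem star_wedge (S : Structure M) {p q m : ℕ} (h : p + q + m = 8) (α : Field p M)
    (β : Field q M) (x : M) (v : Fin m → TM x) :
    S.star h (wedge α β) x v = 1 / ((p ! : ℝ) * q !) * ∑ i : Fin p → Fin 8, α x (frame x i) *
      ∑ j : Fin q → Fin 8, β x (frame x j) *
        volAppend h (S.vol x).toAlternatingMap (Fin.append (frame x i) (frame x j)) v := by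
  let Ω := (S.vol x).toAlternatingMap
  let H (I : Fin (p + q) → Fin 8) : ℝ :=
    α x (frame x (I ∘ Fin.castAdd q)) * β x (frame x (I ∘ Fin.natAdd p))
  let A (I : Fin (p + q) → Fin 8) : ℝ := volAppend h Ω (frame x I) v
  have antisymmetrize := sum_sign_mul_comp_perm H (A := A)
    fun I σ ↦ volAppend_comp_perm h Ω (frame x I) v σ
  have wedge_eq (I : Fin (p + q) → Fin 8) : wedge α β x (frame x I) =
      1 / ((p ! : ℝ) * q !) * ∑ σ : Equiv.Perm (Fin (p + q)),
        (Equiv.Perm.sign σ : ℤ) * H (I ∘ σ) :=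
    congrArg _ (Finset.sum_congr rfl fun σ _ ↦ mul_assoc _ _ _)
  have split : ∑ I, H I * A I = ∑ i : Fin p → Fin 8, α x (frame x i) *
      ∑ j : Fin q → Fin 8, β x (frame x j) *
        volAppend h Ω (Fin.append (frame x i) (frame x j)) v := by
    rw [← Equiv.sum_comp (Fin.appendEquiv p q), Fintype.sum_prod_type]
    refine Finset.sum_congr rfl fun i _ ↦ ?_
    rw [Finset.mul_sum]
    refine Finset.sum_congr rfl fun j _ ↦ ?_
    have restrict_left : Fin.append i j ∘ Fin.castAdd q = i := by ext; simp
    have restrict_right : Fin.append i j ∘ Fin.natAdd p = j := by ext; simp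
    have frame_append : frame x (Fin.append i j) = Fin.append (frame x i) (frame x j) :=
      comp_append (onb x) i j
    change α x (frame x (Fin.append i j ∘ _)) * β x (frame x (Fin.append i j ∘ _)) *
      volAppend h Ω (frame x (Fin.append i j)) v = _
    rw [restrict_left, restrict_right, frame_append, mul_assoc]
  calc S.star h (wedge α β) x v
      = 1 / ((p + q)! : ℝ) * ∑ I, wedge α β x (frame x I) * A I := by
        simp only [A, Ω, volAppend_apply]
        rfl
    _ = 1 / ((p ! : ℝ) * q !) * ∑ I, H I * A I := by
        simp only [wedge_eq, mul_assoc]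
        rw [← Finset.mul_sum, antisymmetrize, Fintype.card_fin]
        field_simp
    _ = _ := by rw [split]

theorem star_wedge_phi (S : Structure M) (β : Field 2 M) (x : M) (v : Fin 2 → TM x) :
    S.star (k := 2 + 4) (m := 2) (by norm_num) (wedge β S.phi) x v = 1 / 2 * S.contrPhi β x v := by
  obtain ⟨e, he⟩ := S.exists_isAdapted x
  have inner_sum (i : Fin 2 → Fin 8) :
      ∑ j : Fin 4 → Fin 8, S.phi x (frame x j) *
        volAppend rfl (S.vol x).toAlternatingMap (Fin.append (frame x i) (frame x j)) v =
      24 * S.phi x ![onb x (i 0), onb x (i 1), v 0, v 1] :=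
    he.sum_phi_mul_volAppend (onb x) rfl (frame x i) v
  have frame_eq (i : Fin 2 → Fin 8) : frame x i = ![onb x (i 0), onb x (i 1)] :=
    List.ofFn_inj.1 rfl
  have normalization : 1 / ((2 ! : ℝ) * 4 !) = 1 / 48 := by norm_num [Nat.factorial]
  rw [star_wedge, normalization]
  simp only [inner_sum]
  rw [← Equiv.sum_comp (finTwoArrowEquiv (Fin 8)).symm, Fintype.sum_prod_type]
  simp only [frame_eq, finTwoArrowEquiv_symm_apply, contrPhi, Finset.mul_sum,
    Matrix.cons_val_zero, Matrix.cons_val_one]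
  refine Finset.sum_congr rfl fun a _ ↦ Finset.sum_congr rfl fun b _ ↦ ?_
  ring

end Structure

end WedgePhi

section Tensors

variable {M : Type*} [TopologicalSpace M] [ChartedSpace E8 M]

/-- The value of `β` at `x` is multilinear, as it is for the value of a tensor field. -/
def IsTensorAt {k : ℕ} (β : Field k M) (x : M) : Prop :=
  ∃ B : MultilinearMap ℝ (fun _ : Fin k ↦ TM x) ℝ, ∀ v, β x v = B v

namespace IsTensorAt

variable {k : ℕ} {β γ : Field k M} {x : M}

theorem zero : IsTensorAt (0 : Field k M) x :=
  ⟨0, fun _ ↦ rfl⟩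

theorem add (hβ : IsTensorAt β x) (hγ : IsTensorAt γ x) : IsTensorAt (β + γ) x := by
  obtain ⟨B, hB⟩ := hβ
  obtain ⟨C, hC⟩ := hγ
  exact ⟨B + C, fun v ↦ congrArg₂ (· + ·) (hB v) (hC v)⟩

theorem const_smul (hβ : IsTensorAt β x) (c : ℝ) : IsTensorAt (c • β) x := by
  obtain ⟨B, hB⟩ := hβ
  exact ⟨c • B, fun v ↦ congrArg (c * ·) (hB v)⟩

theorem of_linearMap₂ {β : Field 2 M} (B : TM x →ₗ[ℝ] TM x →ₗ[ℝ] ℝ)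
    (h : ∀ v, β x v = B (v 0) (v 1)) : IsTensorAt β x :=
  ⟨LinearMap.uncurryLeft
    ((MultilinearMap.ofSubsingletonₗ ℝ ℝ (TM x) ℝ (0 : Fin 1)).toLinearMap ∘ₗ B), h⟩

variable [RiemannianBundle (fun x : M ↦ TangentSpace I8 x)]

theorem ext (hβ : IsTensorAt β x) (hγ : IsTensorAt γ x)
    (h : ∀ i : Fin k → Fin 8, β x (frame x i) = γ x (frame x i)) : β x = γ x := by
  obtain ⟨B, hB⟩ := hβ
  obtain ⟨C, hC⟩ := hγ
  have B_eq_C : B = C := multilinearMap_ext_orthonormalBasis (onb x) fun i ↦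
    (hB _).symm.trans ((h i).trans (hC _))
  ext v
  rw [hB, hC, B_eq_C]

end IsTensorAt

variable [RiemannianBundle (fun x : M ↦ TangentSpace I8 x)]

/-- The components `β(eᵢ, eⱼ)` of a 2-tensor in the orthonormal basis `onb x`. -/
def components (β : Field 2 M) (x : M) (i j : Fin 8) : ℝ := β x ![onb x i, onb x j]

theorem IsTensorAt.components_inj {β γ : Field 2 M} {x : M} (hβ : IsTensorAt β x)
    (hγ : IsTensorAt γ x) : components β x = components γ x ↔ β x = γ x := by
  refine ⟨fun h ↦ hβ.ext hγ fun i ↦ ?_, fun h ↦ funext₂ fun i j ↦ congrFun h _⟩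
  have frame_eq : frame x i = ![onb x (i 0), onb x (i 1)] := List.ofFn_inj.1 rfl
  rw [frame_eq]
  exact congrFun₂ h (i 0) (i 1)

namespace Structure

variable [IsManifold I8 ∞ M] (S : Structure M)

theorem isTensorAt_star {k m : ℕ} (h : k + m = 8) (η : Field k M) (x : M) :
    IsTensorAt (S.star h η) x := by
  refine ⟨(1 / (k ! : ℝ)) • ∑ i : Fin k → Fin 8,
    η x (frame x i) • volAppend h (S.vol x).toAlternatingMap (frame x i), fun v ↦ ?_⟩
  simp only [smul_apply, sum_apply, volAppend_apply, smul_eq_mul]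
  rfl

theorem isTensorAt_deltaPhi (x : M) : IsTensorAt S.deltaPhi x := by
  obtain ⟨B, hB⟩ := S.isTensorAt_star (k := 5) (m := 3) rfl
    (extD (S.star (k := 4) (m := 4) rfl S.phi)) x
  exact ⟨-B, fun v ↦ congrArg Neg.neg (hB v)⟩

theorem isTensorAt_leeContr {γ : Field 3 M} {x : M} (hγ : IsTensorAt γ x) :
    IsTensorAt (S.leeContr γ) x := by
  obtain ⟨B, hB⟩ := hγ
  refine ⟨∑ s, S.lee x ![onb x s] • B.curryLeft (onb x s), fun v ↦ ?_⟩
  simp only [leeContr, hB, sum_apply, smul_apply, smul_eq_mul, B.curryLeft_apply]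
  exact Finset.sum_congr rfl fun s _ ↦ congrArg (fun w ↦ _ * B w) (List.ofFn_inj.1 rfl)

theorem isTensorAt_leeContr_torsionForm (D : Connection M) (x : M) :
    IsTensorAt (S.leeContr (torsionForm D)) x := by
  refine .of_linearMap₂ (∑ s, S.lee x ![onb x s] • tor D x (onb x s)) fun v ↦ ?_
  simp only [LinearMap.sum_apply, LinearMap.smul_apply, smul_eq_mul]
  rfl

/-- `contrPhi` as an exterior form. -/
def contrPhiForm (β : Field 2 M) (x : M) : TM x [⋀^Fin 2]→L[ℝ] ℝ :=
  ∑ a, ∑ b, β x ![onb x a, onb x b] • ((S.Phi x).curryLeft (onb x a)).curryLeft (onb x b)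

theorem contrPhi_eq_contrPhiForm (β : Field 2 M) (x : M) : S.contrPhi β x = S.contrPhiForm β x := by
  ext v
  simp only [contrPhi, contrPhiForm, ContinuousAlternatingMap.sum_apply,
    ContinuousAlternatingMap.smul_apply, smul_eq_mul,
    ContinuousAlternatingMap.curryLeft_apply_apply]
  exact Finset.sum_congr rfl fun a _ ↦ Finset.sum_congr rfl fun b _ ↦
    congrArg (fun w ↦ _ * S.Phi x w) (List.ofFn_inj.1 rfl)

theorem isTensorAt_contrPhi (β : Field 2 M) (x : M) : IsTensorAt (S.contrPhi β) x :=
  ⟨(S.contrPhiForm β x).toMultilinearMap, congrFun (S.contrPhi_eq_contrPhiForm β x)⟩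

theorem memLambda27_of_eq_contrPhi {β : Field 2 M} {x : M}
    (hβ : β x = (-(1 / 6 : ℝ) • S.contrPhi β) x) :
    (∃ b : TM x [⋀^Fin 2]→L[ℝ] ℝ, β x = b) ∧ ∀ v : Fin 2 → TM x,
      S.star (k := 2 + 4) (m := 2) (by norm_num) (wedge β S.phi) x v = -3 * β x v := by
  refine ⟨⟨-(1 / 6 : ℝ) • S.contrPhiForm β x, ?_⟩, fun v ↦ ?_⟩
  · rw [hβ, Pi.smul_apply, S.contrPhi_eq_contrPhiForm]
    rfl
  · rw [S.star_wedge_phi, hβ, Pi.smul_apply, Pi.smul_apply, smul_eq_mul]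
    ring

end Structure

end Tensors

section SymmetricRicci

variable {M : Type*} [TopologicalSpace M] [ChartedSpace E8 M] [IsManifold I8 ∞ M]
  [RiemannianBundle (fun x : M ↦ TangentSpace I8 x)]

/-- The divergence `(div T)(u, v) = ∑ₐ (∇_{eₐ} T)(eₐ, u, v)` of the torsion. -/
def divTorsion (D : Connection M) : Field 2 M := fun x v ↦
  ∑ a, nablaTorsion D x (onb x a) (onb x a) (v 0) (v 1)

variable [IsContMDiffRiemannianBundle I8 ∞ E8 (fun x : M ↦ TangentSpace I8 x)]
  {S : Structure M} {D : Connection M}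

namespace Structure.IsTorsionConnection

theorem components_leeContr_torsionForm (hD : S.IsTorsionConnection D) (x : M) :
    components (S.leeContr (torsionForm D)) x =
      -(1 / 7 : ℝ) • tauT (S.phiArray x) (torArray D x) := by
  ext i j
  simp only [components, leeContr, hD.lee_onb, tauT, Pi.smul_apply, smul_eq_mul, Finset.mul_sum,
    mul_assoc]
  rfl

theorem components_leeContr_torsionForm_swap (hD : S.IsTorsionConnection D) (x : M)
    (i j : Fin 8) : components (S.leeContr (torsionForm D)) x j i =
      -components (S.leeContr (torsionForm D)) x i j := by
  rw [hD.components_leeContr_torsionForm]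
  simp only [Pi.smul_apply, smul_eq_mul, tauT, (hD.isAlt3_torArray x).swap₂ _ i j, mul_neg,
    Finset.sum_neg_distrib]

theorem leeContr_deltaPhi (hD : S.IsTorsionConnection D) :
    S.leeContr S.deltaPhi = S.leeContr (torsionForm D) := by
  funext x
  rw [← (S.isTensorAt_leeContr (S.isTensorAt_deltaPhi x)).components_inj
    (S.isTensorAt_leeContr_torsionForm D x), hD.components_leeContr_torsionForm]
  ext i j
  have spin := S.isSpinArray_phiArray x
  let τ := contr₃ (S.phiArray x) (torArray D x)
  have quadratic_terms_cancel : ∑ s, ∑ t, τ s * τ t * S.phiArray x t s i j = 0 := by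
    have swap : ∑ s, ∑ t, τ s * τ t * S.phiArray x t s i j =
        -∑ s, ∑ t, τ s * τ t * S.phiArray x t s i j := by
      conv_lhs => rw [Finset.sum_comm]
      simp only [← Finset.sum_neg_distrib]
      refine Finset.sum_congr rfl fun s _ ↦ Finset.sum_congr rfl fun t _ ↦ ?_
      rw [spin.swap₁ t s]
      ring
    linarith
  have deltaPhi_onb (s : Fin 8) : S.deltaPhi x ![onb x s, onb x i, onb x j] =
      torArray D x s i j + 1 / 6 * ∑ t, τ t * S.phiArray x t s i j := by
    rw [hD.deltaPhi_onb, spin.contr₂_cyclic_sum (hD.isAlt3_torArray x)]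
    ring
  calc components (S.leeContr S.deltaPhi) x i j
      = ∑ s, -(1 / 7) * τ s * (torArray D x s i j + 1 / 6 * ∑ t, τ t * S.phiArray x t s i j) := by
        change ∑ s, S.lee x ![onb x s] * S.deltaPhi x ![onb x s, onb x i, onb x j] = _
        simp only [hD.lee_onb, deltaPhi_onb, τ]
    _ = -(1 / 7) * ∑ s, τ s * torArray D x s i j -
          1 / 42 * ∑ s, ∑ t, τ s * τ t * S.phiArray x t s i j := by
        simp only [mul_add, Finset.sum_add_distrib, Finset.mul_sum, sub_eq_add_neg,
          ← Finset.sum_neg_distrib]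
        refine congrArg₂ _ (Finset.sum_congr rfl fun s _ ↦ by ring) (Finset.sum_congr rfl fun s _ ↦
          Finset.sum_congr rfl fun t _ ↦ by ring)
    _ = _ := by
        rw [quadratic_terms_cancel, mul_zero, sub_zero]
        rfl

variable [T2Space M]

theorem isTensorAt_dNabla_lee (hD : S.IsTorsionConnection D) (x : M) :
    IsTensorAt (dNabla D S.lee) x := by
  let nablaLee : TM x →ₗ[ℝ] TM x →ₗ[ℝ] ℝ := (1 / 7 : ℝ) • ∑ i, ∑ j, ∑ k,
    ((isLinearMap_nablaTorsion D x (onb x i) (onb x j) (onb x k)).mk' _).smulRight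
      ((((S.phiTensor x).flip (onb x i)).flip (onb x j)).flip (onb x k))
  have nablaLee_apply (u v : TM x) : nablaLee u v = nablaForm D S.lee x u v := by
    rw [hD.nablaForm_lee]
    simp only [nablaLee, LinearMap.sum_apply, LinearMap.smul_apply, smul_eq_mul]
    rfl
  refine .of_linearMap₂ (nablaLee - nablaLee.flip) fun v ↦ ?_
  rw [dNabla, ← nablaLee_apply, ← nablaLee_apply]
  rfl

theorem components_dNabla_lee (hD : S.IsTorsionConnection D) (x : M) :
    components (dNabla D S.lee) x =
      -(1 / 7 : ℝ) • skewContr₃ (S.phiArray x) (nablaTorsionArray D x) := by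
  have nablaForm_onb (i j : Fin 8) : nablaForm D S.lee x (onb x i) (onb x j) =
      -(1 / 7) * contr₃ (S.phiArray x) (nablaTorsionArray D x i) j := by
    simp only [hD.nablaForm_lee, contr₃_apply, S.phiTensor_onb,
      (S.isSpinArray_phiArray x).rotate _ _ _ j, mul_neg, Finset.sum_neg_distrib, neg_mul]
    rfl
  ext i j
  change nablaForm D S.lee x (onb x i) (onb x j) - nablaForm D S.lee x (onb x j) (onb x i) = _
  rw [nablaForm_onb, nablaForm_onb, Pi.smul_apply, Pi.smul_apply, skewContr₃, smul_eq_mul]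
  ring

theorem isTensorAt_divTorsion (hD : S.IsTorsionConnection D) (x : M) :
    IsTensorAt (divTorsion D) x := by
  refine .of_linearMap₂ (∑ a, (hD.isBilinearMap_nablaTorsion₂₃ x (onb x a) (onb x a)).toLinearMap)
    fun v ↦ ?_
  simp only [LinearMap.sum_apply]
  rfl

theorem ricci_symm_iff_divTorsion_eq_zero (hD : S.IsTorsionConnection D) (x : M) :
    (∀ u v : TM x, ricci D x u v = ricci D x v u) ↔ divTorsion D x = 0 := by
  simp only [← sub_eq_zero (b := ricci D x _ _), hD.ricci_sub_ricci]
  exact ⟨fun h ↦ funext fun v ↦ h (v 0) (v 1), fun h u v ↦ congrFun h ![u, v]⟩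

theorem components_divTorsion_relation (hD : S.IsTorsionConnection D) (x : M) :
    (2 : ℝ) • components (-(1 / 7 : ℝ) • divTorsion D) x +
        opPhi (S.phiArray x) (components (-(1 / 7 : ℝ) • divTorsion D) x) =
      components (dNabla D S.lee) x -
        (1 / 6 : ℝ) • opPhi (S.phiArray x) (components (dNabla D S.lee) x) +
        (2 / 3 : ℝ) • components (S.leeContr (torsionForm D)) x -
        (1 / 3 : ℝ) • opPhi (S.phiArray x) (components (S.leeContr (torsionForm D)) x) := by
  have components_div : components (-(1 / 7 : ℝ) • divTorsion D) x =
      -(1 / 7 : ℝ) • divergence (nablaTorsionArray D x) := rfl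
  have relation := (hD.isCurvatureArray x).divergence_relation fun u v ↦
    hD.ricci_sub_ricci x (onb x u) (onb x v)
  rw [components_div, hD.components_dNabla_lee, hD.components_leeContr_torsionForm]
  simp only [map_smul]
  linear_combination (norm := module) (-(1 / 7 : ℝ)) • relation

theorem ricci_symm_iff_components_dNabla_lee (hD : S.IsTorsionConnection D) (x : M) :
    (∀ u v : TM x, ricci D x u v = ricci D x v u) ↔
      components (dNabla D S.lee) x = -(1 / 3 : ℝ) • components (S.leeContr (torsionForm D)) x +
        (1 / 6 : ℝ) • opPhi (S.phiArray x) (components (S.leeContr (torsionForm D)) x) := by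
  have spin := S.isSpinArray_phiArray x
  have components_eq_zero_iff : components (-(1 / 7 : ℝ) • divTorsion D) x = 0 ↔
      divTorsion D x = 0 := by
    refine Iff.trans ?_ ((hD.isTensorAt_divTorsion x).components_inj .zero)
    exact smul_eq_zero_iff_right (show -(1 / 7 : ℝ) ≠ 0 by norm_num)
  rw [hD.ricci_symm_iff_divTorsion_eq_zero, ← components_eq_zero_iff]
  refine eq_zero_iff_of_quadratic (spin.opPhi_opPhi fun i j ↦ ?_) (spin.opPhi_opPhi fun i j ↦ ?_)
    (spin.opPhi_opPhi (hD.components_leeContr_torsionForm_swap x))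
    (hD.components_divTorsion_relation x)
  · change -(1 / 7) * divergence (nablaTorsionArray D x) j i =
      -(-(1 / 7) * divergence (nablaTorsionArray D x) i j)
    simp only [divergence, nablaTorsionArray, hD.nablaTorsion_swap₂ x _ _ (onb x i),
      Finset.sum_neg_distrib, mul_neg]
  · exact (neg_sub _ _).symm

theorem ricci_symm_iff_dNabla_lee (hD : S.IsTorsionConnection D) (x : M) :
    (∀ u v : TM x, ricci D x u v = ricci D x v u) ↔ ∀ v : Fin 2 → TM x,
      dNabla D S.lee x v = -(1 / 3 : ℝ) * S.leeContr (torsionForm D) x v +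
        (1 / 6 : ℝ) * S.contrPhi (S.leeContr (torsionForm D)) x v := by
  let β := S.leeContr (torsionForm D)
  have tensor : IsTensorAt (-(1 / 3 : ℝ) • β + (1 / 6 : ℝ) • S.contrPhi β) x :=
    ((S.isTensorAt_leeContr_torsionForm D x).const_smul _).add
      ((S.isTensorAt_contrPhi β x).const_smul _)
  rw [hD.ricci_symm_iff_components_dNabla_lee]
  exact ((hD.isTensorAt_dNabla_lee x).components_inj tensor).trans funext_iff

theorem dNabla_lee_eq_contrPhi (hD : S.IsTorsionConnection D) {x : M}
    (ricci_symm : ∀ u v : TM x, ricci D x u v = ricci D x v u) :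
    dNabla D S.lee x = (-(1 / 6 : ℝ) • S.contrPhi (dNabla D S.lee)) x := by
  rw [← (hD.isTensorAt_dNabla_lee x).components_inj ((S.isTensorAt_contrPhi _ x).const_smul _)]
  exact eq_neg_smul_of_quadratic ((S.isSpinArray_phiArray x).opPhi_opPhi
    (hD.components_leeContr_torsionForm_swap x))
    ((hD.ricci_symm_iff_components_dNabla_lee x).1 ricci_symm)

end Structure.IsTorsionConnection

end SymmetricRicci

end Spin7

end

theorem mainTheorem9_general
    {M : Type*} [TopologicalSpace M] [T2Space M]
    [ChartedSpace Spin7.E8 M] [IsManifold Spin7.I8 ∞ M]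
    [RiemannianBundle (fun x : M => TangentSpace Spin7.I8 x)]
    [IsContMDiffRiemannianBundle Spin7.I8 ∞ Spin7.E8 (fun x : M => TangentSpace Spin7.I8 x)]
    {S : Spin7.Structure M} {D : Spin7.Connection M} (hD : S.IsTorsionConnection D) (x : M) :
    ((∀ u v : Spin7.TM x, Spin7.ricci D x u v = Spin7.ricci D x v u) ↔
      ∀ v : Fin 2 → Spin7.TM x,
        Spin7.dNabla D S.lee x v =
          -(1 / 3 : ℝ) * S.leeContr S.deltaPhi x v +
            (1 / 6 : ℝ) * S.contrPhi (S.leeContr S.deltaPhi) x v) ∧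
    ((∀ u v : Spin7.TM x, Spin7.ricci D x u v = Spin7.ricci D x v u) ↔
      ∀ v : Fin 2 → Spin7.TM x,
        Spin7.dNabla D S.lee x v =
          -(1 / 3 : ℝ) * S.leeContr (Spin7.torsionForm D) x v +
            (1 / 6 : ℝ) * S.contrPhi (S.leeContr (Spin7.torsionForm D)) x v) ∧
    ((∀ u v : Spin7.TM x, Spin7.ricci D x u v = Spin7.ricci D x v u) →
      (∀ v : Fin 2 → Spin7.TM x,
        Spin7.dNabla D S.lee x v = -(1 / 6 : ℝ) * S.contrPhi (Spin7.dNabla D S.lee) x v) ∧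
      (∃ b : (Spin7.TM x) [⋀^Fin 2]→L[ℝ] ℝ, Spin7.dNabla D S.lee x = b) ∧
      ∀ v : Fin 2 → Spin7.TM x,
        S.star (k := 2 + 4) (m := 2) (by norm_num) (Spin7.wedge (Spin7.dNabla D S.lee) S.phi) x v =
          -3 * Spin7.dNabla D S.lee x v) := by
  rw [hD.leeContr_deltaPhi]
  refine ⟨hD.ricci_symm_iff_dNabla_lee x, hD.ricci_symm_iff_dNabla_lee x, fun ricci_symm ↦ ?_⟩
  have eq_contrPhi := hD.dNabla_lee_eq_contrPhi ricci_symm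
  exact ⟨congrFun eq_contrPhi, S.memLambda27_of_eq_contrPhi eq_contrPhi⟩

/-- On a `Spin(7)`-manifold, with Lee form `θ`, `Spin(7)`-torsion connection `∇` and torsion `T`:
`Ric` is symmetric iff
`(d^∇θ)_{ij} = -(1/3) θ_s (δΦ)_{sij} + (1/6) θ_s (δΦ)_{sab} Φ_{abij}`, iff
`(d^∇θ)_{ij} = -(1/3) θ_s T_{sij} + (1/6) θ_s T_{sab} Φ_{abij}`; and then
`(d^∇θ)_{ij} = -(1/6) (d^∇θ)_{ab} Φ_{abij}` and `d^∇θ ∈ Λ²₇`. -/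
theorem mainTheorem9
    {M : Type*} [TopologicalSpace M] [T2Space M] [SecondCountableTopology M]
    [ChartedSpace Spin7.E8 M] [IsManifold Spin7.I8 ∞ M]
    [RiemannianBundle (fun x : M => TangentSpace Spin7.I8 x)]
    [IsContMDiffRiemannianBundle Spin7.I8 ∞ Spin7.E8 (fun x : M => TangentSpace Spin7.I8 x)]
    (S : Spin7.Structure M) (D : Spin7.Connection M) (hD : S.IsTorsionConnection D) :
    ((∀ (x : M) (u v : Spin7.TM x), Spin7.ricci D x u v = Spin7.ricci D x v u) ↔
      ∀ (x : M) (v : Fin 2 → Spin7.TM x),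
        Spin7.dNabla D S.lee x v =
          -(1 / 3 : ℝ) * S.leeContr S.deltaPhi x v +
            (1 / 6 : ℝ) * S.contrPhi (S.leeContr S.deltaPhi) x v) ∧
    ((∀ (x : M) (u v : Spin7.TM x), Spin7.ricci D x u v = Spin7.ricci D x v u) ↔
      ∀ (x : M) (v : Fin 2 → Spin7.TM x),
        Spin7.dNabla D S.lee x v =
          -(1 / 3 : ℝ) * S.leeContr (Spin7.torsionForm D) x v +
            (1 / 6 : ℝ) * S.contrPhi (S.leeContr (Spin7.torsionForm D)) x v) ∧
    ((∀ (x : M) (u v : Spin7.TM x), Spin7.ricci D x u v = Spin7.ricci D x v u) →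
      (∀ (x : M) (v : Fin 2 → Spin7.TM x),
        Spin7.dNabla D S.lee x v = -(1 / 6 : ℝ) * S.contrPhi (Spin7.dNabla D S.lee) x v) ∧
      S.MemLambda27 (Spin7.dNabla D S.lee)) := by
  have pointwise (x : M) := mainTheorem9_general hD x
  refine ⟨forall_congr' fun x ↦ (pointwise x).1, forall_congr' fun x ↦ (pointwise x).2.1,
    fun ricci_symm ↦ ?_⟩
  have consequences (x : M) := (pointwise x).2.2 (ricci_symm x)
  exact ⟨fun x ↦ (consequences x).1, fun x ↦ (consequences x).2.1, fun x ↦ (consequences x).2.2⟩
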